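/- There are a randomized algorithm $\mathcal A$ and universal constants $C_1,C_2,K,p>0$ such that for every $C_0>0$ there is a constant $A>0$ (depending only on $C_0$) for which the following holds. Let $d\in\mathbb N$, $\epsilon\in(0,1)$, $t^*\in\mathbb R$ with $|t^*|\le C_0\sqrt{\log(1/\epsilon)}$, and let $\mathbf w^*\in\mathbb R^d$ be a unit vector. Let $D$ be a probability distribution of $(\mathbf x,y)$ on $\mathbb R^d\times\{\pm1\}$ whose $\mathbf x$-marginal is the standard Gaussian $\mathcal N(\mathbf 0,\mathbf I_d)$. Put $f(\mathbf x)=\mathrm{sign}(\langle\mathbf w^*,\mathbf x\rangle-t^*)\in\{\pm1\}$ and suppose that $D$ satisfies the reliability condition with respect to $f$, that is, $\Pr_{(\mathbf x,y)\sim D}[f(\mathbf x)=+1\wedge y=-1]=0$, and that $\Pr_{(\mathbf x,y)\sim D}[y=-1]\ge\epsilon$. Let $$N=\frac{d^{\,C_1\max({t^*}^2,1)}}{\epsilon^2}.$$ Given $d,\epsilon,t^*$ and access to i.i.d. samples from $D$ (but not $\mathbf w^*$), the algorithm $\mathcal A$ always draws at most $N$ samples and halts after at most $K N^{K}$ steps,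 and with probability at least $p$ (over the samples and the internal coins) it outputs a unit vector $\mathbf v\in\mathbb R^d$ with $$\langle\mathbf v,\mathbf w^*\rangle\ \ge\ \max\Big(\max\big(\log(1/\epsilon),2\big)^{-C_2\max({t^*}^2,1)},\ \epsilon^{A}\Big).$$ Here an algorithm is a program of a real random-access machine (unit-cost $+,-,\times,/,\sqrt{\cdot}$ and comparisons on reals, addition and truncated subtraction on integers, indirect addressing, fair coin flips; reading a sample costs $d+1$ steps). -/

import Mathlib

open MeasureTheory ProbabilityTheory

noncomputable section

/-! Labelled examples, halfspaces, the reliability condition -/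

/-- A labelled example: a point of `ℝ^d` together with a label in `{±1}`. -/
abbrev Example (d : ℕ) : Type := EuclideanSpace ℝ (Fin d) × ℤˣ

/-- The halfspace `x ↦ sign (⟨w, x⟩ - t)`, with `sign 0 = +1`. -/
def halfspace {d : ℕ} (w : EuclideanSpace ℝ (Fin d)) (t : ℝ) (x : EuclideanSpace ℝ (Fin d)) : ℤˣ :=
  if 0 ≤ inner ℝ w x - t then 1 else -1

/-- `D` satisfies the reliability condition with respect to `f`:
`Pr_{(x,y) ∼ D} [f x = +1 ∧ y = -1] = 0`. -/
def ReliabilityCondition {d : ℕ} (D : Measure (Example d))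
    (f : EuclideanSpace ℝ (Fin d) → ℤˣ) : Prop :=
  D {z | f z.1 = 1 ∧ z.2 = -1} = 0

/-! A randomized real random-access machine with access to i.i.d. labelled examples.

The memory consists of cells indexed by `ℕ` holding natural numbers and of cells indexed by `ℕ`
holding real numbers. Programs are finite and contain no real constants. -/

namespace RealRAM

/-- Elementary instructions. Arguments are addresses of cells, except the constant `c`.
Natural numbers can only be added and subtracted (at unit cost), and there is no rounding. -/
inductive Instr : Type
  | natConst (i c : ℕ)
  | natAdd (i j k : ℕ)
  | natSub (i j k : ℕ)
  | natLoad (i j : ℕ)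
  | natStore (i j : ℕ)
  | ofNat (i j : ℕ)
  | add (i j k : ℕ)
  | sub (i j k : ℕ)
  | mul (i j k : ℕ)
  | div (i j k : ℕ)
  | sqrt (i j : ℕ)
  | load (i j : ℕ)
  | store (i j : ℕ)
  | flip (i : ℕ)
  | draw (i : ℕ)

/-- Comparisons of two cells. -/
inductive Test : Type
  | natLt (i j : ℕ)
  | lt (i j : ℕ)

/-- Programs. -/
inductive Prog : Type
  | skip
  | instr (a : Instr)
  | seq (p q : Prog)
  | ite (b : Test) (p q : Prog)
  | while (b : Test) (p : Prog)

/-- The memory, the number of examples drawn so far, and the number of coins flipped so far. -/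
structure State : Type where
  nat : ℕ → ℕ
  real : ℕ → ℝ
  drawn : ℕ
  flipped : ℕ

/-- The sources a run reads from: a sequence of labelled examples and a sequence of coins. -/
abbrev Tape (d : ℕ) : Type := (ℕ → Example d) × (ℕ → Bool)

def State.setNat (s : State) (i v : ℕ) : State := { s with nat := Function.update s.nat i v }

def State.setReal (s : State) (i : ℕ) (v : ℝ) : State :=
  { s with real := Function.update s.real i v }

/-- Write the coordinates of an example to the real cells `a, …, a + d - 1` and its label to the
real cell `a + d`. -/
def writeExample {d : ℕ} (a : ℕ) (z : Example d) (m : ℕ → ℝ) (j : ℕ) : ℝ :=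
  if h : a ≤ j ∧ j < a + d then z.1 ⟨j - a, by omega⟩
  else if j = a + d then ((z.2 : ℤ) : ℝ)
  else m j

/-- The effect of an elementary instruction. -/
def Instr.eval {d : ℕ} (T : Tape d) (s : State) : Instr → State
  | natConst i c => s.setNat i c
  | natAdd i j k => s.setNat i (s.nat j + s.nat k)
  | natSub i j k => s.setNat i (s.nat j - s.nat k)
  | natLoad i j => s.setNat i (s.nat (s.nat j))
  | natStore i j => s.setNat (s.nat i) (s.nat j)
  | ofNat i j => s.setReal i (s.nat j : ℝ)
  | add i j k => s.setReal i (s.real j + s.real k)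
  | sub i j k => s.setReal i (s.real j - s.real k)
  | mul i j k => s.setReal i (s.real j * s.real k)
  | div i j k => s.setReal i (s.real j / s.real k)
  | sqrt i j => s.setReal i (Real.sqrt (s.real j))
  | load i j => s.setReal i (s.real (s.nat j))
  | store i j => s.setReal (s.nat i) (s.real j)
  | flip i => { s.setNat i (T.2 s.flipped).toNat with flipped := s.flipped + 1 }
  | draw i => { s with real := writeExample (s.nat i) (T.1 s.drawn) s.real
                       drawn := s.drawn + 1 }

/-- The number of steps of an elementary instruction: `d + 1` for reading an example (one per
number read), and one for every other instruction. -/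
def Instr.cost (d : ℕ) : Instr → ℕ
  | draw _ => d + 1
  | _ => 1

def Test.Holds (s : State) : Test → Prop
  | natLt i j => s.nat i < s.nat j
  | lt i j => s.real i < s.real j

/-- `Exec T p s n s'`: started in the state `s` and reading from `T`, the program `p` halts after
exactly `n` steps in the state `s'`. Every evaluation of a test is one step. -/
inductive Exec {d : ℕ} (T : Tape d) : Prog → State → ℕ → State → Prop
  | skip (s : State) : Exec T .skip s 0 s
  | instr (a : Instr) (s : State) : Exec T (.instr a) s (a.cost d) (a.eval T s)
  | seq {p q : Prog} {s s' s'' : State} {m n : ℕ} :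
      Exec T p s m s' → Exec T q s' n s'' → Exec T (.seq p q) s (m + n) s''
  | ite_true {b : Test} {p q : Prog} {s s' : State} {n : ℕ} :
      b.Holds s → Exec T p s n s' → Exec T (.ite b p q) s (n + 1) s'
  | ite_false {b : Test} {p q : Prog} {s s' : State} {n : ℕ} :
      ¬ b.Holds s → Exec T q s n s' → Exec T (.ite b p q) s (n + 1) s'
  | while_true {b : Test} {p : Prog} {s s' s'' : State} {m n : ℕ} :
      b.Holds s → Exec T p s m s' → Exec T (.while b p) s' n s'' →
        Exec T (.while b p) s (m + n + 1) s''
  | while_false {b : Test} {p : Prog} {s : State} :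
      ¬ b.Holds s → Exec T (.while b p) s 1 s

/-- Runs are deterministic given the tape: the number of steps and the final state are unique. -/
theorem Exec.unique {d : ℕ} {T : Tape d} {p : Prog} {s s₁ s₂ : State} {n₁ n₂ : ℕ}
    (h₁ : Exec T p s n₁ s₁) (h₂ : Exec T p s n₂ s₂) : n₁ = n₂ ∧ s₁ = s₂ := by
  induction h₁ generalizing n₂ s₂ with
  | skip s => cases h₂; exact ⟨rfl, rfl⟩
  | instr a s => cases h₂; exact ⟨rfl, rfl⟩
  | seq _ _ ih₁ ih₂ =>
    cases h₂ with
    | seq h h' =>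
      obtain ⟨rfl, rfl⟩ := ih₁ h
      obtain ⟨rfl, rfl⟩ := ih₂ h'
      exact ⟨rfl, rfl⟩
  | ite_true hb _ ih =>
    cases h₂ with
    | ite_true _ h => obtain ⟨rfl, rfl⟩ := ih h; exact ⟨rfl, rfl⟩
    | ite_false hb' _ => exact absurd hb hb'
  | ite_false hb _ ih =>
    cases h₂ with
    | ite_true hb' _ => exact absurd hb' hb
    | ite_false _ h => obtain ⟨rfl, rfl⟩ := ih h; exact ⟨rfl, rfl⟩
  | while_true hb _ _ ih₁ ih₂ =>
    cases h₂ with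
    | while_true _ h h' =>
      obtain ⟨rfl, rfl⟩ := ih₁ h
      obtain ⟨rfl, rfl⟩ := ih₂ h'
      exact ⟨rfl, rfl⟩
    | while_false hb' => exact absurd hb hb'
  | while_false hb =>
    cases h₂ with
    | while_true hb' _ _ => exact absurd hb' hb
    | while_false _ => exact ⟨rfl, rfl⟩

/-- The initial state: the input consists of `d`, `ε` and `t`; all other cells hold `0`. -/
def initial (d : ℕ) (ε t : ℝ) : State where
  nat := fun i => if i = 0 then d else 0
  real := fun i => if i = 0 then ε else if i = 1 then t else 0
  drawn := 0
  flipped := 0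

/-- The output vector: the content of the real cells `0, …, d - 1`. -/
def output (d : ℕ) (s : State) : EuclideanSpace ℝ (Fin d) :=
  WithLp.toLp 2 fun i => s.real i

/-- The law of the tape: i.i.d. examples from `D` and, independently of them, i.i.d. fair coins. -/
def tapeLaw {d : ℕ} (D : Measure (Example d)) [IsProbabilityMeasure D] : Measure (Tape d) :=
  (Measure.infinitePi fun _ : ℕ => D).prod
    (Measure.infinitePi fun _ : ℕ => (PMF.uniformOfFintype Bool).toMeasure)

end RealRAM

/-- The sample bound `d ^ (C max(t², 1)) / ε²`. -/
def sampleBound (C : ℝ) (d : ℕ) (ε t : ℝ) : ℝ := (d : ℝ) ^ (C * max (t ^ 2) 1) / ε ^ 2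

end

/-! Write u = ⟨w, x⟩ and let P ≥ ε be the mass of the label -1. Reliability puts almost all negative
examples in {u < t}. For a suitable even m = O(max(t², 1)), `exists_threshold_hermite` gives a
combination of He_1, …, He_{m+1}, with no constant term, that is at most -1 on that range of u.
Integrating it over the negative examples shows that some moment E[1_{y=-1} He_{j+1}(u)] is at least
P up to a factor exponential in m, once the Hermite polynomials are suitably scaled.

The Hermite moments are read off from a multilinear object. Rotate x successively against m fresh
Gaussian vectors; this yields a residual and m split components. For Gaussian x these are again
independent standard Gaussians (`measurePreserving_splitAll`), while for fixed x the average over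
the noise of the product of the residual and j components, all paired with w, is an explicit
multiple of He_{j+1}(u) (`integral_resid_mul_prod_split`). Let `coef` be the tensor of the products
of these vectors, each extended by the constant 1, averaged over the negative examples. Let B be its
squared norm and S the squared norm of its contraction with w in the residual slot.

Two estimates carry the proof. The threshold polynomial gives P² ≤ 4096^m S (`sq_integral_lbl_le`).
Duality and hypercontractivity of multilinear Gaussian forms give B ≤ P^{2-1/q} (4q)^{m+1} for every
q ≥ 1 (`sum_coef_sq_pow_le`). The powers of P nearly cancel in S / B, and what is lost is P^{1/q}
and factors exponential in m.

The learner converts S / B into a correlation. It contracts the slots other than the residual with a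
random Gaussian group Z and multiplies by one more Gaussian coordinate, so that the resulting vector
has mean zero. Over R independent blocks, its inner product with w is a centred sum of variance R S
with controlled fourth moment, hence of order √(R S) and positive with constant probability. Its
length is O(√(R B)) by Markov's inequality, and the error of estimating conditional expectations
from n groups is a variance computation (`le_measure_learnerVec`). The correlation obtained is a
constant times √(S / B). The event does not depend on q: q ≈ log(1/ε) yields the logarithmic bound
and q = 1 yields ε^A (`exists_exponent`). All Gaussian vectors are positions of fresh examples.

The remainder verifies a real random-access program that evaluates this statistic on the stream of
samples: loop invariants, bounds for samples and steps, and the law of the stream cut into blocks.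
In dimension one the sample bound does not grow with m, so the program just normalises one example,
which is right with probability 1/2. -/

noncomputable section

/-! ### Functions with moments of all orders -/

section AllLp

variable {Ω : Type*} [MeasurableSpace Ω]

/-- All moments of `f` are finite. -/
def AllLp (f : Ω → ℝ) (μ : Measure Ω) : Prop := ∀ p : ℕ, MemLp f p μ

namespace AllLp

variable {μ : Measure Ω} {f g : Ω → ℝ}

theorem aesm (hf : AllLp f μ) : AEStronglyMeasurable f μ := (hf 0).1

theorem integrable (hf : AllLp f μ) : Integrable f μ :=
  memLp_one_iff_integrable.1 (by simpa using hf 1)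

theorem const [IsFiniteMeasure μ] (c : ℝ) : AllLp (fun _ => c) μ := fun _ => memLp_const c

theorem add (hf : AllLp f μ) (hg : AllLp g μ) : AllLp (fun x => f x + g x) μ :=
  fun p => (hf p).add (hg p)

theorem sub (hf : AllLp f μ) (hg : AllLp g μ) : AllLp (fun x => f x - g x) μ :=
  fun p => (hf p).sub (hg p)

theorem const_mul (hf : AllLp f μ) (c : ℝ) : AllLp (fun x => c * f x) μ :=
  fun p => (hf p).const_mul c

/-- Hölder with exponents 2p, 2p. Closure under products is the reason for demanding all moments at
once: every integrand below is built from Gaussian coordinates and bounded labels. -/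
theorem mul (hf : AllLp f μ) (hg : AllLp g μ) : AllLp (fun x => f x * g x) μ := by
  intro p
  have : ENNReal.HolderTriple ((2 * p : ℕ) : ENNReal) ((2 * p : ℕ) : ENNReal) (p : ENNReal) := by
    constructor
    push_cast
    rw [ENNReal.mul_inv (by simp) (by simp), ← add_mul, ENNReal.inv_two_add_inv_two, one_mul]
  exact (hg (2 * p)).mul' (hf (2 * p))

theorem pow [IsFiniteMeasure μ] (hf : AllLp f μ) (n : ℕ) : AllLp (fun x => f x ^ n) μ := by
  induction n with
  | zero => simpa using const 1
  | succ n ih => simpa only [pow_succ] using ih.mul hf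

theorem finsetSum {ι : Type*} {s : Finset ι} {f : ι → Ω → ℝ} (hf : ∀ i ∈ s, AllLp (f i) μ) :
    AllLp (fun x => ∑ i ∈ s, f i x) μ :=
  fun p => memLp_finsetSum s fun i hi => hf i hi p

theorem finsetProd [IsFiniteMeasure μ] {ι : Type*} {s : Finset ι} {f : ι → Ω → ℝ}
    (hf : ∀ i ∈ s, AllLp (f i) μ) : AllLp (fun x => ∏ i ∈ s, f i x) μ := by
  classical
  induction s using Finset.induction_on with
  | empty => simpa using const 1
  | insert i s hi ih =>
    simp only [Finset.prod_insert hi]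
    exact (hf i (by simp)).mul (ih fun j hj => hf j (by simp [hj]))

theorem comp {Ω' : Type*} [MeasurableSpace Ω'] {ν : Measure Ω'} {φ : Ω' → Ω}
    (hf : AllLp f μ) (hφ : MeasurePreserving φ ν μ) : AllLp (fun x => f (φ x)) ν :=
  fun p => (hf p).comp_measurePreserving hφ

end AllLp

end AllLp

/-! ### One-dimensional Gaussian integrals of polynomials -/

/-- The standard Gaussian measure on `ℝ`. -/
abbrev gauss : Measure ℝ := gaussianReal 0 1

theorem allLp_id_gauss : AllLp (fun x => x) gauss := fun p =>
  memLp_id_gaussianReal' p (by simp)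

open Polynomial

theorem allLp_polynomial {Ω : Type*} [MeasurableSpace Ω] {μ : Measure Ω} [IsFiniteMeasure μ]
    {f : Ω → ℝ} (hf : AllLp f μ) (p : ℝ[X]) :
    AllLp (fun x => p.eval (f x)) μ := by
  simp only [eval_eq_sum_range]
  exact AllLp.finsetSum fun i _ => (hf.pow i).const_mul _

theorem integrable_of_eq_polynomial {f : ℝ → ℝ} (p : ℝ[X]) (hf : ∀ x, f x = p.eval x) :
    Integrable f gauss :=
  (funext hf : f = _) ▸ (allLp_polynomial allLp_id_gauss p).integrable

theorem integrable_polynomial_gauss (p : ℝ[X]) : Integrable (fun x => p.eval x) gauss :=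
  (allLp_polynomial allLp_id_gauss p).integrable

/-- Stein's identity for polynomials. -/
theorem integral_X_mul_gauss (p : ℝ[X]) :
    ∫ x, x * p.eval x ∂gauss = ∫ x, (derivative p).eval x ∂gauss := by
  have hI : ∀ q : ℝ[X], Integrable (fun x => gaussianPDFReal 0 1 x * q.eval x) := by
    intro q
    have h := integrable_polynomial_gauss q
    rw [gauss, gaussianReal_of_var_ne_zero 0 one_ne_zero,
      integrable_withDensity_iff_integrable_smul₀'
        (measurable_gaussianPDF 0 1).aemeasurable
        (Filter.Eventually.of_forall fun x => gaussianPDF_lt_top)] at h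
    simpa using h
  have hd : ∀ x, HasDerivAt (fun x => gaussianPDFReal 0 1 x * p.eval x)
      (gaussianPDFReal 0 1 x * (derivative p - X * p).eval x) x := by
    intro x
    have h1 : HasDerivAt (gaussianPDFReal 0 1) (-x * gaussianPDFReal 0 1 x) x := by
      have h2 : HasDerivAt (fun x : ℝ => -(x - 0) ^ 2 / (2 * (1 : NNReal))) (-x) x := by
        have := (((hasDerivAt_id x).pow 2).neg).div_const 2
        refine (this.congr_deriv (by simp; ring)).congr_of_eventuallyEq (.of_forall fun y => by simp)
      have h3 := (h2.exp).const_mul (√(2 * Real.pi * (1 : NNReal)))⁻¹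
      exact h3.congr_deriv (by rw [gaussianPDFReal_def]; ring)
    exact (h1.mul (p.hasDerivAt x)).congr_deriv (by simp; ring)
  -- Integration by parts: the total derivative of density times polynomial integrates to zero.
  have h := integral_eq_zero_of_hasDerivAt_of_integrable hd (hI _) (hI p)
  have h' : ∫ x, (derivative p - X * p).eval x ∂gauss = 0 := by
    rw [gauss, integral_gaussianReal_eq_integral_smul one_ne_zero]
    simpa using h
  have h4 : ∫ x, ((derivative p).eval x - (X * p).eval x) ∂gauss = 0 := by
    simpa using h'
  rw [integral_sub (integrable_polynomial_gauss _) (integrable_polynomial_gauss _)] at h4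
  simp only [eval_mul, eval_X] at h4
  linarith

/-- The moments of the standard Gaussian. -/
def gmoment (n : ℕ) : ℝ := ∫ x, x ^ n ∂gauss

theorem gmoment_zero : gmoment 0 = 1 := by simp [gmoment]

theorem gmoment_add_two (n : ℕ) : gmoment (n + 2) = (n + 1) * gmoment n := by
  have := integral_X_mul_gauss (X ^ (n + 1))
  simp only [eval_pow, eval_X, derivative_X_pow, eval_mul, eval_natCast, map_natCast] at this
  rw [integral_const_mul] at this
  simp only [gmoment]
  rw [Nat.add_sub_cancel, Nat.cast_succ] at this
  rw [← this]
  congr 1; ext x; ring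

theorem gmoment_one : gmoment 1 = 0 := by
  have h := integral_X_mul_gauss 1
  simp only [eval_one, mul_one, derivative_one, eval_zero, integral_zero] at h
  simpa only [gmoment, pow_one] using h

theorem gmoment_odd (n : ℕ) : gmoment (2 * n + 1) = 0 := by
  induction n with
  | zero => simpa using gmoment_one
  | succ n ih => rw [show 2 * (n + 1) + 1 = 2 * n + 1 + 2 by ring, gmoment_add_two, ih, mul_zero]

theorem gmoment_even_pos (n : ℕ) : 0 < gmoment (2 * n) := by
  induction n with
  | zero => simp [gmoment_zero]
  | succ n ih =>
    rw [show 2 * (n + 1) = 2 * n + 2 by ring, gmoment_add_two]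
    positivity

theorem gmoment_even_le (n : ℕ) : gmoment (2 * n) ≤ (2 * n : ℝ) ^ n := by
  induction n with
  | zero => simp [gmoment_zero]
  | succ n ih =>
    rw [show 2 * (n + 1) = 2 * n + 2 by ring, gmoment_add_two, pow_succ', Nat.cast_succ]
    have h : (2 * n : ℝ) ^ n ≤ (2 * (n + 1)) ^ n := by gcongr; linarith
    push_cast
    exact mul_le_mul (by linarith) (ih.trans h) (gmoment_even_pos n).le (by positivity)

/-- Both sides satisfy a recursion in n, and (4n+3)(4n+1) ≤ 4(2n+1)². This controls the L² norm of
the threshold polynomial by its mean. -/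
theorem gmoment_four_mul_le (n : ℕ) : gmoment (4 * n) ≤ 4 ^ n * gmoment (2 * n) ^ 2 := by
  induction n with
  | zero => simp [gmoment_zero]
  | succ n ih =>
    rw [show 4 * (n + 1) = 4 * n + 2 + 2 by ring, gmoment_add_two, gmoment_add_two,
      show 2 * (n + 1) = 2 * n + 2 by ring, gmoment_add_two]
    push_cast
    have h0 : (0 : ℝ) ≤ n := n.cast_nonneg
    have h1 : 0 ≤ 4 ^ n * gmoment (2 * n) ^ 2 := by positivity
    calc (4 * n + 2 + 1) * ((4 * n + 1) * gmoment (4 * n))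
        ≤ (4 * n + 2 + 1) * ((4 * n + 1) * (4 ^ n * gmoment (2 * n) ^ 2)) := by gcongr
      _ = (4 * n + 2 + 1) * (4 * n + 1) * (4 ^ n * gmoment (2 * n) ^ 2) := by ring
      _ ≤ 4 * (2 * n + 1) ^ 2 * (4 ^ n * gmoment (2 * n) ^ 2) :=
        mul_le_mul_of_nonneg_right (by nlinarith) h1
      _ = _ := by ring

/-! ### Hermite polynomials -/

/-- The probabilists' Hermite polynomials over `ℝ`. -/
def He (n : ℕ) : ℝ[X] := (hermite n).map (Int.castRingHom ℝ)

theorem He_zero : He 0 = 1 := by simp [He]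

theorem He_succ (n : ℕ) : He (n + 1) = X * He n - derivative (He n) := by
  simp [He, hermite_succ, derivative_map]

theorem He_one : He 1 = X := by simp [He]

theorem derivative_He_succ (n : ℕ) : derivative (He (n + 1)) = (n + 1 : ℝ[X]) * He n := by
  induction n with
  | zero => simp [He_one, He_zero]
  | succ n ih =>
    rw [He_succ (n + 1), derivative_sub, derivative_mul, ih, derivative_mul]
    have : derivative ((n : ℝ[X]) + 1) = 0 := by simp
    rw [this, He_succ n]
    simp; ring

theorem He_succ_succ (n : ℕ) : He (n + 2) = X * He (n + 1) - (n + 1 : ℝ[X]) * He n := by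
  rw [He_succ (n + 1), derivative_He_succ]

theorem He_monic (n : ℕ) : (He n).Monic := (hermite_monic n).map _

theorem natDegree_He (n : ℕ) : (He n).natDegree = n := by
  rw [He, (hermite_monic n).natDegree_map, natDegree_hermite]

/-- By Stein's identity, p ↦ X p - p' is the adjoint of differentiation under the Gaussian;
orthogonality of the Hermite polynomials is the iteration of this. -/
theorem integral_He_succ_mul (n : ℕ) (q : ℝ[X]) :
    ∫ x, (He (n + 1)).eval x * q.eval x ∂gauss =
      ∫ x, (He n).eval x * (derivative q).eval x ∂gauss := by
  have h := integral_X_mul_gauss (He n * q)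
  have h1 : ∀ x, (He (n + 1)).eval x * q.eval x =
      x * (He n * q).eval x - (derivative (He n) * q).eval x := by
    intro x; simp [He_succ]; ring
  have hi : Integrable (fun x => x * (He n * q).eval x) gauss :=
    integrable_of_eq_polynomial (X * (He n * q)) fun x => by simp
  simp_rw [h1]
  rw [integral_sub hi (integrable_polynomial_gauss _), h,
    ← integral_sub (integrable_polynomial_gauss _) (integrable_polynomial_gauss _)]
  congr 1; ext x; simp

theorem integral_He_mul_He (n k : ℕ) :
    ∫ x, (He n).eval x * (He k).eval x ∂gauss = if n = k then (n.factorial : ℝ) else 0 := by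
  induction n generalizing k with
  | zero =>
    cases k with
    | zero => simp [He_zero]
    | succ k =>
      have := integral_He_succ_mul k 1
      simpa [He_zero] using this
  | succ n ih =>
    cases k with
    | zero =>
      have := integral_He_succ_mul n 1
      simpa [He_zero] using this
    | succ k =>
      rw [integral_He_succ_mul, derivative_He_succ]
      have : ∀ x, (He n).eval x * ((k + 1 : ℝ[X]) * He k).eval x =
          (k + 1 : ℝ) * ((He n).eval x * (He k).eval x) := by intro x; simp; ring
      simp_rw [this]
      rw [integral_const_mul, ih]
      by_cases h : n = k
      · simp [h, Nat.factorial_succ]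
      · simp [h]

/-- Every polynomial is a combination of Hermite polynomials. -/
theorem exists_He_expansion (n : ℕ) (p : ℝ[X]) (hp : p.natDegree ≤ n) :
    ∃ b : ℕ → ℝ, p = ∑ j ∈ Finset.range (n + 1), C (b j) * He j := by
  induction n generalizing p with
  | zero =>
    refine ⟨fun _ => p.coeff 0, ?_⟩
    rw [Finset.sum_range_one, He_zero, mul_one]
    exact eq_C_of_natDegree_le_zero hp
  | succ n ih =>
    -- The Hermite polynomials are monic, so the leading term can be subtracted off.
    obtain ⟨b, hb⟩ := ih (p - C (p.coeff (n + 1)) * He (n + 1)) (by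
      rw [natDegree_le_iff_coeff_eq_zero]
      intro N hN
      rw [coeff_sub, coeff_C_mul]
      rcases Nat.lt_or_ge (n + 1) N with h | h
      · rw [coeff_eq_zero_of_natDegree_lt (hp.trans_lt h),
          coeff_eq_zero_of_natDegree_lt (p := He (n + 1)) (by rwa [natDegree_He]), mul_zero, sub_zero]
      · obtain rfl : N = n + 1 := by omega
        have := (He_monic (n + 1)).coeff_natDegree
        rw [natDegree_He] at this
        rw [this, mul_one, sub_self])
    refine ⟨fun j => if j = n + 1 then p.coeff (n + 1) else b j, ?_⟩
    rw [Finset.sum_range_succ]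
    simp only [if_true]
    rw [Finset.sum_congr rfl (g := fun j => C (b j) * He j), ← hb]
    · ring
    · intro j hj
      rw [if_neg (by simp at hj; omega)]

/-- Expansion in Hermite polynomials, with Bessel's inequality. -/
theorem exists_He_expansion_bessel (n : ℕ) (p : ℝ[X]) (hp : p.natDegree ≤ n) :
    ∃ b : ℕ → ℝ, p = ∑ j ∈ Finset.range (n + 1), C (b j) * He j ∧
      b 0 = ∫ x, p.eval x ∂gauss ∧
      ∀ j ≤ n, b j ^ 2 * j.factorial ≤ ∫ x, p.eval x ^ 2 ∂gauss := by
  obtain ⟨b, hb⟩ := exists_He_expansion n p hp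
  have hc : ∀ j ≤ n, ∫ x, p.eval x * (He j).eval x ∂gauss = b j * j.factorial := by
    intro j hj
    have : ∀ x, p.eval x * (He j).eval x =
        ∑ i ∈ Finset.range (n + 1), b i * ((He i).eval x * (He j).eval x) := by
      intro x
      conv_lhs => rw [hb]
      rw [eval_finsetSum, Finset.sum_mul]
      exact Finset.sum_congr rfl fun i _ => by simp; ring
    simp_rw [this]
    rw [integral_finsetSum _ fun i _ => 
      (integrable_of_eq_polynomial (He i * He j) fun x => by simp).const_mul (b i)]
    simp_rw [integral_const_mul, integral_He_mul_He]
    rw [Finset.sum_eq_single j]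
    · simp
    · intro i _ hi; simp [hi]
    · intro h; simp at h; omega
  refine ⟨b, hb, ?_, fun j hj => ?_⟩
  · have := hc 0 (Nat.zero_le _)
    simpa [He_zero] using this.symm
  -- A single coefficient suffices, so only the projection onto `He j` is compared with p.
  · have h0 : 0 ≤ ∫ x, (p.eval x - b j * (He j).eval x) ^ 2 ∂gauss :=
      integral_nonneg fun x => sq_nonneg _
    have h1 : ∀ x, (p.eval x - b j * (He j).eval x) ^ 2 =
        p.eval x ^ 2 - 2 * b j * (p.eval x * (He j).eval x) +
          b j ^ 2 * ((He j).eval x * (He j).eval x) := by intro x; ring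
    simp_rw [h1] at h0
    have i1 : Integrable (fun x => p.eval x ^ 2) gauss := integrable_of_eq_polynomial (p ^ 2) fun x => by simp
    have i2 : Integrable (fun x => 2 * b j * (p.eval x * (He j).eval x)) gauss := 
      (integrable_of_eq_polynomial (p * He j) fun x => by simp).const_mul (2 * b j)
    have i3 : Integrable (fun x => b j ^ 2 * ((He j).eval x * (He j).eval x)) gauss := 
      (integrable_of_eq_polynomial (He j * He j) fun x => by simp).const_mul (b j ^ 2)
    rw [integral_add (f := fun x => _ - _) (i1.sub i2) i3, integral_sub i1 i2, integral_const_mul, integral_const_mul,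
      hc j hj, integral_He_mul_He, if_pos rfl] at h0
    linarith

end


/-! ### The threshold polynomial, and successive rotations in one dimension. -/

noncomputable section

open Polynomial

/-! ### A polynomial that is negative below a threshold -/

theorem sq_threshold_le (u s : ℝ) (hs : 0 ≤ s) :
    (u - s) ^ 2 * (u + s) ^ 4 ≤ 32 * (u ^ 6 + s ^ 6) := by
  have h := add_pow_le (abs_nonneg u) hs 6
  have h1 : |u - s| ≤ |u| + s := (abs_sub u s).trans_eq (by rw [abs_of_nonneg hs])
  have h2 : |u + s| ≤ |u| + s := (abs_add_le u s).trans_eq (by rw [abs_of_nonneg hs])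
  calc (u - s) ^ 2 * (u + s) ^ 4 = |u - s| ^ 2 * |u + s| ^ 4 := by
        rw [sq_abs, Even.pow_abs (by decide)]
    _ ≤ (|u| + s) ^ 2 * (|u| + s) ^ 4 := by gcongr
    _ = (|u| + s) ^ 6 := by ring
    _ ≤ _ := by
      rw [Even.pow_abs (by decide)] at h
      norm_num at h; exact h

/-- For `s² + 2 ≤ m`, a combination of the Hermite polynomials of degrees `1, …, m + 1` with
bounded coefficients that is at most `-1` on `(-∞, s]`. -/
theorem exists_threshold_hermite (m : ℕ) (hm : Even m) (s : ℝ) (hs : 1 ≤ s)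
    (hsm : s ^ 2 + 2 ≤ m) :
    ∃ b : ℕ → ℝ, (∀ u ≤ s, ∑ j ∈ Finset.range (m + 1), b j * (He (j + 1)).eval u ≤ -1) ∧
      ∀ j ≤ m, b j ^ 2 * (j + 1).factorial ≤ 72 * (m : ℝ) ^ 3 * 2 ^ m := by
  obtain ⟨k, rfl⟩ : ∃ k, m = 2 * k + 2 := by
    obtain ⟨l, hl⟩ := hm
    have : (2 : ℝ) < m := by nlinarith
    have : 2 < m := by exact_mod_cast this
    exact ⟨l - 1, by omega⟩
  -- The witness u^{2k} (u - s)(u + s)² is nonpositive on (-∞, s]. The square makes the mean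
  -- positive: the even part is s u^{2k} (u² - s²), and u^{2k} shifts the Gaussian weight to |u| > s
  -- as soon as s² < 2k + 1.
  have hk : s ^ 2 ≤ 2 * k := by push_cast at hsm; linarith
  set p : ℝ[X] := X ^ (2 * k) * (X - C s) * (X + C s) ^ 2 with hp
  have hpe : ∀ u, p.eval u = u ^ (2 * k) * (u - s) * (u + s) ^ 2 := by intro u; simp [hp]
  have hdeg : p.natDegree ≤ 2 * k + 3 := by
    have h1 : (X ^ (2 * k) : ℝ[X]).natDegree ≤ 2 * k := natDegree_X_pow_le _
    have h2 : (X - C s : ℝ[X]).natDegree ≤ 1 := (natDegree_X_sub_C _).le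
    have h3 : ((X + C s) ^ 2 : ℝ[X]).natDegree ≤ 2 * 1 :=
      natDegree_pow_le_of_le 2 (natDegree_X_add_C _).le
    have := natDegree_mul_le_of_le (natDegree_mul_le_of_le h1 h2) h3
    rwa [add_assoc] at this
  obtain ⟨b, hb, hb0, hbj⟩ := exists_He_expansion_bessel _ p hdeg
  set M := gmoment (2 * k) with hM
  have hMpos : 0 < M := gmoment_even_pos k
  have hI : ∀ n : ℕ, Integrable (fun u : ℝ => u ^ n) gauss := fun n =>
    integrable_of_eq_polynomial (X ^ n) fun x => by simp
  have hmean : b 0 = s * M * (2 * k + 1 - s ^ 2) := by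
    rw [hb0]
    have : ∀ u, p.eval u = (u ^ (2 * k + 3) + s * u ^ (2 * k + 2)) -
        (s ^ 2 * u ^ (2 * k + 1) + s ^ 3 * u ^ (2 * k)) := by intro u; rw [hpe]; ring
    simp_rw [this]
    rw [integral_sub (f := fun u => _ + _) (g := fun u => _ + _)
        ((hI _).add ((hI _).const_mul _)) (((hI _).const_mul _).add ((hI _).const_mul _)),
      integral_add (hI _) ((hI _).const_mul _),
      integral_add ((hI _).const_mul _) ((hI _).const_mul _)]
    simp_rw [integral_const_mul]
    change gmoment (2 * (k + 1) + 1) + s * gmoment (2 * k + 2) -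
      (s ^ 2 * gmoment (2 * k + 1) + s ^ 3 * M) = _
    rw [gmoment_odd, gmoment_odd, gmoment_add_two, ← hM]
    push_cast; ring
  have hmu : M ≤ b 0 := by
    rw [hmean]
    nlinarith [mul_le_mul_of_nonneg_left hs hMpos.le, mul_pos (by linarith : 0 < s) hMpos]
  have hmu0 : 0 < b 0 := hMpos.trans_le hmu
  have hnorm : ∫ u, p.eval u ^ 2 ∂gauss ≤ 72 * (2 * k + 2) ^ 3 * 2 ^ (2 * k + 2) * M ^ 2 := by
    have h1 : ∀ u, p.eval u ^ 2 ≤ 32 * u ^ (4 * k + 6) + 32 * s ^ 6 * u ^ (4 * k) := by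
      intro u
      have := mul_le_mul_of_nonneg_left (sq_threshold_le u s (by linarith))
        (by positivity : 0 ≤ (u ^ (2 * k)) ^ 2)
      rw [hpe]
      calc _ = (u ^ (2 * k)) ^ 2 * ((u - s) ^ 2 * (u + s) ^ 4) := by ring
        _ ≤ _ := this
        _ = _ := by ring
    have h2 := integral_mono (integrable_of_eq_polynomial (p ^ 2) fun x => by simp)
      (((hI (4 * k + 6)).const_mul 32).add ((hI (4 * k)).const_mul (32 * s ^ 6))) h1
    refine h2.trans ?_
    simp only [Pi.add_apply]
    rw [integral_add ((hI _).const_mul _) ((hI _).const_mul _), integral_const_mul,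
      integral_const_mul]
    change 32 * gmoment (4 * k + 2 + 2 + 2) + 32 * s ^ 6 * gmoment (4 * k) ≤ _
    rw [gmoment_add_two, gmoment_add_two, gmoment_add_two]
    have h3 : 0 < gmoment (4 * k) := by
      have := gmoment_even_pos (2 * k); rwa [show 2 * (2 * k) = 4 * k by ring] at this
    have h4 := gmoment_four_mul_le k
    have h5 : s ^ 6 ≤ (2 * k) ^ 3 := by
      calc s ^ 6 = (s ^ 2) ^ 3 := by ring
        _ ≤ _ := by gcongr
    have hk0 : (0 : ℝ) ≤ k := k.cast_nonneg
    push_cast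
    rw [show (4 * k + 4 + 1 : ℝ) = 4 * k + 2 + 2 + 1 by ring]
    calc 32 * ((4 * k + 2 + 2 + 1) * ((4 * k + 2 + 1) * ((4 * k + 1) * gmoment (4 * k)))) +
          32 * s ^ 6 * gmoment (4 * k)
        ≤ 32 * ((4 * k + 2 + 2 + 1) * ((4 * k + 2 + 1) * ((4 * k + 1) * gmoment (4 * k)))) +
          32 * (2 * k) ^ 3 * gmoment (4 * k) := by gcongr
      _ = (32 * ((4 * k + 2 + 2 + 1) * ((4 * k + 2 + 1) * (4 * k + 1)) + (2 * k) ^ 3)) *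
          gmoment (4 * k) := by ring
      _ ≤ (288 * (2 * k + 2) ^ 3) * gmoment (4 * k) := by
          refine mul_le_mul_of_nonneg_right ?_ h3.le
          nlinarith [pow_nonneg hk0 3, pow_nonneg hk0 2]
      _ ≤ (288 * (2 * k + 2) ^ 3) * (4 ^ k * M ^ 2) :=
          mul_le_mul_of_nonneg_left h4 (by positivity)
      _ = _ := by
          rw [pow_add 2, pow_mul 2 2 k]; norm_num; ring
  -- Dropping the constant coefficient `b 0` and dividing by it turns p ≤ 0 into the bound -1. The
  -- index shift accounts for the missing degree 0.
  refine ⟨fun j => b (j + 1) / b 0, fun u hu => ?_, fun j hj => ?_⟩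
  · have h1 : p.eval u = (∑ j ∈ Finset.range (2 * k + 2 + 1), b (j + 1) * (He (j + 1)).eval u) +
        b 0 := by
      conv_lhs => rw [hb, eval_finsetSum, Finset.sum_range_succ']
      simp [He_zero]
    have h2 : p.eval u ≤ 0 := by
      rw [hpe]
      have h3 : 0 ≤ u ^ (2 * k) := by rw [pow_mul]; positivity
      have h4 : u ^ (2 * k) * (u - s) ≤ 0 := mul_nonpos_of_nonneg_of_nonpos h3 (by linarith)
      exact mul_nonpos_of_nonpos_of_nonneg h4 (sq_nonneg _)
    have h3 : ∑ j ∈ Finset.range (2 * k + 2 + 1), b (j + 1) / b 0 * (He (j + 1)).eval u =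
        (p.eval u - b 0) / b 0 := by
      rw [h1, add_sub_cancel_right, Finset.sum_div]
      exact Finset.sum_congr rfl fun i _ => by ring
    rw [h3, div_le_iff₀ hmu0]
    linarith
  · have h1 := hbj (j + 1) (by omega)
    rw [div_pow, div_mul_eq_mul_div, div_le_iff₀ (by positivity)]
    calc _ ≤ _ := h1
      _ ≤ _ := hnorm
      _ ≤ _ := by push_cast; gcongr

/-! ### Splitting off the first coordinate of a finite product -/

theorem measurePreserving_cons {E : Type*} [MeasurableSpace E] (μ : Measure E) [SigmaFinite μ]
    (n : ℕ) : MeasurePreserving (fun p : E × (Fin n → E) => (Fin.cons p.1 p.2 : Fin (n + 1) → E))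
      (μ.prod (Measure.pi fun _ => μ)) (Measure.pi fun _ => μ) := by
  have h := (measurePreserving_piFinSuccAbove (fun _ : Fin (n + 1) => μ) 0).symm
  have e : (fun p : E × (Fin n → E) => (Fin.cons p.1 p.2 : Fin (n + 1) → E)) =
      ⇑(MeasurableEquiv.piFinSuccAbove (fun _ : Fin (n + 1) => E) 0).symm := by
    ext p i
    simp [MeasurableEquiv.piFinSuccAbove_symm_apply, Fin.insertNthEquiv]
  rw [e]
  exact h

theorem integral_pi_cons {E : Type*} [MeasurableSpace E] (μ : Measure E) [SigmaFinite μ]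
    (n : ℕ) {f : (Fin (n + 1) → E) → ℝ} (hf : Integrable f (Measure.pi fun _ => μ)) :
    ∫ x, f x ∂(Measure.pi fun _ => μ) =
      ∫ a, ∫ b, f (Fin.cons a b) ∂(Measure.pi fun _ => μ) ∂μ := by
  have h := measurePreserving_cons μ n
  have hi := h.integrable_comp hf.1 |>.2 hf
  rw [← h.map_eq, integral_map h.measurable.aemeasurable (by rw [h.map_eq]; exact hf.1),
    integral_prod (f := fun p => f (Fin.cons p.1 p.2)) hi]

/-! ### Splitting a Gaussian vector by successive rotations -/

section Resid

variable {V : Type*} [AddCommGroup V] [Module ℝ V]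

/-- The vector that remains of `x` after `i` rotations against the noise `ζ`. -/
def resid (c s : ℝ) (x : V) (ζ : ℕ → V) : ℕ → V
  | 0 => x
  | i + 1 => s • resid c s x ζ i - c • ζ i

/-- The vector split off by the `i`-th rotation. -/
def split (c s : ℝ) (x : V) (ζ : ℕ → V) (i : ℕ) : V := c • resid c s x ζ i + s • ζ i

/-- The definition peels off the last rotation; the inductions over independent noises need the
first one, after which the process restarts from s x - c ζ₀. -/
theorem resid_succ' (c s : ℝ) (x : V) (ζ : ℕ → V) (i : ℕ) :
    resid c s x ζ (i + 1) = resid c s (s • x - c • ζ 0) (fun j => ζ (j + 1)) i := by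
  induction i with
  | zero => rfl
  | succ i ih => rw [resid, ih, resid]

theorem split_succ' (c s : ℝ) (x : V) (ζ : ℕ → V) (i : ℕ) :
    split c s x ζ (i + 1) = split c s (s • x - c • ζ 0) (fun j => ζ (j + 1)) i := by
  rw [split, split, resid_succ']

/-- Allows the zero-extended finite noise of the analysis to be exchanged for the infinite stream
read by the program. -/
theorem resid_congr (c s : ℝ) (x : V) {ζ ξ : ℕ → V} {i : ℕ} (h : ∀ j < i, ζ j = ξ j) :
    resid c s x ζ i = resid c s x ξ i := by
  induction i with
  | zero => rfl
  | succ i ih => rw [resid, resid, ih fun j hj => h j (by omega), h i (by omega)]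

theorem split_congr (c s : ℝ) (x : V) {ζ ξ : ℕ → V} {i : ℕ} (h : ∀ j ≤ i, ζ j = ξ j) :
    split c s x ζ i = split c s x ξ i := by
  rw [split, split, resid_congr c s x fun j hj => h j hj.le, h i le_rfl]

theorem map_resid {W : Type*} [AddCommGroup W] [Module ℝ W] (L : V →ₗ[ℝ] W) (c s : ℝ) (x : V)
    (ζ : ℕ → V) (i : ℕ) : L (resid c s x ζ i) = resid c s (L x) (fun j => L (ζ j)) i := by
  induction i with
  | zero => rfl
  | succ i ih => rw [resid, resid, map_sub, map_smul, map_smul, ih]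

theorem map_split {W : Type*} [AddCommGroup W] [Module ℝ W] (L : V →ₗ[ℝ] W) (c s : ℝ) (x : V)
    (ζ : ℕ → V) (i : ℕ) : L (split c s x ζ i) = split c s (L x) (fun j => L (ζ j)) i := by
  rw [split, split, map_add, map_smul, map_smul, map_resid]

end Resid

/-- Extend a finite sequence by zero. -/
def ext0 {V : Type*} [Zero V] {m : ℕ} (n : Fin m → V) (i : ℕ) : V := if h : i < m then n ⟨i, h⟩ else 0

theorem ext0_cons_zero {V : Type*} [Zero V] {m : ℕ} (a : V) (n : Fin m → V) :
    ext0 (Fin.cons a n : Fin (m + 1) → V) 0 = a := by simp [ext0]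

theorem ext0_cons_succ {V : Type*} [Zero V] {m : ℕ} (a : V) (n : Fin m → V) (i : ℕ) :
    ext0 (Fin.cons a n : Fin (m + 1) → V) (i + 1) = ext0 n i := by
  by_cases h : i < m
  · simp only [ext0, Nat.add_lt_add_iff_right, h, dif_pos]
    exact Fin.cons_succ (α := fun _ => V) a n ⟨i, h⟩
  · simp [ext0, h]

theorem allLp_resid {Ω : Type*} [MeasurableSpace Ω] {μ : Measure Ω} {c s : ℝ}
    {x : Ω → ℝ} {ζ : Ω → ℕ → ℝ} (hx : AllLp x μ) (hζ : ∀ i, AllLp (fun ω => ζ ω i) μ) (i : ℕ) :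
    AllLp (fun ω => resid c s (x ω) (ζ ω) i) μ := by
  induction i with
  | zero => exact hx
  | succ i ih => exact (ih.const_mul s).sub ((hζ i).const_mul c)

theorem allLp_split {Ω : Type*} [MeasurableSpace Ω] {μ : Measure Ω} {c s : ℝ}
    {x : Ω → ℝ} {ζ : Ω → ℕ → ℝ} (hx : AllLp x μ) (hζ : ∀ i, AllLp (fun ω => ζ ω i) μ) (i : ℕ) :
    AllLp (fun ω => split c s (x ω) (ζ ω) i) μ :=
  ((allLp_resid hx hζ i).const_mul c).add ((hζ i).const_mul s)

theorem allLp_ext0_gauss {m : ℕ} (i : ℕ) :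
    AllLp (fun n : Fin m → ℝ => ext0 n i) (Measure.pi fun _ => gauss) := by
  by_cases h : i < m
  · simp only [ext0, h, dif_pos]
    exact allLp_id_gauss.comp (measurePreserving_eval (fun _ : Fin m => gauss) ⟨i, h⟩)
  · simpa only [ext0, h, dif_neg, not_false_eq_true] using AllLp.const 0

/-- The Ornstein–Uhlenbeck operator acts on Hermite polynomials by a scalar. -/
theorem integral_He_rotate (c s : ℝ) (hcs : c ^ 2 + s ^ 2 = 1) (l : ℕ) (u : ℝ) :
    ∫ n, (He l).eval (s * u - c * n) ∂gauss = s ^ l * (He l).eval u ∧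
    ∫ n, (c * u + s * n) * (He l).eval (s * u - c * n) ∂gauss =
      c * s ^ l * (He (l + 1)).eval u := by
  have hI : ∀ q : ℝ[X], Integrable (fun n => q.eval (s * u - c * n)) gauss := fun q =>
    integrable_of_eq_polynomial (q.comp (C (s * u) - C c * X)) fun x => by simp
  have hI' : ∀ q : ℝ[X], Integrable (fun n => n * q.eval (s * u - c * n)) gauss := fun q =>
    integrable_of_eq_polynomial (X * q.comp (C (s * u) - C c * X)) fun x => by simp
  have hstein : ∀ q : ℝ[X], ∫ n, n * q.eval (s * u - c * n) ∂gauss =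
      -c * ∫ n, (derivative q).eval (s * u - c * n) ∂gauss := by
    intro q
    have := integral_X_mul_gauss (q.comp (C (s * u) - C c * X))
    simp only [eval_comp, derivative_comp] at this
    simp only [eval_sub, eval_mul, eval_C, eval_X, derivative_sub, derivative_C, derivative_mul,
      zero_mul, derivative_X, mul_one, zero_add, zero_sub, eval_neg, eval_comp] at this
    rw [this, ← integral_const_mul]
  -- Strong induction along the three-term recurrence: Stein's identity turns the term with a factor
  -- n into one of degree l, and c² + s² = 1 recombines the result.
  have h1 : ∀ l, ∫ n, (He l).eval (s * u - c * n) ∂gauss = s ^ l * (He l).eval u := by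
    intro l
    induction l using Nat.strong_induction_on with
    | _ l ih =>
      match l with
      | 0 => simp [He_zero]
      | 1 =>
        have h0 := hstein 1
        simp only [eval_one, mul_one, derivative_one, eval_zero, integral_zero, mul_zero] at h0
        have hi := hI' 1
        simp only [eval_one, mul_one] at hi
        simp only [He_one, eval_X, pow_one]
        rw [integral_sub (integrable_const _) (hi.const_mul c), integral_const_mul c, h0]
        simp
      | l + 2 =>
        have e : ∀ n, (He (l + 2)).eval (s * u - c * n) =
            (s * u * (He (l + 1)).eval (s * u - c * n) -
              c * (n * (He (l + 1)).eval (s * u - c * n))) -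
            (l + 1) * (He l).eval (s * u - c * n) := by
          intro n; rw [He_succ_succ]; simp; ring
        simp_rw [e]
        rw [integral_sub (f := fun n => _ - _) (((hI _).const_mul _).sub ((hI' _).const_mul _))
            ((hI _).const_mul _),
          integral_sub ((hI _).const_mul _) ((hI' _).const_mul _)]
        simp_rw [integral_const_mul]
        rw [hstein, derivative_He_succ]
        have e2 : ∀ n, ((l + 1 : ℝ[X]) * He l).eval (s * u - c * n) =
            (l + 1) * (He l).eval (s * u - c * n) := by intro n; simp
        simp_rw [e2]
        rw [integral_const_mul, ih (l + 1) (by omega), ih l (by omega), He_succ_succ]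
        have hc : c ^ 2 = 1 - s ^ 2 := by linarith
        simp only [eval_sub, eval_mul, eval_X, eval_add, eval_natCast, eval_one]
        linear_combination (l + 1) * s ^ l * (He l).eval u * hc
  refine ⟨h1 l, ?_⟩
  have e : ∀ n, (c * u + s * n) * (He l).eval (s * u - c * n) =
      c * u * (He l).eval (s * u - c * n) + s * (n * (He l).eval (s * u - c * n)) := by
    intro n; ring
  simp_rw [e]
  rw [integral_add ((hI _).const_mul _) ((hI' _).const_mul _)]
  simp_rw [integral_const_mul]
  rw [hstein, h1]
  cases l with
  | zero => simp [He_zero, He_one]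
  | succ l =>
    rw [derivative_He_succ]
    have e2 : ∀ n, ((l + 1 : ℝ[X]) * He l).eval (s * u - c * n) =
        (l + 1) * (He l).eval (s * u - c * n) := by intro n; simp
    simp_rw [e2]
    rw [integral_const_mul, h1, He_succ_succ]
    simp only [eval_sub, eval_mul, eval_X, eval_add, eval_natCast, eval_one]
    ring

/-- The factor by which the noise shrinks a product of `j` split components and the residual. -/
def shrink (c s : ℝ) : ℕ → ℕ → ℝ
  | m, 0 => s ^ m
  | 0, _ + 1 => 0
  | m + 1, j + 1 => c * s ^ (j + 1) * shrink c s m j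

/-- Averaging over the noise, a product of split components and the residual is a Hermite
polynomial. -/
theorem integral_resid_mul_prod_split (c s : ℝ) (hcs : c ^ 2 + s ^ 2 = 1) (m j : ℕ) (hj : j ≤ m)
    (u : ℝ) :
    ∫ n : Fin m → ℝ, resid c s u (ext0 n) m * ∏ i ∈ Finset.range j, split c s u (ext0 n) i
      ∂(Measure.pi fun _ => gauss) = shrink c s m j * (He (j + 1)).eval u := by
  induction m generalizing j u with
  | zero =>
    obtain rfl : j = 0 := by omega
    simp [resid, shrink, He_one]
  | succ m ih =>
    rw [integral_pi_cons gauss m ((allLp_resid (AllLp.const u) allLp_ext0_gauss _).mul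
      (AllLp.finsetProd fun i _ =>
        allLp_split (AllLp.const u) allLp_ext0_gauss i)).integrable]
    simp_rw [resid_succ', ext0_cons_zero, ext0_cons_succ]
    cases j with
    | zero =>
      have := ih 0 (by omega)
      simp only [Finset.range_zero, Finset.prod_empty, mul_one, smul_eq_mul] at this ⊢
      simp_rw [this]
      rw [integral_const_mul, (integral_He_rotate c s hcs 1 u).1, shrink, shrink]
      ring
    | succ j =>
      have := ih j (by omega)
      simp_rw [Finset.prod_range_succ', split_succ', ext0_cons_zero, ext0_cons_succ]
      simp only [split, resid, ext0_cons_zero, smul_eq_mul] at this ⊢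
      simp_rw [← mul_assoc, integral_mul_const, this]
      -- By the induction hypothesis the later rotations have become a Hermite polynomial in the new
      -- residual; the first split component raises its degree by one.
      have e : ∀ a, shrink c s m j * (He (j + 1)).eval (s * u - c * a) * (c * u + s * a) =
          shrink c s m j * ((c * u + s * a) * (He (j + 1)).eval (s * u - c * a)) := by
        intro a; ring
      simp_rw [e]
      rw [integral_const_mul, (integral_He_rotate c s hcs (j + 1) u).2, shrink]
      ring

end


/-! ### Multilinear forms in independent features, hypercontractivity, and Gaussian vectors. -/

noncomputable section

/-- The inner integral is over the first slot, the order required for hypercontractivity by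
induction on slots. -/
theorem integral_pi_cons_symm {E : Type*} [MeasurableSpace E] (μ : Measure E) [SigmaFinite μ]
    (n : ℕ) {f : (Fin (n + 1) → E) → ℝ} (hf : Integrable f (Measure.pi fun _ => μ)) :
    ∫ x, f x ∂(Measure.pi fun _ => μ) =
      ∫ b, ∫ a, f (Fin.cons a b) ∂μ ∂(Measure.pi fun _ => μ) := by
  have h := measurePreserving_cons μ n
  have hi := h.integrable_comp hf.1 |>.2 hf
  rw [← h.map_eq, integral_map h.measurable.aemeasurable (by rw [h.map_eq]; exact hf.1),
    integral_prod_symm (f := fun p => f (Fin.cons p.1 p.2)) hi]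

/-! ### Polynomials that are multilinear in independent families of features -/

section Features

variable {ι Ω : Type*}

/-- The product of one feature per slot. -/
def monom (e : ι → Ω → ℝ) {k : ℕ} (I : Fin k → ι) (x : Fin k → Ω) : ℝ := ∏ i, e (I i) (x i)

/-- The multilinear form with coefficients `T`. -/
def multi [Fintype ι] (e : ι → Ω → ℝ) {k : ℕ} (T : (Fin k → ι) → ℝ) (x : Fin k → Ω) : ℝ :=
  ∑ I, T I * monom e I x

theorem sum_cons [Fintype ι] {k : ℕ} (F : (Fin (k + 1) → ι) → ℝ) :
    ∑ I, F I = ∑ α, ∑ I : Fin k → ι, F (Fin.cons α I) := by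
  rw [← (Fin.consEquiv fun _ => ι).sum_comp, Fintype.sum_prod_type]
  rfl

theorem monom_cons (e : ι → Ω → ℝ) {k : ℕ} (α : ι) (I : Fin k → ι) (a : Ω) (x : Fin k → Ω) :
    monom e (Fin.cons α I : Fin (k + 1) → ι) (Fin.cons a x : Fin (k + 1) → Ω) =
      e α a * monom e I x := by
  simp [monom, Fin.prod_univ_succ]

theorem multi_cons [Fintype ι] (e : ι → Ω → ℝ) {k : ℕ} (T : (Fin (k + 1) → ι) → ℝ) (a : Ω) (x : Fin k → Ω) :
    multi e T (Fin.cons a x : Fin (k + 1) → Ω) =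
      ∑ α, multi e (fun I => T (Fin.cons α I)) x * e α a := by
  rw [multi, sum_cons]
  refine Finset.sum_congr rfl fun α _ => ?_
  rw [multi, Finset.sum_mul]
  refine Finset.sum_congr rfl fun I _ => ?_
  rw [monom_cons]; ring

variable [MeasurableSpace Ω] {μ : Measure Ω} [IsProbabilityMeasure μ] {e : ι → Ω → ℝ}

theorem allLp_monom (he : ∀ α, AllLp (e α) μ) {k : ℕ} (I : Fin k → ι) :
    AllLp (monom e I) (Measure.pi fun _ => μ) :=
  AllLp.finsetProd fun i _ => (he (I i)).comp (measurePreserving_eval (fun _ => μ) i)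

theorem integral_monom_mul_monom [DecidableEq ι]
    (ho : ∀ α β, ∫ x, e α x * e β x ∂μ = if α = β then 1 else 0) {k : ℕ} (I J : Fin k → ι) :
    ∫ x, monom e I x * monom e J x ∂(Measure.pi fun _ => μ) = if I = J then 1 else 0 := by
  simp_rw [monom, ← Finset.prod_mul_distrib]
  rw [integral_fintype_prod_eq_prod (f := fun i x => e (I i) x * e (J i) x)]
  simp_rw [ho]
  by_cases h : I = J
  · simp [h]
  · obtain ⟨i, hi⟩ := Function.ne_iff.1 h
    rw [if_neg h]
    exact Finset.prod_eq_zero (Finset.mem_univ i) (if_neg hi)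

variable [Fintype ι]

theorem allLp_multi (he : ∀ α, AllLp (e α) μ) {k : ℕ} (T : (Fin k → ι) → ℝ) :
    AllLp (multi e T) (Measure.pi fun _ => μ) :=
  AllLp.finsetSum fun I _ => (allLp_monom he I).const_mul _

theorem integral_multi_mul_multi [DecidableEq ι] (he : ∀ α, AllLp (e α) μ)
    (ho : ∀ α β, ∫ x, e α x * e β x ∂μ = if α = β then 1 else 0) {k : ℕ}
    (T U : (Fin k → ι) → ℝ) :
    ∫ x, multi e T x * multi e U x ∂(Measure.pi fun _ => μ) = ∑ I, T I * U I := by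
  have h : ∀ x, multi e T x * multi e U x =
      ∑ I, ∑ J, T I * U J * (monom e I x * monom e J x) := by
    intro x
    rw [multi, multi, Finset.sum_mul_sum]
    exact Finset.sum_congr rfl fun I _ => Finset.sum_congr rfl fun J _ => by ring
  have hi : ∀ I J : Fin k → ι, Integrable (fun x => T I * U J * (monom e I x * monom e J x))
      (Measure.pi fun _ => μ) := fun I J =>
    (((allLp_monom he I).mul (allLp_monom he J)).const_mul _).integrable
  simp_rw [h]
  rw [integral_finsetSum _ fun I _ => integrable_finsetSum _ fun J _ => hi I J]
  refine Finset.sum_congr rfl fun I _ => ?_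
  rw [integral_finsetSum _ fun J _ => hi I J]
  simp_rw [integral_const_mul, integral_monom_mul_monom ho]
  simp

/-- A weighted form of Minkowski's inequality for sums of squares. -/
theorem integral_sum_sq_pow_le {Ω' : Type*} [MeasurableSpace Ω'] {ν : Measure Ω'}
    [IsFiniteMeasure ν] (q : ℕ) (hq : 1 ≤ q) (C : ℝ) (hC : 0 ≤ C) (f : ι → Ω' → ℝ) (a : ι → ℝ)
    (hf : ∀ α, AllLp (f α) ν) (ha : ∀ α, 0 ≤ a α) (h0 : ∀ α, a α = 0 → ∀ x, f α x = 0)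
    (hb : ∀ α, ∫ x, f α x ^ (2 * q) ∂ν ≤ C * a α ^ q) :
    ∫ x, (∑ α, f α x ^ 2) ^ q ∂ν ≤ C * (∑ α, a α) ^ q := by
  obtain ⟨q, rfl⟩ : ∃ r, q = r + 1 := ⟨q - 1, by omega⟩
  set A := ∑ α, a α with hA
  rcases (Finset.sum_nonneg fun α _ => ha α : 0 ≤ A).eq_or_lt with hA0 | hA0
  · have hA1 : 0 ≤ A := hA0.le
    have : ∀ α, a α = 0 := fun α =>
      (Finset.sum_eq_zero_iff_of_nonneg fun α _ => ha α).1 hA0.symm α (Finset.mem_univ α)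
    have h1 : ∀ α x, f α x = 0 := fun α x => h0 α (this α) x
    simp only [h1]
    simpa using mul_nonneg hC (pow_nonneg hA1 (q + 1))
  have hA' : A ≠ 0 := hA0.ne'
  -- Jensen's inequality for the weights `a α / A`. Each term then has its own moment bound with
  -- exactly compensating powers of `a α`; indices with `a α = 0` contribute nothing by `h0`.
  have hpt : ∀ x, (∑ α, f α x ^ 2) ^ (q + 1) ≤
      ∑ α, (a α / A) * ((A / a α) ^ (q + 1) * f α x ^ (2 * (q + 1))) := by
    intro x
    have h1 := Real.pow_arith_mean_le_arith_mean_pow Finset.univ (fun α => a α / A)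
      (fun α => A / a α * f α x ^ 2) (fun α _ => div_nonneg (ha α) hA0.le)
      (by rw [← Finset.sum_div, div_self hA0.ne'])
      (fun α _ => mul_nonneg (div_nonneg hA0.le (ha α)) (sq_nonneg _)) (q + 1)
    have h2 : ∑ α, a α / A * (A / a α * f α x ^ 2) = ∑ α, f α x ^ 2 := by
      refine Finset.sum_congr rfl fun α _ => ?_
      by_cases h : a α = 0
      · simp [h, h0 α h x]
      · field_simp
    rw [h2] at h1
    refine h1.trans_eq (Finset.sum_congr rfl fun α _ => ?_)
    rw [mul_pow, ← pow_mul]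
  have hint : ∀ α, Integrable (fun x => a α / A * ((A / a α) ^ (q + 1) * f α x ^ (2 * (q + 1)))) ν :=
    fun α => ((((hf α).pow _).const_mul _).const_mul _).integrable
  calc _ ≤ ∫ x, ∑ α, (a α / A) * ((A / a α) ^ (q + 1) * f α x ^ (2 * (q + 1))) ∂ν :=
        integral_mono ((AllLp.finsetSum fun α _ => (hf α).pow 2).pow _).integrable
          (integrable_finsetSum _ fun α _ => hint α) hpt
    _ = ∑ α, (a α / A) * ((A / a α) ^ (q + 1) * ∫ x, f α x ^ (2 * (q + 1)) ∂ν) := by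
        rw [integral_finsetSum _ fun α _ => hint α]
        simp_rw [integral_const_mul]
    _ ≤ ∑ α, a α * (C * A ^ q) := by
        refine Finset.sum_le_sum fun α _ => ?_
        rcases (ha α).eq_or_lt with h | h
        · simp [← h]
        · calc _ ≤ (a α / A) * ((A / a α) ^ (q + 1) * (C * a α ^ (q + 1))) := by
                have := hb α
                gcongr
            _ = _ := by
                have := h.ne'
                rw [div_pow, pow_succ A]
                field_simp
    _ = _ := by rw [← Finset.sum_mul, ← hA]; ring

/-- Hypercontractivity for multilinear forms in independent slots. -/
theorem integral_multi_pow_le (he : ∀ α, AllLp (e α) μ) (q : ℕ) (hq : 1 ≤ q) (C : ℝ)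
    (hC : 0 ≤ C) (h1 : ∀ t : ι → ℝ, ∫ x, (∑ α, t α * e α x) ^ (2 * q) ∂μ ≤ C * (∑ α, t α ^ 2) ^ q)
    {k : ℕ} (T : (Fin k → ι) → ℝ) :
    ∫ x, multi e T x ^ (2 * q) ∂(Measure.pi fun _ => μ) ≤ C ^ k * (∑ I, T I ^ 2) ^ q := by
  induction k with
  | zero => simp [multi, monom, pow_mul]
  | succ k ih =>
    have hL := (allLp_multi he T).pow (2 * q)
    rw [integral_pi_cons_symm μ k hL.integrable]
    simp_rw [multi_cons]
    have hin : Integrable (fun b => ∫ a, (∑ α, multi e (fun I => T (Fin.cons α I)) b * e α a) ^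
        (2 * q) ∂μ) (Measure.pi fun _ : Fin k => μ) := by
      have := (measurePreserving_cons μ k).integrable_comp hL.integrable.1 |>.2 hL.integrable
      have := this.integral_prod_right
      simpa only [Function.comp_def, multi_cons] using this
    -- With the other slots frozen, the form is linear in the first slot, so the one-slot inequality
    -- `h1` applies; Minkowski then feeds the induction hypothesis for each α.
    calc _ ≤ ∫ b, C * (∑ α, multi e (fun I => T (Fin.cons α I)) b ^ 2) ^ q
          ∂(Measure.pi fun _ : Fin k => μ) := by
          refine integral_mono hin ?_ fun b => h1 _
          exact (((AllLp.finsetSum fun α _ => (allLp_multi he _).pow 2).pow q).const_mul C).integrable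
      _ = C * ∫ b, (∑ α, multi e (fun I => T (Fin.cons α I)) b ^ 2) ^ q
          ∂(Measure.pi fun _ : Fin k => μ) := integral_const_mul _ _
      _ ≤ C * (C ^ k * (∑ α, ∑ I, T (Fin.cons α I) ^ 2) ^ q) := by
          gcongr
          refine integral_sum_sq_pow_le q hq (C ^ k) (by positivity) _ _
            (fun α => allLp_multi he _) (fun α => Finset.sum_nonneg fun I _ => sq_nonneg _)
            (fun α h0 x => ?_) (fun α => ih _)
          have : ∀ I : Fin k → ι, T (Fin.cons α I) = 0 := fun I => by
            have := (Finset.sum_eq_zero_iff_of_nonneg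
              fun (I : Fin k → ι) _ => sq_nonneg (T (Fin.cons α I))).1 h0 I (Finset.mem_univ I)
            simpa using this
          simp [multi, this]
      _ = _ := by rw [sum_cons fun I => T I ^ 2]; ring

end Features

/-! ### Features of a Gaussian vector -/

section Gaussian

variable {d : ℕ}

/-- The constant feature and the coordinates. -/
def feat (α : Option (Fin d)) (x : EuclideanSpace ℝ (Fin d)) : ℝ := α.elim 1 fun a => x a

@[simp] theorem feat_none (x : EuclideanSpace ℝ (Fin d)) : feat none x = 1 := rfl

@[simp] theorem feat_some (a : Fin d) (x : EuclideanSpace ℝ (Fin d)) : feat (some a) x = x a := rfl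

/-- The standard Gaussian on `ℝ^d`. -/
abbrev gaussE (d : ℕ) : Measure (EuclideanSpace ℝ (Fin d)) :=
  stdGaussian (EuclideanSpace ℝ (Fin d))

theorem measurePreserving_toLp_gauss (d : ℕ) :
    MeasurePreserving (WithLp.toLp 2) (Measure.pi fun _ : Fin d => gauss) (gaussE d) :=
  ⟨by fun_prop, map_pi_eq_stdGaussian⟩

theorem measurePreserving_coord (a : Fin d) :
    MeasurePreserving (fun x : EuclideanSpace ℝ (Fin d) => x a) (gaussE d) gauss := by
  refine ⟨by fun_prop, ?_⟩
  rw [← (measurePreserving_toLp_gauss d).map_eq, Measure.map_map (by fun_prop) (by fun_prop)]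
  exact (measurePreserving_eval (fun _ : Fin d => gauss) a).map_eq

theorem allLp_coord (a : Fin d) :
    AllLp (fun x : EuclideanSpace ℝ (Fin d) => x a) (gaussE d) :=
  allLp_id_gauss.comp (measurePreserving_coord a)

theorem allLp_feat (α : Option (Fin d)) : AllLp (feat α) (gaussE d) := by
  cases α with
  | none => exact AllLp.const 1
  | some a => exact allLp_coord a

theorem integral_coord (a : Fin d) : ∫ x, x a ∂gaussE d = 0 := by
  rw [← integral_map (φ := fun x : EuclideanSpace ℝ (Fin d) => x a) (f := fun x => x)
    (by fun_prop) (by fun_prop), (measurePreserving_coord a).map_eq]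
  simp

theorem integral_coord_mul_coord (a b : Fin d) :
    ∫ x, x a * x b ∂gaussE d = if a = b then 1 else 0 := by
  rw [← (measurePreserving_toLp_gauss d).map_eq, integral_map (by fun_prop) (by fun_prop)]
  have h : ∀ x : Fin d → ℝ, x a * x b =
      ∏ i, (if i = a then x i else 1) * (if i = b then x i else 1) := by
    intro x; rw [Finset.prod_mul_distrib]; simp
  simp only [h]
  rw [integral_fintype_prod_eq_prod
    (f := fun i y => (if i = a then y else 1) * (if i = b then y else 1))]
  have g1 : ∫ x, x ∂gauss = 0 := by simp
  have g2 : ∫ x, x * x ∂gauss = 1 := by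
    have := gmoment_add_two 0
    simpa [gmoment, sq] using this
  split_ifs with hab
  · subst hab
    refine Finset.prod_eq_one fun i _ => ?_
    by_cases hi : i = a <;> simp [hi, g2]
  · refine Finset.prod_eq_zero (Finset.mem_univ a) ?_
    simp [hab, g1]

theorem integral_feat_mul_feat (α β : Option (Fin d)) :
    ∫ x, feat α x * feat β x ∂gaussE d = if α = β then 1 else 0 := by
  cases α <;> cases β <;> simp [integral_coord, integral_coord_mul_coord]

theorem gaussE_map_inner (v : EuclideanSpace ℝ (Fin d)) :
    (gaussE d).map (fun x => inner ℝ v x) = gauss.map (fun n => ‖v‖ * n) := by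
  have h := IsGaussian.map_eq_gaussianReal (μ := gaussE d) (innerSL ℝ v)
  rw [integral_strongDual_stdGaussian, variance_dual_stdGaussian, innerSL_apply_norm] at h
  rw [gauss, gaussianReal_map_const_mul]
  convert h using 2
  · rfl
  · exact mul_zero _
  · rw [mul_one]
    apply NNReal.eq
    simp

theorem integral_inner_gaussE (v : EuclideanSpace ℝ (Fin d)) {φ : ℝ → ℝ} (hφ : Measurable φ) :
    ∫ x, φ (inner ℝ v x) ∂gaussE d = ∫ n, φ (‖v‖ * n) ∂gauss := by
  rw [← integral_map (φ := fun x => inner ℝ v x) (f := φ) (by fun_prop)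
    hφ.aestronglyMeasurable, gaussE_map_inner, integral_map (by fun_prop)
    hφ.aestronglyMeasurable]

/-- From (1 + n²)^q ≤ 2^{q-1} (1 + n^{2q}), where both 1 and the Gaussian moment are at most (2q)^q.
-/
theorem integral_one_add_sq_pow_le (q : ℕ) (hq : 1 ≤ q) :
    ∫ n, (1 + n ^ 2) ^ q ∂gauss ≤ (4 * q : ℝ) ^ q := by
  have hI : Integrable (fun n : ℝ => n ^ (2 * q)) gauss := (allLp_id_gauss.pow _).integrable
  have h1 : ∀ n : ℝ, (1 + n ^ 2) ^ q ≤ 2 ^ (q - 1) * (1 + n ^ (2 * q)) := fun n => by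
    have := add_pow_le (zero_le_one' ℝ) (sq_nonneg n) q
    rwa [one_pow, ← pow_mul] at this
  calc _ ≤ ∫ n, 2 ^ (q - 1) * (1 + n ^ (2 * q)) ∂gauss :=
        integral_mono (((AllLp.const 1).add (allLp_id_gauss.pow 2)).pow q).integrable
          (((integrable_const _).add hI).const_mul _) h1
    _ = 2 ^ (q - 1) * (1 + gmoment (2 * q)) := by
        rw [integral_const_mul, integral_add (integrable_const _) hI]; simp [gmoment]
    _ ≤ 2 ^ (q - 1) * ((2 * q) ^ q + (2 * q) ^ q) := by
        have h2 : (1 : ℝ) ≤ (2 * q) ^ q := one_le_pow₀ (by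
          have : (1 : ℝ) ≤ q := by exact_mod_cast hq
          linarith)
        gcongr
        exact gmoment_even_le q
    _ = 2 ^ (q - 1 + 1) * (2 * q) ^ q := by rw [pow_succ]; ring
    _ = _ := by rw [Nat.sub_add_cancel hq, ← mul_pow]; ring

/-- The one-slot input of hypercontractivity. The form depends on x only through one Gaussian
direction, and Cauchy–Schwarz separates its coefficients from 1 + n². -/
theorem integral_feat_pow_le (q : ℕ) (hq : 1 ≤ q) (t : Option (Fin d) → ℝ) :
    ∫ x, (∑ α, t α * feat α x) ^ (2 * q) ∂gaussE d ≤ (4 * q : ℝ) ^ q * (∑ α, t α ^ 2) ^ q := by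
  set v : EuclideanSpace ℝ (Fin d) := WithLp.toLp 2 fun a => t (some a) with hv
  have h1 : ∀ x, ∑ α, t α * feat α x = t none + inner ℝ v x := by
    intro x
    simp [Fintype.sum_option, hv, PiLp.inner_apply, mul_comm]
  have h2 : ∑ α, t α ^ 2 = t none ^ 2 + ‖v‖ ^ 2 := by
    simp [Fintype.sum_option, hv, EuclideanSpace.norm_sq_eq]
  simp_rw [h1]
  rw [h2, integral_inner_gaussE v (φ := fun y => (t none + y) ^ (2 * q)) (by fun_prop)]
  have h3 : ∀ n : ℝ, (t none + ‖v‖ * n) ^ (2 * q) ≤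
      (t none ^ 2 + ‖v‖ ^ 2) ^ q * (1 + n ^ 2) ^ q := by
    intro n
    rw [pow_mul, ← mul_pow]
    refine pow_le_pow_left₀ (sq_nonneg _) ?_ q
    nlinarith [sq_nonneg (t none * n - ‖v‖)]
  have hA : AllLp (fun n : ℝ => (1 + n ^ 2) ^ q) gauss :=
    ((AllLp.const 1).add (allLp_id_gauss.pow 2)).pow q
  calc _ ≤ ∫ n, (t none ^ 2 + ‖v‖ ^ 2) ^ q * (1 + n ^ 2) ^ q ∂gauss :=
        integral_mono (((AllLp.const _).add (allLp_id_gauss.const_mul _)).pow _).integrable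
          (hA.const_mul _).integrable h3
    _ = (t none ^ 2 + ‖v‖ ^ 2) ^ q * ∫ n, (1 + n ^ 2) ^ q ∂gauss := integral_const_mul _ _
    _ ≤ (t none ^ 2 + ‖v‖ ^ 2) ^ q * (4 * q) ^ q := by
        gcongr; exact integral_one_add_sq_pow_le q hq
    _ = _ := mul_comm _ _

/-! ### The successive rotations preserve the Gaussian measure -/

/-- A rotation by arccos c followed by a sign change of the second vector; both preserve the
Gaussian. -/
theorem measurePreserving_reflect (c s : ℝ) (hc : 0 ≤ c) (hs : 0 ≤ s) (hcs : c ^ 2 + s ^ 2 = 1) :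
    MeasurePreserving (fun p : EuclideanSpace ℝ (Fin d) × EuclideanSpace ℝ (Fin d) =>
      (c • p.1 + s • p.2, s • p.1 - c • p.2)) ((gaussE d).prod (gaussE d))
      ((gaussE d).prod (gaussE d)) := by
  have h1 := IsGaussian.map_rotation_eq_self_of_forall_strongDual_eq_zero (μ := gaussE d)
    (fun L => integral_strongDual_stdGaussian L) (Real.arccos c)
  have hc1 : c ≤ 1 := by nlinarith
  have e1 : Real.cos (Real.arccos c) = c := Real.cos_arccos (by linarith) hc1
  have e2 : Real.sin (Real.arccos c) = s := by
    rw [Real.sin_arccos, show 1 - c ^ 2 = s ^ 2 by linarith, Real.sqrt_sq hs]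
  have hr : MeasurePreserving (ContinuousLinearMap.rotation (Real.arccos c))
      ((gaussE d).prod (gaussE d)) ((gaussE d).prod (gaussE d)) := ⟨by fun_prop, h1⟩
  have hn : MeasurePreserving (fun x : EuclideanSpace ℝ (Fin d) => -x) (gaussE d) (gaussE d) :=
    ⟨by fun_prop, stdGaussian_map (LinearIsometryEquiv.neg ℝ)⟩
  have := ((MeasurePreserving.id (gaussE d)).prod hn).comp hr
  convert this using 1
  ext1 p
  simp [ContinuousLinearMap.rotation_apply, e1, e2]
  abel

/-- The residual followed by the components split off. -/
def splitAll (c s : ℝ) {m : ℕ} {V : Type*} [AddCommGroup V] [Module ℝ V] (X : Fin (m + 1) → V) :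
    Fin (m + 1) → V :=
  Fin.cons (resid c s (X 0) (ext0 (Fin.tail X)) m)
    fun i => split c s (X 0) (ext0 (Fin.tail X)) i

/-- The inductive structure: reflect the first pair, set the split component aside in position 1,
and continue with the new residual and the remaining noise. -/
theorem splitAll_cons_cons (c s : ℝ) {m : ℕ} {V : Type*} [AddCommGroup V] [Module ℝ V] (x z : V)
    (t : Fin m → V) :
    splitAll c s (Fin.cons x (Fin.cons z t : Fin (m + 1) → V) : Fin (m + 2) → V) =
      Fin.insertNth (α := fun _ => V) 1 (c • x + s • z)
        (splitAll c s (Fin.cons (s • x - c • z) t : Fin (m + 1) → V)) := by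
  have e1 : ext0 (Fin.cons z t : Fin (m + 1) → V) 0 = z := ext0_cons_zero _ _
  have e2 : (fun j => ext0 (Fin.cons z t : Fin (m + 1) → V) (j + 1)) = ext0 t :=
    funext fun i => ext0_cons_succ _ _ _
  rw [Fin.eq_insertNth_iff]
  constructor
  · rw [show (1 : Fin (m + 2)) = Fin.succ 0 from rfl]
    simp [splitAll, split, resid, e1]
  · ext1 i
    refine Fin.cases ?_ (fun i => ?_) i
    · simp only [Fin.removeNth, splitAll, Fin.cons_zero, Fin.tail_cons]
      rw [show Fin.succAbove (1 : Fin (m + 2)) 0 = 0 from rfl]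
      simp only [Fin.cons_zero, resid_succ', e1, e2]
    · simp only [Fin.removeNth, splitAll, Fin.cons_zero, Fin.tail_cons, Fin.cons_succ]
      rw [show Fin.succAbove (1 : Fin (m + 2)) i.succ = i.succ.succ from
        Fin.succAbove_of_lt_succ _ _ (by simp [Fin.lt_def])]
      simp only [Fin.cons_succ, Fin.val_succ, split_succ', e1, e2]

theorem measurePreserving_splitAll (c s : ℝ) (hc : 0 ≤ c) (hs : 0 ≤ s) (hcs : c ^ 2 + s ^ 2 = 1)
    (m : ℕ) :
    MeasurePreserving (splitAll c s : (Fin (m + 1) → EuclideanSpace ℝ (Fin d)) → _)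
      (Measure.pi fun _ => gaussE d) (Measure.pi fun _ => gaussE d) := by
  induction m with
  | zero =>
    convert MeasurePreserving.id (Measure.pi fun _ : Fin 1 => gaussE d) using 1
    ext1 X
    ext1 i
    obtain rfl : i = 0 := Fin.fin_one_eq_zero i
    rfl
  | succ m ih =>
    let E := EuclideanSpace ℝ (Fin d)
    have h0 : MeasurePreserving (MeasurableEquiv.piFinSuccAbove (fun _ : Fin (m + 2) => E) 0)
        (Measure.pi fun _ => gaussE d) ((gaussE d).prod (Measure.pi fun _ => gaussE d)) :=
      measurePreserving_piFinSuccAbove (fun _ : Fin (m + 2) => gaussE d) 0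
    have h1 : MeasurePreserving (MeasurableEquiv.piFinSuccAbove (fun _ : Fin (m + 1) => E) 0)
        (Measure.pi fun _ => gaussE d) ((gaussE d).prod (Measure.pi fun _ => gaussE d)) :=
      measurePreserving_piFinSuccAbove (fun _ : Fin (m + 1) => gaussE d) 0
    have h2 := (MeasurePreserving.id (gaussE d)).prod h1
    have h3 := (measurePreserving_prodAssoc (gaussE d) (gaussE d)
      (Measure.pi fun _ : Fin m => gaussE d)).symm
    have h4 := (measurePreserving_reflect (d := d) c s hc hs hcs).prod
      (MeasurePreserving.id (Measure.pi fun _ : Fin m => gaussE d))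
    have h5 := measurePreserving_prodAssoc (gaussE d) (gaussE d)
      (Measure.pi fun _ : Fin m => gaussE d)
    have h6 := (MeasurePreserving.id (gaussE d)).prod (ih.comp (measurePreserving_cons (gaussE d) m))
    have h7 : MeasurePreserving (MeasurableEquiv.piFinSuccAbove (fun _ : Fin (m + 2) => E) 1).symm
        ((gaussE d).prod (Measure.pi fun _ => gaussE d)) (Measure.pi fun _ => gaussE d) :=
      (measurePreserving_piFinSuccAbove (fun _ : Fin (m + 2) => gaussE d) 1).symm
    -- Read from right to left: isolate x and the first noise, reflect the pair, reassociate, apply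
    -- the induction hypothesis to the tail, and reinsert the component.
    have := h7.comp (h6.comp (h5.comp (h4.comp (h3.comp (h2.comp h0)))))
    convert this using 1
    ext1 X
    induction X using Fin.consCases with
    | _ x X =>
      induction X using Fin.consCases with
      | _ z t =>
        rw [splitAll_cons_cons]
        rfl

end Gaussian

end


/-! ### The moment tensor of the negative examples: upper bound, and relation to Hermite moments. -/

noncomputable section

/-! ### Product coefficients and lifted coefficients -/

section Multi

variable {ι Ω : Type*} [Fintype ι]

theorem sum_prod_eq_prod_sum {k : ℕ} (τ : Fin k → ι → ℝ) :
    ∑ I : Fin k → ι, ∏ i, τ i (I i) = ∏ i, ∑ α, τ i α := by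
  rw [Finset.prod_univ_sum, Fintype.piFinset_univ]

theorem multi_prod (e : ι → Ω → ℝ) {k : ℕ} (τ : Fin k → ι → ℝ) (x : Fin k → Ω) :
    multi e (fun I => ∏ i, τ i (I i)) x = ∏ i, ∑ α, τ i α * e α (x i) := by
  rw [multi, ← sum_prod_eq_prod_sum]
  simp_rw [monom, Finset.prod_mul_distrib]

/-- Put the feature `α₀` into the first slot. -/
def liftCoef [DecidableEq ι] (α₀ : ι) {k : ℕ} (U : (Fin k → ι) → ℝ) (I : Fin (k + 1) → ι) : ℝ :=
  if I 0 = α₀ then U (Fin.tail I) else 0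

theorem sum_liftCoef_mul [DecidableEq ι] (α₀ : ι) {k : ℕ} (U : (Fin k → ι) → ℝ)
    (F : (Fin (k + 1) → ι) → ℝ) :
    ∑ I, liftCoef α₀ U I * F I = ∑ I, U I * F (Fin.cons α₀ I) := by
  rw [sum_cons, Finset.sum_eq_single α₀]
  · simp [liftCoef]
  · intro β _ hβ
    simp [liftCoef, hβ]
  · simp

theorem sum_liftCoef_sq [DecidableEq ι] (α₀ : ι) {k : ℕ} (U : (Fin k → ι) → ℝ) :
    ∑ I, liftCoef α₀ U I ^ 2 = ∑ I, U I ^ 2 := by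
  simp_rw [sq, sum_liftCoef_mul]
  simp [liftCoef]

theorem multi_liftCoef [DecidableEq ι] (e : ι → Ω → ℝ) (α₀ : ι) {k : ℕ} (U : (Fin k → ι) → ℝ)
    (x : Fin (k + 1) → Ω) :
    multi e (liftCoef α₀ U) x = e α₀ (x 0) * multi e U (Fin.tail x) := by
  rw [multi, sum_liftCoef_mul, multi, Finset.mul_sum]
  refine Finset.sum_congr rfl fun I _ => ?_
  rw [← Fin.cons_self_tail x, monom_cons]
  simp; ring

end Multi

/-! ### Labelled examples -/

section Examples

variable {d : ℕ}

/-- The indicator of the label `-1`. -/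
def lbl (z : Example d) : ℝ := (1 - ((z.2 : ℤ) : ℝ)) / 2

theorem lbl_eq (z : Example d) : lbl z = if z.2 = -1 then 1 else 0 := by
  rcases Int.units_eq_one_or z.2 with h | h <;> simp [lbl, h]

theorem lbl_nonneg (z : Example d) : 0 ≤ lbl z := by rw [lbl_eq]; split_ifs <;> norm_num

theorem lbl_le_one (z : Example d) : lbl z ≤ 1 := by rw [lbl_eq]; split_ifs <;> norm_num

theorem measurable_unitsVal : Measurable (Units.val : ℤˣ → ℤ) := comap_measurable _

theorem measurable_lbl : Measurable (lbl : Example d → ℝ) := by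
  have h1 : Measurable fun z : Example d => ((z.2 : ℤ) : ℝ) :=
    (Measurable.of_discrete (f := fun n : ℤ => (n : ℝ))).comp
      (measurable_unitsVal.comp measurable_snd)
  exact (measurable_const.sub h1).div_const 2

theorem measurableSet_label : MeasurableSet {z : Example d | z.2 = -1} := by
  have h : {z : Example d | z.2 = -1} = lbl ⁻¹' {1} := by
    ext z
    simp only [Set.mem_ofPred_eq, Set.mem_preimage, Set.mem_singleton_iff, lbl_eq]
    split_ifs <;> simp_all
  rw [h]
  exact measurable_lbl (measurableSet_singleton 1)

variable {D : Measure (Example d)}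

theorem integral_lbl : ∫ z, lbl z ∂D = D.real {z | z.2 = -1} := by
  have h : (lbl : Example d → ℝ) = Set.indicator {z | z.2 = -1} 1 := by
    ext z; simp [lbl_eq, Set.indicator_apply]
  rw [h, integral_indicator_one measurableSet_label]

theorem measurePreserving_fst_of_map (hD : D.map Prod.fst = gaussE d) :
    MeasurePreserving Prod.fst D (gaussE d) := ⟨measurable_fst, hD⟩

/-- The positions of a group of examples. -/
def pos {k : ℕ} (G : Fin k → Example d) (i : Fin k) : EuclideanSpace ℝ (Fin d) := (G i).1

theorem measurePreserving_pos (hD : D.map Prod.fst = gaussE d) (k : ℕ) :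
    MeasurePreserving (pos : (Fin k → Example d) → _) (Measure.pi fun _ => D)
      (Measure.pi fun _ => gaussE d) :=
  measurePreserving_pi _ _ fun _ => measurePreserving_fst_of_map hD

variable [IsProbabilityMeasure D]

theorem allLp_lbl : AllLp (lbl : Example d → ℝ) D := fun p =>
  MemLp.of_bound measurable_lbl.aestronglyMeasurable 1 (.of_forall fun z => by
    rw [Real.norm_eq_abs, abs_of_nonneg (lbl_nonneg z)]
    exact lbl_le_one z)

/-- A power mean inequality for weights bounded by one. -/
theorem integral_weight_mul_pow_le {Ω : Type*} [MeasurableSpace Ω] {μ : Measure Ω}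
    [IsFiniteMeasure μ] {w f : Ω → ℝ} (hw : AllLp w μ) (hf : AllLp f μ) (hw0 : ∀ x, 0 ≤ w x)
    (hw1 : ∀ x, w x ≤ 1) (hP : 0 < ∫ x, w x ∂μ) (q : ℕ) (hq : 1 ≤ q) :
    (∫ x, w x * f x ∂μ) ^ (2 * q) ≤ (∫ x, w x ∂μ) ^ (2 * q - 1) * ∫ x, f x ^ (2 * q) ∂μ := by
  set P := ∫ x, w x ∂μ with hPdef
  set a := (∫ x, w x * f x ∂μ) / P with ha
  have haP : ∫ x, w x * f x ∂μ = a * P := by rw [ha, div_mul_cancel₀ _ hP.ne']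
  -- The tangent line of x^{2q} at the weighted mean a, which proves Jensen's inequality for the
  -- measure w/P. Finally w ≤ 1 discards the weight on the right.
  have key : ∀ x, a ^ (2 * q) + 2 * q * a ^ (2 * q - 1) * (x - a) ≤ x ^ (2 * q) := by
    intro x
    have hE : Even (2 * q) := even_two_mul q
    by_cases ha0 : a = 0
    · rw [ha0, zero_pow (by omega), zero_pow (by omega)]
      simpa using hE.pow_nonneg x
    have hx : x = a * (1 + (x - a) / a) := by field_simp; ring
    have hb : 1 + ((2 * q : ℕ) : ℝ) * ((x - a) / a) ≤ (1 + (x - a) / a) ^ (2 * q) := by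
      by_cases h : -2 ≤ (x - a) / a
      · exact one_add_mul_le_pow h _
      · have h1 : (1 : ℝ) ≤ q := by exact_mod_cast hq
        have h2 := hE.pow_nonneg (1 + (x - a) / a)
        push_cast
        nlinarith
    calc _ = a ^ (2 * q) * (1 + ((2 * q : ℕ) : ℝ) * ((x - a) / a)) := by
          have : a ^ (2 * q) = a ^ (2 * q - 1) * a := by rw [← pow_succ]; congr 1; omega
          rw [this]; push_cast; field_simp
      _ ≤ a ^ (2 * q) * (1 + (x - a) / a) ^ (2 * q) :=
          mul_le_mul_of_nonneg_left hb (hE.pow_nonneg a)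
      _ = x ^ (2 * q) := by rw [← mul_pow, ← hx]
  have h1 : ∫ x, w x * (a ^ (2 * q) + 2 * q * a ^ (2 * q - 1) * (f x - a)) ∂μ ≤
      ∫ x, f x ^ (2 * q) ∂μ := by
    refine integral_mono (hw.mul ((AllLp.const _).add ((hf.sub (AllLp.const a)).const_mul
      (2 * q * a ^ (2 * q - 1))))).integrable (hf.pow _).integrable fun x => ?_
    have h2 := mul_le_mul_of_nonneg_left (key (f x)) (hw0 x)
    refine h2.trans ?_
    have := (even_two_mul q).pow_nonneg (f x)
    nlinarith [hw1 x]
  have h2 : ∫ x, w x * (a ^ (2 * q) + 2 * q * a ^ (2 * q - 1) * (f x - a)) ∂μ =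
      P * a ^ (2 * q) := by
    have e : ∀ x, w x * (a ^ (2 * q) + 2 * q * a ^ (2 * q - 1) * (f x - a)) =
        (a ^ (2 * q) - 2 * q * a ^ (2 * q - 1) * a) * w x +
          2 * q * a ^ (2 * q - 1) * (w x * f x) := by intro x; ring
    simp_rw [e]
    rw [integral_add (hw.const_mul _).integrable ((hw.mul hf).const_mul _).integrable,
      integral_const_mul, integral_const_mul, haP]
    ring
  rw [h2] at h1
  rw [haP, mul_pow]
  have : P ^ (2 * q) = P ^ (2 * q - 1) * P := by rw [← pow_succ]; congr 1; omega
  rw [this]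
  calc _ = P ^ (2 * q - 1) * (P * a ^ (2 * q)) := by ring
    _ ≤ _ := by gcongr

/-! ### The moment tensor of the negative examples -/

/-- The coefficients of the moment tensor of the negative examples after splitting. -/
def coef (D : Measure (Example d)) (c s : ℝ) {m : ℕ} (I : Fin (m + 1) → Option (Fin d)) : ℝ :=
  ∫ G : Fin (m + 1) → Example d, lbl (G 0) * monom feat I (splitAll c s (pos G))
    ∂(Measure.pi fun _ => D)

variable {c s : ℝ} {m : ℕ}

theorem allLp_lbl_zero : AllLp (fun G : Fin (m + 1) → Example d => lbl (G 0))
    (Measure.pi fun _ => D) :=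
  allLp_lbl.comp (measurePreserving_eval (fun _ : Fin (m + 1) => D) 0)

theorem measurePreserving_splitAll_pos {D : Measure (Example d)}
    (hD : D.map Prod.fst = gaussE d) (hc : 0 ≤ c) (hs : 0 ≤ s)
    (hcs : c ^ 2 + s ^ 2 = 1) :
    MeasurePreserving (fun G : Fin (m + 1) → Example d => splitAll c s (pos G))
      (Measure.pi fun _ => D) (Measure.pi fun _ => gaussE d) :=
  (measurePreserving_splitAll c s hc hs hcs m).comp (measurePreserving_pos hD (m + 1))

theorem allLp_multi_split {D : Measure (Example d)}
    (hD : D.map Prod.fst = gaussE d) (hc : 0 ≤ c) (hs : 0 ≤ s)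
    (hcs : c ^ 2 + s ^ 2 = 1) (T : (Fin (m + 1) → Option (Fin d)) → ℝ) :
    AllLp (fun G : Fin (m + 1) → Example d => multi feat T (splitAll c s (pos G)))
      (Measure.pi fun _ => D) :=
  (allLp_multi allLp_feat T).comp (measurePreserving_splitAll_pos hD hc hs hcs)

/-- Makes the tensor a linear functional on multilinear forms: its norm is estimated by testing with
itself, its contractions by testing with product tensors. -/
theorem sum_mul_coef (hD : D.map Prod.fst = gaussE d) (hc : 0 ≤ c) (hs : 0 ≤ s)
    (hcs : c ^ 2 + s ^ 2 = 1) (T : (Fin (m + 1) → Option (Fin d)) → ℝ) :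
    ∑ I, T I * coef D c s I = ∫ G : Fin (m + 1) → Example d,
      lbl (G 0) * multi feat T (splitAll c s (pos G)) ∂(Measure.pi fun _ => D) := by
  have e : ∀ G : Fin (m + 1) → Example d, lbl (G 0) * multi feat T (splitAll c s (pos G)) =
      ∑ I, T I * (lbl (G 0) * monom feat I (splitAll c s (pos G))) := by
    intro G
    rw [multi, Finset.mul_sum]
    exact Finset.sum_congr rfl fun I _ => by ring
  simp_rw [e]
  rw [integral_finsetSum _ fun I _ => ((allLp_lbl_zero.mul
    ((allLp_monom allLp_feat I).comp (measurePreserving_splitAll_pos hD hc hs hcs))).const_mul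
      (T I)).integrable]
  simp_rw [integral_const_mul]
  rfl

theorem integral_lbl_zero : ∫ G : Fin (m + 1) → Example d, lbl (G 0) ∂(Measure.pi fun _ => D) =
    ∫ z, lbl z ∂D :=
  integral_comp_eval (μ := fun _ : Fin (m + 1) => D) (i := 0) allLp_lbl.aesm

/-- The moment tensor of the negative examples is small. -/
theorem sum_coef_sq_pow_le (hD : D.map Prod.fst = gaussE d) (hc : 0 ≤ c) (hs : 0 ≤ s)
    (hcs : c ^ 2 + s ^ 2 = 1) (hP : 0 < ∫ z, lbl z ∂D) (q : ℕ) (hq : 1 ≤ q) :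
    (∑ I : Fin (m + 1) → Option (Fin d), coef D c s I ^ 2) ^ q ≤
      (∫ z, lbl z ∂D) ^ (2 * q - 1) * ((4 * q) ^ q) ^ (m + 1) := by
  set B := ∑ I : Fin (m + 1) → Option (Fin d), coef D c s I ^ 2 with hB
  have hB0 : 0 ≤ B := Finset.sum_nonneg fun I _ => sq_nonneg _
  -- Duality: the squared norm is the pairing of the tensor with its own form F. The power mean
  -- inequality bounds B^{2q} by P^{2q-1} E F^{2q}, hypercontractivity gives back B^q, and one
  -- factor B^q cancels.
  have hBi : B = ∫ G : Fin (m + 1) → Example d,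
      lbl (G 0) * multi feat (coef D c s) (splitAll c s (pos G)) ∂(Measure.pi fun _ => D) := by
    rw [← sum_mul_coef hD hc hs hcs, hB]
    exact Finset.sum_congr rfl fun I _ => sq _
  have h1 := integral_weight_mul_pow_le (μ := Measure.pi fun _ : Fin (m + 1) => D)
    (w := fun G => lbl (G 0)) allLp_lbl_zero
    (allLp_multi_split hD hc hs hcs (coef D c s)) (fun G => lbl_nonneg _) (fun G => lbl_le_one _)
    (by rwa [integral_lbl_zero]) q hq
  rw [← hBi, integral_lbl_zero] at h1
  have h2 : ∫ G : Fin (m + 1) → Example d, multi feat (coef D c s) (splitAll c s (pos G)) ^ (2 * q)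
      ∂(Measure.pi fun _ => D) ≤ ((4 * q) ^ q) ^ (m + 1) * B ^ q := by
    have hmp := measurePreserving_splitAll_pos (m := m) hD hc hs hcs
    rw [← integral_map (φ := fun G : Fin (m + 1) → Example d => splitAll c s (pos G))
      (f := fun x => multi feat (coef D c s) x ^ (2 * q)) hmp.measurable.aemeasurable
      (by rw [hmp.map_eq]; exact ((allLp_multi allLp_feat _).pow _).aesm), hmp.map_eq]
    exact integral_multi_pow_le allLp_feat q hq _ (by positivity) (integral_feat_pow_le q hq) _
  rcases hB0.eq_or_lt with h | h
  · rw [← h, zero_pow (by omega)]; positivity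
  · have h3 : B ^ q * B ^ q ≤
        ((∫ z, lbl z ∂D) ^ (2 * q - 1) * ((4 * q) ^ q) ^ (m + 1)) * B ^ q := by
      calc B ^ q * B ^ q = B ^ (2 * q) := by rw [← pow_add]; congr 1; omega
        _ ≤ _ := h1
        _ ≤ (∫ z, lbl z ∂D) ^ (2 * q - 1) * (((4 * q) ^ q) ^ (m + 1) * B ^ q) := by gcongr
        _ = _ := by ring
    exact le_of_mul_le_mul_right h3 (by positivity)

/-! ### The moment tensor is large in the direction of the halfspace -/

/-- The contraction of the moment tensor with `w` in the first slot. -/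
def contract (D : Measure (Example d)) (c s : ℝ) (w : EuclideanSpace ℝ (Fin d)) {m : ℕ}
    (I : Fin m → Option (Fin d)) : ℝ :=
  ∑ a, w a * coef D c s (Fin.cons (some a) I : Fin (m + 1) → Option (Fin d))

/-- The coefficients of the linear form given by `w`. -/
def wfeat (w : EuclideanSpace ℝ (Fin d)) (α : Option (Fin d)) : ℝ := α.elim 0 fun a => w a

theorem sum_wfeat_mul_feat (w x : EuclideanSpace ℝ (Fin d)) :
    ∑ α, wfeat w α * feat α x = inner ℝ w x := by
  simp [Fintype.sum_option, wfeat, PiLp.inner_apply, mul_comm]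

theorem sum_wfeat_sq (w : EuclideanSpace ℝ (Fin d)) : ∑ α, wfeat w α ^ 2 = ‖w‖ ^ 2 := by
  simp [Fintype.sum_option, wfeat, EuclideanSpace.norm_sq_eq]

theorem measurePreserving_inner {w : EuclideanSpace ℝ (Fin d)} (hw : ‖w‖ = 1) :
    MeasurePreserving (fun x : EuclideanSpace ℝ (Fin d) => inner ℝ w x) (gaussE d) gauss := by
  refine ⟨by fun_prop, ?_⟩
  rw [gaussE_map_inner, hw]
  simp

/-- Averaging over the noise turns products of split components into Hermite polynomials. -/
theorem integral_lbl_mul_split (hD : D.map Prod.fst = gaussE d) (hcs : c ^ 2 + s ^ 2 = 1)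
    {w : EuclideanSpace ℝ (Fin d)} (hw : ‖w‖ = 1) (j : ℕ) (hj : j ≤ m) :
    ∫ G : Fin (m + 1) → Example d, lbl (G 0) *
        (resid c s (inner ℝ w (pos G 0)) (ext0 fun i => inner ℝ w (pos G (Fin.succ i))) m *
          ∏ i ∈ Finset.range j,
            split c s (inner ℝ w (pos G 0)) (ext0 fun i => inner ℝ w (pos G (Fin.succ i))) i)
        ∂(Measure.pi fun _ => D) =
      ∫ z, lbl z * (shrink c s m j * (He (j + 1)).eval (inner ℝ w z.1)) ∂D := by
  have hmp : MeasurePreserving (fun z : Example d => (inner ℝ w z.1 : ℝ)) D gauss :=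
    (measurePreserving_inner hw).comp (measurePreserving_fst_of_map hD)
  have hmpi : MeasurePreserving (fun (G : Fin m → Example d) i => (inner ℝ w (G i).1 : ℝ))
      (Measure.pi fun _ => D) (Measure.pi fun _ => gauss) :=
    measurePreserving_pi _ _ fun _ => hmp
  have hx : AllLp (fun G : Fin (m + 1) → Example d => (inner ℝ w (pos G 0) : ℝ))
      (Measure.pi fun _ => D) :=
    allLp_id_gauss.comp (hmp.comp (measurePreserving_eval (fun _ : Fin (m + 1) => D) 0))
  have hζ : ∀ i, AllLp (fun G : Fin (m + 1) → Example d =>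
      ext0 (fun i : Fin m => (inner ℝ w (pos G (Fin.succ i)) : ℝ)) i) (Measure.pi fun _ => D) := by
    intro i
    by_cases h : i < m
    · simp only [ext0, h, dif_pos]
      exact allLp_id_gauss.comp (hmp.comp (measurePreserving_eval (fun _ : Fin (m + 1) => D) _))
    · simpa only [ext0, h, dif_neg, not_false_eq_true] using AllLp.const 0
  rw [integral_pi_cons D m (allLp_lbl_zero.mul ((allLp_resid hx hζ m).mul
    (AllLp.finsetProd fun i _ => allLp_split hx hζ i))).integrable]
  congr 1
  ext z
  simp only [Fin.cons_zero, pos, Fin.cons_succ]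
  rw [integral_const_mul, ← integral_resid_mul_prod_split c s hcs m j hj, ← hmpi.map_eq,
    integral_map hmpi.measurable.aemeasurable]
  rw [hmpi.map_eq]
  exact ((allLp_resid (AllLp.const _) allLp_ext0_gauss m).mul
    (AllLp.finsetProd fun i _ => allLp_split (AllLp.const _) allLp_ext0_gauss i)).aesm

theorem inner_splitAll_zero (w : EuclideanSpace ℝ (Fin d))
    (X : Fin (m + 1) → EuclideanSpace ℝ (Fin d)) :
    inner ℝ w (splitAll c s X 0) =
      resid c s (inner ℝ w (X 0)) (ext0 fun i => inner ℝ w (X (Fin.succ i))) m := by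
  have h := map_resid (innerₛₗ ℝ w) c s (X 0) (ext0 (Fin.tail X)) m
  simp only [innerₛₗ_apply_apply] at h
  simp only [splitAll, Fin.cons_zero]
  rw [h]
  congr 1
  ext i
  by_cases hi : i < m <;> simp [ext0, hi, Fin.tail]

theorem inner_splitAll_succ (w : EuclideanSpace ℝ (Fin d))
    (X : Fin (m + 1) → EuclideanSpace ℝ (Fin d)) (i : Fin m) :
    inner ℝ w (splitAll c s X (Fin.succ i)) =
      split c s (inner ℝ w (X 0)) (ext0 fun i => inner ℝ w (X (Fin.succ i))) i := by
  have h := map_split (innerₛₗ ℝ w) c s (X 0) (ext0 (Fin.tail X)) i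
  simp only [innerₛₗ_apply_apply] at h
  simp only [splitAll, Fin.cons_succ]
  rw [h]
  congr 1
  ext i
  by_cases hi : i < m <;> simp [ext0, hi, Fin.tail]

/-- Each Hermite moment of the negative examples is bounded by the contracted tensor. -/
theorem abs_integral_He_le (hD : D.map Prod.fst = gaussE d) (hc : 0 ≤ c) (hs : 0 ≤ s)
    (hcs : c ^ 2 + s ^ 2 = 1) {w : EuclideanSpace ℝ (Fin d)} (hw : ‖w‖ = 1) (j : ℕ) (hj : j ≤ m) :
    |∫ z, lbl z * (shrink c s m j * (He (j + 1)).eval (inner ℝ w z.1)) ∂D| ≤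
      √(∑ I : Fin m → Option (Fin d), contract D c s w I ^ 2) := by
  classical
  set δ : Option (Fin d) → ℝ := fun α => if α = none then 1 else 0 with hδ
  -- The test tensor has w in the first j split slots and the constant feature in the others. It has
  -- unit norm, so Cauchy–Schwarz costs nothing.
  set τ : Fin m → Option (Fin d) → ℝ := fun i => if (i : ℕ) < j then wfeat w else δ with hτ
  have hδf : ∀ x : EuclideanSpace ℝ (Fin d), ∑ α, δ α * feat α x = 1 := by
    intro x; simp [hδ]
  have hprod : ∀ f : ℕ → ℝ, ∏ i : Fin m, (if (i : ℕ) < j then f i else 1) =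
      ∏ i ∈ Finset.range j, f i := by
    intro f
    rw [Fin.prod_univ_eq_prod_range (fun i => if i < j then f i else 1) m, Finset.prod_ite,
      Finset.prod_const_one, mul_one]
    congr 1
    ext i; simp; omega
  have h1 : ∫ z, lbl z * (shrink c s m j * (He (j + 1)).eval (inner ℝ w z.1)) ∂D =
      ∑ I : Fin m → Option (Fin d), contract D c s w I * ∏ i, τ i (I i) := by
    set T : (Fin (m + 1) → Option (Fin d)) → ℝ := fun I =>
      ∏ i, (Fin.cons (wfeat w) τ : Fin (m + 1) → Option (Fin d) → ℝ) i (I i) with hT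
    have h2 : ∑ I, T I * coef D c s I =
        ∑ I : Fin m → Option (Fin d), contract D c s w I * ∏ i, τ i (I i) := by
      rw [sum_cons, Finset.sum_comm]
      refine Finset.sum_congr rfl fun I _ => ?_
      simp only [hT, Fin.prod_univ_succ, Fin.cons_zero, Fin.cons_succ, Fintype.sum_option, wfeat,
        Option.elim, zero_mul, zero_add, contract, Finset.sum_mul]
      exact Finset.sum_congr rfl fun a _ => by ring
    rw [← h2, sum_mul_coef hD hc hs hcs, ← integral_lbl_mul_split hD hcs hw j hj]
    congr 1
    ext G
    rw [hT, multi_prod, Fin.prod_univ_succ]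
    simp only [Fin.cons_zero, Fin.cons_succ, sum_wfeat_mul_feat, inner_splitAll_zero]
    congr 2
    rw [← hprod]
    refine Finset.prod_congr rfl fun i _ => ?_
    by_cases hi : (i : ℕ) < j
    · simp only [hτ, hi, if_true, sum_wfeat_mul_feat, inner_splitAll_succ]
    · simp only [hτ, hi, if_false, hδf]
  have h3 : ∑ I : Fin m → Option (Fin d), (∏ i, τ i (I i)) ^ 2 = 1 := by
    simp_rw [← Finset.prod_pow]
    rw [sum_prod_eq_prod_sum fun i α => τ i α ^ 2]
    refine Finset.prod_eq_one fun i _ => ?_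
    by_cases hi : (i : ℕ) < j
    · simp only [hτ, hi, if_true, sum_wfeat_sq, hw, one_pow]
    · simp [hτ, hi, hδ]
  rw [h1]
  refine Real.abs_le_sqrt ?_
  have := Finset.sum_mul_sq_le_sq_mul_sq Finset.univ (fun I : Fin m → Option (Fin d) =>
    contract D c s w I) (fun I => ∏ i, τ i (I i))
  rwa [h3, mul_one] at this

end Examples

end


/-! ### Lower bound for the contracted tensor; anticoncentration of independent sums. -/

noncomputable section

/-! ### Size of the moment tensor in the direction of the halfspace -/

section Signal

/-- The bound `M` stays fixed while m decreases in the induction, so each split is charged the same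
factor c s^M. -/
theorem le_shrink {c s : ℝ} (hc : 0 ≤ c) (hs : 0 ≤ s) (hs1 : s ≤ 1) (M m j : ℕ) (hj : j ≤ m)
    (hM : m ≤ M) : c ^ j * s ^ (m + j * M) ≤ shrink c s m j := by
  induction m generalizing j with
  | zero =>
    obtain rfl : j = 0 := by omega
    simp [shrink]
  | succ m ih =>
    cases j with
    | zero => simp [shrink]
    | succ j =>
      rw [shrink]
      have h := ih j (by omega) (by omega)
      calc c ^ (j + 1) * s ^ (m + 1 + (j + 1) * M)
          ≤ c ^ (j + 1) * s ^ (j + 1 + (m + j * M)) := by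
            refine mul_le_mul_of_nonneg_left (pow_le_pow_of_le_one hs hs1 ?_) (by positivity)
            rw [add_mul]; omega
        _ = c * s ^ (j + 1) * (c ^ j * s ^ (m + j * M)) := by ring
        _ ≤ _ := mul_le_mul_of_nonneg_left h (by positivity)

/-- With c² = 1/(m+1) the at most m + m² factors s² ≥ e^{-1/m} cost only e^{-(m+1)}. The remaining
loss (m+1)^j from c will be paid by the factorial in the Hermite coefficients. -/
theorem exp_le_shrink_sq {c s : ℝ} {m : ℕ} (hm : 1 ≤ m) (hc : 0 ≤ c) (hs : 0 ≤ s)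
    (hc2 : c ^ 2 = 1 / (m + 1)) (hs2 : s ^ 2 = m / (m + 1)) {j : ℕ} (hj : j ≤ m) :
    Real.exp (-(m + 1)) / (m + 1) ^ j ≤ shrink c s m j ^ 2 := by
  have hm0 : (0 : ℝ) < m := by exact_mod_cast hm
  have hs1 : s ≤ 1 := by
    have : s ^ 2 ≤ 1 := by rw [hs2, div_le_one (by positivity)]; linarith
    nlinarith
  have h1 := le_shrink hc hs hs1 m m j hj le_rfl
  have h2 : c ^ j * s ^ (m + m * m) ≤ shrink c s m j := by
    refine le_trans ?_ h1
    refine mul_le_mul_of_nonneg_left (pow_le_pow_of_le_one hs hs1 ?_) (by positivity)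
    have := Nat.mul_le_mul_right m hj
    omega
  have h3 : Real.exp (-(m + 1)) ≤ (s ^ 2) ^ (m + m * m) := by
    have h4 : Real.exp (-(1 / m)) ≤ s ^ 2 := by
      rw [Real.exp_neg, hs2, inv_le_comm₀ (Real.exp_pos _) (by positivity), inv_div]
      have := Real.add_one_le_exp (1 / (m : ℝ))
      calc ((m : ℝ) + 1) / m = 1 / m + 1 := by field_simp; ring
        _ ≤ _ := this
    calc Real.exp (-(m + 1)) = Real.exp (-(1 / m)) ^ (m + m * m) := by
          rw [← Real.exp_nat_mul]; congr 1; push_cast; field_simp; ring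
      _ ≤ _ := by gcongr
  calc Real.exp (-(m + 1)) / (m + 1) ^ j ≤ (s ^ 2) ^ (m + m * m) / (m + 1) ^ j := by gcongr
    _ = (c ^ 2) ^ j * (s ^ 2) ^ (m + m * m) := by rw [hc2, div_pow, one_pow]; ring
    _ = (c ^ j * s ^ (m + m * m)) ^ 2 := by ring
    _ ≤ _ := by gcongr

theorem sum_abs_sq_le (m : ℕ) (hm : 4 ≤ m) (f : ℕ → ℝ)
    (hf : ∀ j ≤ m, f j ^ 2 ≤ 576 * (m : ℝ) ^ 3 * 16 ^ m) :
    (∑ j ∈ Finset.range (m + 1), |f j|) ^ 2 ≤ 4096 ^ m := by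
  have h1 : ∀ j ∈ Finset.range (m + 1), |f j| ≤ √(576 * (m : ℝ) ^ 3 * 16 ^ m) := fun j hj =>
    Real.abs_le_sqrt (hf j (by simp at hj; omega))
  have h2 := Finset.sum_le_card_nsmul _ _ _ h1
  rw [Finset.card_range, nsmul_eq_mul] at h2
  have h3 : 0 ≤ ∑ j ∈ Finset.range (m + 1), |f j| := Finset.sum_nonneg fun _ _ => abs_nonneg _
  have h5 : ((m + 1 : ℕ) : ℝ) ≤ 2 ^ m := by exact_mod_cast Nat.lt_two_pow_self
  have h6 : (m : ℝ) ≤ 2 ^ m := by exact_mod_cast Nat.lt_two_pow_self.le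
  have h7 : (576 : ℝ) ≤ 8 ^ m := by
    calc (576 : ℝ) ≤ 8 ^ 4 := by norm_num
      _ ≤ 8 ^ m := pow_le_pow_right₀ (by norm_num) hm
  calc _ ≤ (((m + 1 : ℕ) : ℝ) * √(576 * (m : ℝ) ^ 3 * 16 ^ m)) ^ 2 := by gcongr
    _ = ((m + 1 : ℕ) : ℝ) ^ 2 * (576 * (m : ℝ) ^ 3 * 16 ^ m) := by
        rw [mul_pow, Real.sq_sqrt (by positivity)]
    _ ≤ (2 ^ m) ^ 2 * (8 ^ m * (2 ^ m) ^ 3 * 16 ^ m) := by gcongr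
    _ = (2 ^ 2 * (8 * 2 ^ 3 * 16)) ^ m := by
        rw [mul_pow, mul_pow, mul_pow, ← pow_mul, ← pow_mul, ← pow_mul, ← pow_mul,
          mul_comm 2 m, mul_comm 3 m]
    _ = _ := by norm_num

variable {d : ℕ} {D : Measure (Example d)} [IsProbabilityMeasure D] {c s : ℝ} {m : ℕ}

/-- If the negative examples lie below a threshold, the contracted moment tensor is large. -/
theorem sq_integral_lbl_le (hD : D.map Prod.fst = gaussE d) (hm4 : 4 ≤ m) (hme : Even m)
    (hc : 0 ≤ c) (hs : 0 ≤ s) (hc2 : c ^ 2 = 1 / (m + 1)) (hs2 : s ^ 2 = m / (m + 1))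
    {w : EuclideanSpace ℝ (Fin d)} (hw : ‖w‖ = 1) {t₀ : ℝ} (ht0 : 1 ≤ t₀) (htm : t₀ ^ 2 + 2 ≤ m)
    (hneg : ∀ᵐ z ∂D, z.2 = -1 → inner ℝ w z.1 ≤ t₀) :
    (∫ z, lbl z ∂D) ^ 2 ≤ 4096 ^ m * ∑ I : Fin m → Option (Fin d), contract D c s w I ^ 2 := by
  obtain ⟨b, hb1, hb2⟩ := exists_threshold_hermite m hme t₀ ht0 htm
  have hcs : c ^ 2 + s ^ 2 = 1 := by rw [hc2, hs2]; field_simp; ring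
  have hκ : ∀ j ≤ m, 0 < shrink c s m j ^ 2 := fun j hj =>
    lt_of_lt_of_le (by positivity) (exp_le_shrink_sq (by omega) hc hs hc2 hs2 hj)
  have hκ' : ∀ j ≤ m, shrink c s m j ≠ 0 := fun j hj h => by simpa [h] using hκ j hj
  set S := ∑ I : Fin m → Option (Fin d), contract D c s w I ^ 2 with hS
  have hS0 : 0 ≤ S := Finset.sum_nonneg fun _ _ => sq_nonneg _
  have hu : AllLp (fun z : Example d => (inner ℝ w z.1 : ℝ)) D :=
    allLp_id_gauss.comp ((measurePreserving_inner hw).comp (measurePreserving_fst_of_map hD))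
  set g : ℕ → Example d → ℝ := fun j z =>
    lbl z * (shrink c s m j * (He (j + 1)).eval (inner ℝ w z.1)) with hg
  have hgL : ∀ j, AllLp (g j) D := fun j =>
    allLp_lbl.mul ((allLp_polynomial hu (He (j + 1))).const_mul _)
  -- The threshold polynomial is at most -1 at almost every negative example; positive examples have
  -- weight zero, so its values there do not matter.
  have h1 : ∫ z, lbl z ∂D ≤ -∑ j ∈ Finset.range (m + 1), b j / shrink c s m j * ∫ z, g j z ∂D := by
    simp_rw [← integral_const_mul]
    rw [← integral_finsetSum _ fun j _ => ((hgL j).const_mul _).integrable, ← integral_neg]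
    refine integral_mono_ae allLp_lbl.integrable
      (AllLp.finsetSum fun j _ => (hgL j).const_mul _).integrable.neg ?_
    filter_upwards [hneg] with z hz
    by_cases h : z.2 = -1
    · have h2 := hb1 _ (hz h)
      have h3 : ∑ j ∈ Finset.range (m + 1), b j / shrink c s m j * g j z =
          ∑ j ∈ Finset.range (m + 1), b j * (He (j + 1)).eval (inner ℝ w z.1) := by
        refine Finset.sum_congr rfl fun j hj => ?_
        have := hκ' j (by simp at hj; omega)
        rw [hg]
        simp only [lbl_eq, h, if_true, one_mul]
        field_simp
      rw [h3, lbl_eq, if_pos h]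
      linarith
    · simp [hg, lbl_eq, h]
  have h2 : ∫ z, lbl z ∂D ≤ (∑ j ∈ Finset.range (m + 1), |b j / shrink c s m j|) * √S := by
    refine h1.trans ((neg_le_abs _).trans ?_)
    rw [Finset.sum_mul]
    refine (Finset.abs_sum_le_sum_abs _ _).trans (Finset.sum_le_sum fun j hj => ?_)
    rw [abs_mul]
    exact mul_le_mul_of_nonneg_left
      (abs_integral_He_le hD hc hs hcs hw j (by simp at hj; omega)) (abs_nonneg _)
  have h3 := sum_abs_sq_le m hm4 (fun j => b j / shrink c s m j) (fun j hj => by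
    have h4 := exp_le_shrink_sq (by omega) hc hs hc2 hs2 hj
    have h5 := hb2 j hj
    have h6 : ((m : ℝ) + 1) ^ j / j.factorial ≤ Real.exp (m + 1) :=
      Real.pow_div_factorial_le_exp _ (by positivity) _
    have h7 : (j.factorial : ℝ) ≤ (j + 1).factorial := by
      exact_mod_cast Nat.factorial_le (Nat.le_succ j)
    have h8 : (0 : ℝ) < j.factorial := by positivity
    rw [div_pow, div_le_iff₀ (hκ j hj)]
    have h9 : Real.exp (m + 1) ≤ (2.7182818286 : ℝ) ^ (m + 1) := by
      have := Real.exp_one_lt_d9.le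
      calc Real.exp (m + 1) = Real.exp 1 ^ (m + 1) := by
            rw [← Real.exp_nat_mul]; push_cast; ring_nf
        _ ≤ _ := by gcongr
    have h10 : Real.exp (m + 1) ^ 2 ≤ 8 * 8 ^ m := by
      calc Real.exp (m + 1) ^ 2 ≤ ((2.7182818286 : ℝ) ^ (m + 1)) ^ 2 := by gcongr
        _ = ((2.7182818286 : ℝ) ^ 2) ^ (m + 1) := by rw [← pow_mul, ← pow_mul, mul_comm]
        _ ≤ 8 ^ (m + 1) := by gcongr; norm_num
        _ = _ := by ring
    -- The factor 1/j! from Bessel's inequality cancels (m+1)^j up to e^{m+1}; the other e^{m+1}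
    -- comes from s, and e² ≤ 8 leaves an exponential in m.
    calc b j ^ 2 ≤ b j ^ 2 * (j + 1).factorial / j.factorial := by
          rw [le_div_iff₀ h8]; gcongr
      _ ≤ 72 * (m : ℝ) ^ 3 * 2 ^ m / j.factorial := by gcongr
      _ = 72 * (m : ℝ) ^ 3 * 2 ^ m * (((m : ℝ) + 1) ^ j / j.factorial) * (1 / (m + 1) ^ j) := by
          field_simp
      _ ≤ 72 * (m : ℝ) ^ 3 * 2 ^ m * Real.exp (m + 1) * (1 / (m + 1) ^ j) := by gcongr
      _ = 72 * (m : ℝ) ^ 3 * 2 ^ m * (Real.exp (m + 1) ^ 2) *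
          (Real.exp (-(m + 1)) / (m + 1) ^ j) := by
          rw [Real.exp_neg]
          have := Real.exp_pos ((m : ℝ) + 1)
          field_simp
      _ ≤ 72 * (m : ℝ) ^ 3 * 2 ^ m * (8 * 8 ^ m) * (Real.exp (-(m + 1)) / (m + 1) ^ j) := by
          gcongr
      _ = 576 * (m : ℝ) ^ 3 * 16 ^ m * (Real.exp (-(m + 1)) / (m + 1) ^ j) := by
          rw [show (16 : ℝ) = 2 * 8 by norm_num, mul_pow]; ring
      _ ≤ _ := by gcongr)
  have hP0 : 0 ≤ ∫ z, lbl z ∂D := integral_nonneg fun z => lbl_nonneg z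
  calc (∫ z, lbl z ∂D) ^ 2 ≤ ((∑ j ∈ Finset.range (m + 1), |b j / shrink c s m j|) * √S) ^ 2 := by
        gcongr
    _ = (∑ j ∈ Finset.range (m + 1), |b j / shrink c s m j|) ^ 2 * S := by
        rw [mul_pow, Real.sq_sqrt hS0]
    _ ≤ _ := by gcongr

end Signal

/-! ### Sums of independent copies -/

section IID

variable {Ω : Type*} [MeasurableSpace Ω] {μ : Measure Ω} [IsProbabilityMeasure μ] {f : Ω → ℝ}

theorem allLp_sum_pi (hf : AllLp f μ) (R : ℕ) :
    AllLp (fun ω : Fin R → Ω => ∑ r, f (ω r)) (Measure.pi fun _ => μ) :=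
  AllLp.finsetSum fun r _ => hf.comp (measurePreserving_eval (fun _ : Fin R => μ) r)

theorem integral_sum_pi (hf : AllLp f μ) (h0 : ∫ x, f x ∂μ = 0) (R : ℕ) :
    ∫ ω : Fin R → Ω, ∑ r, f (ω r) ∂(Measure.pi fun _ => μ) = 0 := by
  rw [integral_finsetSum _ fun r _ =>
    (hf.comp (measurePreserving_eval (fun _ : Fin R => μ) r)).integrable]
  refine Finset.sum_eq_zero fun r _ => ?_
  rw [integral_comp_eval (μ := fun _ : Fin R => μ) hf.aesm, h0]

theorem integral_sum_sq_pi (hf : AllLp f μ) (h0 : ∫ x, f x ∂μ = 0) (R : ℕ) :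
    ∫ ω : Fin R → Ω, (∑ r, f (ω r)) ^ 2 ∂(Measure.pi fun _ => μ) = R * ∫ x, f x ^ 2 ∂μ := by
  induction R with
  | zero => simp
  | succ R ih =>
    have hS := allLp_sum_pi hf R
    rw [integral_pi_cons μ R ((allLp_sum_pi hf (R + 1)).pow 2).integrable]
    simp_rw [Fin.sum_univ_succ, Fin.cons_zero, Fin.cons_succ]
    have e : ∀ a, ∫ b : Fin R → Ω, (f a + ∑ r, f (b r)) ^ 2 ∂(Measure.pi fun _ => μ) =
        f a ^ 2 + R * ∫ x, f x ^ 2 ∂μ := by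
      intro a
      have e1 : ∀ b : Fin R → Ω, (f a + ∑ r, f (b r)) ^ 2 =
          (f a ^ 2 + 2 * f a * ∑ r, f (b r)) + (∑ r, f (b r)) ^ 2 := fun b => by ring
      simp_rw [e1]
      rw [integral_add ((AllLp.const _).add (hS.const_mul _)).integrable (hS.pow 2).integrable,
        integral_add (integrable_const _) (hS.const_mul _).integrable, integral_const_mul,
        integral_sum_pi hf h0, ih]
      simp
    simp_rw [e]
    rw [integral_add (hf.pow 2).integrable (integrable_const _)]
    simp; ring

/-- Expanding one summand at a time: the terms of odd degree in the new variable disappear either by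
its centring or by that of the previous sum, so the third moment `W` never has to be known. -/
theorem integral_sum_pow_four_pi (hf : AllLp f μ) (h0 : ∫ x, f x ∂μ = 0) (R : ℕ) :
    ∫ ω : Fin R → Ω, (∑ r, f (ω r)) ^ 4 ∂(Measure.pi fun _ => μ) ≤
      3 * R ^ 2 * (∫ x, f x ^ 2 ∂μ) ^ 2 + R * ∫ x, f x ^ 4 ∂μ := by
  induction R with
  | zero => simp
  | succ R ih =>
    have hS := allLp_sum_pi hf R
    rw [integral_pi_cons μ R ((allLp_sum_pi hf (R + 1)).pow 4).integrable]
    simp_rw [Fin.sum_univ_succ, Fin.cons_zero, Fin.cons_succ]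
    set W := ∫ b : Fin R → Ω, (∑ r, f (b r)) ^ 3 ∂(Measure.pi fun _ => μ)
    set X := ∫ b : Fin R → Ω, (∑ r, f (b r)) ^ 4 ∂(Measure.pi fun _ => μ)
    set v := ∫ x, f x ^ 2 ∂μ
    have e : ∀ a, ∫ b : Fin R → Ω, (f a + ∑ r, f (b r)) ^ 4 ∂(Measure.pi fun _ => μ) =
        (f a ^ 4 + 6 * (R * v) * f a ^ 2) + (4 * W * f a + X) := by
      intro a
      have e1 : ∀ b : Fin R → Ω, (f a + ∑ r, f (b r)) ^ 4 =
          (f a ^ 4 + 6 * f a ^ 2 * (∑ r, f (b r)) ^ 2) +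
          (4 * f a * (∑ r, f (b r)) ^ 3 + (∑ r, f (b r)) ^ 4) +
          4 * f a ^ 3 * ∑ r, f (b r) := fun b => by ring
      simp_rw [e1]
      rw [integral_add ((((AllLp.const _).add ((hS.pow 2).const_mul _))).add
          (((hS.pow 3).const_mul _).add (hS.pow 4))).integrable (hS.const_mul _).integrable,
        integral_add ((AllLp.const _).add ((hS.pow 2).const_mul _)).integrable
          (((hS.pow 3).const_mul _).add (hS.pow 4)).integrable,
        integral_add (integrable_const _) ((hS.pow 2).const_mul _).integrable,
        integral_add ((hS.pow 3).const_mul _).integrable (hS.pow 4).integrable,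
        integral_const_mul, integral_const_mul, integral_const_mul,
        integral_sum_pi hf h0, integral_sum_sq_pi hf h0]
      simp only [integral_const, probReal_univ, smul_eq_mul, one_mul, mul_zero, add_zero]
      ring
    simp_rw [e]
    rw [integral_add ((hf.pow 4).add ((hf.pow 2).const_mul _)).integrable
        ((hf.const_mul _).add (AllLp.const _)).integrable,
      integral_add (hf.pow 4).integrable ((hf.pow 2).const_mul _).integrable,
      integral_add (hf.const_mul _).integrable (integrable_const _),
      integral_const_mul, integral_const_mul, h0]
    simp only [integral_const, probReal_univ, smul_eq_mul, one_mul, mul_zero, zero_add]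
    push_cast
    have hv : 0 ≤ v ^ 2 := sq_nonneg v
    change _ + 6 * (R * v) * v + X ≤ _
    nlinarith

/-- The linear term makes this one-sided. For mean 0, variance 1 and fourth moment at most 4, the
left side has expectation at least (1 - 1/2 - 1/4)/5 = 1/20. -/
theorem anticoncentration_pointwise (x : ℝ) :
    (x + x ^ 2 - x ^ 4 / 8 - 1 / 4) / 5 ≤ if 1 / 8 ≤ x then 1 else 0 := by
  split_ifs with h
  · have : x + x ^ 2 - x ^ 4 / 8 - 1 / 4 ≤ 5 := by
      nlinarith [sq_nonneg (x ^ 2 - 5), sq_nonneg (x - 2)]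
    linarith
  · push Not at h
    have : x + x ^ 2 - x ^ 4 / 8 - 1 / 4 ≤ 0 := by
      by_cases h0 : 0 ≤ x
      · nlinarith [pow_nonneg h0 4]
      · push Not at h0
        by_cases h3 : x ≤ -2.8
        · nlinarith [sq_nonneg (x ^ 2 - 7.84), mul_nonneg (by linarith : 0 ≤ -2.8 - x)
            (by linarith : 0 ≤ -x)]
        · push Not at h3
          have h4 : 0 ≤ -x * (-x + 3.266) * (x + 1.633) ^ 2 := by
            have : 0 ≤ -x := by linarith
            have : 0 ≤ -x + 3.266 := by linarith
            positivity
          nlinarith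
    linarith

/-- A centred sum of independent variables with bounded kurtosis is large with constant
probability. -/
theorem le_measure_sum_pi (hf : AllLp f μ) (h0 : ∫ x, f x ∂μ = 0) (R : ℕ) (hR : 0 < R)
    (hv : 0 < ∫ x, f x ^ 2 ∂μ) (h4 : ∫ x, f x ^ 4 ∂μ ≤ R * (∫ x, f x ^ 2 ∂μ) ^ 2) :
    1 / 20 ≤ (Measure.pi fun _ : Fin R => μ).real
      {ω | √(R * ∫ x, f x ^ 2 ∂μ) / 8 ≤ ∑ r, f (ω r)} := by
  set v := ∫ x, f x ^ 2 ∂μ with hvdef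
  have hR' : (0 : ℝ) < R := by exact_mod_cast hR
  set σ := √(R * v) with hσ
  have hσ0 : 0 < σ := Real.sqrt_pos.2 (by positivity)
  have hσ2 : σ ^ 2 = R * v := Real.sq_sqrt (by positivity)
  have hS := allLp_sum_pi hf R
  set ν := Measure.pi fun _ : Fin R => μ
  set A := {ω : Fin R → Ω | σ / 8 ≤ ∑ r, f (ω r)} with hA
  have hX : AllLp (fun ω : Fin R → Ω => σ⁻¹ * ∑ r, f (ω r)) ν := hS.const_mul _
  have e1 : ∫ ω, σ⁻¹ * ∑ r, f (ω r) ∂ν = 0 := by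
    rw [integral_const_mul, integral_sum_pi hf h0, mul_zero]
  have e2 : ∫ ω, (σ⁻¹ * ∑ r, f (ω r)) ^ 2 ∂ν = 1 := by
    simp_rw [mul_pow]
    rw [integral_const_mul, integral_sum_sq_pi hf h0, ← hvdef, ← hσ2, inv_pow,
      inv_mul_cancel₀ (by positivity)]
  have e4 : ∫ ω, (σ⁻¹ * ∑ r, f (ω r)) ^ 4 ∂ν ≤ 4 := by
    simp_rw [mul_pow]
    rw [integral_const_mul, inv_pow, inv_mul_le_iff₀ (by positivity)]
    refine (integral_sum_pow_four_pi hf h0 R).trans ?_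
    have : σ ^ 4 = (R * v) ^ 2 := by rw [← hσ2]; ring
    rw [this]
    nlinarith
  have hAn : NullMeasurableSet A ν :=
    nullMeasurableSet_le aemeasurable_const hS.aesm.aemeasurable
  have hind : ∀ ω, (if 1 / 8 ≤ σ⁻¹ * ∑ r, f (ω r) then (1 : ℝ) else 0) = A.indicator 1 ω := by
    intro ω
    rw [Set.indicator_apply]
    have : 1 / 8 ≤ σ⁻¹ * ∑ r, f (ω r) ↔ ω ∈ A := by
      rw [hA, Set.mem_ofPred_eq, inv_mul_eq_div, le_div_iff₀ hσ0, div_mul_eq_mul_div, one_mul]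
    simp only [this, Pi.one_apply]
  have hp : ∫ ω, ((σ⁻¹ * ∑ r, f (ω r)) + (σ⁻¹ * ∑ r, f (ω r)) ^ 2 -
      (σ⁻¹ * ∑ r, f (ω r)) ^ 4 / 8 - 1 / 4) / 5 ∂ν ≤ ∫ ω, A.indicator (1 : (Fin R → Ω) → ℝ) ω ∂ν := by
    refine integral_mono ?_ ?_ fun ω => ?_
    · exact ((((hX.integrable.add (hX.pow 2).integrable).sub
        ((hX.pow 4).integrable.div_const 8)).sub (integrable_const (1 / 4))).div_const 5)
    · exact (integrable_const (1 : ℝ)).indicator₀ hAn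
    · rw [← hind]; exact anticoncentration_pointwise _
  rw [integral_indicator₀ hAn, integral_div, integral_sub, integral_sub, integral_add, integral_div,
    e1, e2] at hp
  · simp only [Pi.one_apply, integral_const, smul_eq_mul, mul_one, measureReal_restrict_apply_univ,
      probReal_univ] at hp
    linarith
  · exact hX.integrable
  · exact (hX.pow 2).integrable
  · exact hX.integrable.add (hX.pow 2).integrable
  · exact (hX.pow 4).integrable.div_const 8
  · exact (hX.integrable.add (hX.pow 2).integrable).sub ((hX.pow 4).integrable.div_const 8)
  · exact integrable_const _

end IID

end


/-! ### The learner's statistic, its mean and variance, and its correlation with w. -/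

noncomputable section

section Learner

variable {d m : ℕ}

/-! ### The statistic computed by the learner -/

/-- The contribution of the group `G` of examples, contracted with the random group `Z`. -/
def sampleVec (a₀ : Fin d) (c s : ℝ) (Z G : Fin (m + 1) → Example d) (a : Fin d) : ℝ :=
  pos Z 0 a₀ * lbl (G 0) *
    (∏ i : Fin m, (1 + inner ℝ (splitAll c s (pos G) (Fin.succ i)) (pos Z (Fin.succ i)))) *
    splitAll c s (pos G) 0 a

/-- The coefficients of the conditional expectation of `sampleVec` given `Z`. -/
def meanCoef (D : Measure (Example d)) (a₀ : Fin d) (c s : ℝ) (a : Fin d) :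
    (Fin (m + 1) → Option (Fin d)) → ℝ :=
  liftCoef (some a₀) fun I : Fin m → Option (Fin d) =>
    coef D c s (Fin.cons (some a) I : Fin (m + 1) → Option (Fin d))

/-- A kernel identity: a product of such factors contracts a tensor with (d+1)^m entries without
writing the tensor down. -/
theorem one_add_inner_eq (x y : EuclideanSpace ℝ (Fin d)) :
    1 + inner ℝ x y = ∑ α, feat α x * feat α y := by
  simp [Fintype.sum_option, PiLp.inner_apply, mul_comm]

theorem sum_feat_sq (x : EuclideanSpace ℝ (Fin d)) : ∑ α, feat α x ^ 2 = 1 + ‖x‖ ^ 2 := by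
  simp [Fintype.sum_option, EuclideanSpace.norm_sq_eq]

/-- For fixed Z, a labelled multilinear form in the vectors split from G; this view gives the
conditional expectation. -/
theorem sampleVec_eq_left (a₀ : Fin d) (c s : ℝ) (Z G : Fin (m + 1) → Example d) (a : Fin d) :
    sampleVec a₀ c s Z G a = lbl (G 0) * multi feat (liftCoef (some a)
      fun I : Fin m → Option (Fin d) => pos Z 0 a₀ * ∏ i, feat (I i) (pos Z (Fin.succ i)))
      (splitAll c s (pos G)) := by
  have h : multi feat (fun I : Fin m → Option (Fin d) => pos Z 0 a₀ *
      ∏ i, feat (I i) (pos Z (Fin.succ i))) (Fin.tail (splitAll c s (pos G))) =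
      pos Z 0 a₀ * ∏ i : Fin m, (1 + inner ℝ (splitAll c s (pos G) (Fin.succ i))
        (pos Z (Fin.succ i))) := by
    have := multi_prod feat (fun i α => feat α (pos Z (Fin.succ i)))
      (Fin.tail (splitAll c s (pos G)))
    have h2 : multi feat (fun I : Fin m → Option (Fin d) => pos Z 0 a₀ *
        ∏ i, feat (I i) (pos Z (Fin.succ i))) (Fin.tail (splitAll c s (pos G))) =
        pos Z 0 a₀ * multi feat (fun I : Fin m → Option (Fin d) =>
          ∏ i, feat (I i) (pos Z (Fin.succ i))) (Fin.tail (splitAll c s (pos G))) := by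
      simp only [multi, Finset.mul_sum, mul_assoc]
    rw [h2, this]
    congr 1
    refine Finset.prod_congr rfl fun i _ => ?_
    rw [one_add_inner_eq]
    exact Finset.sum_congr rfl fun α _ => mul_comm _ _
  rw [multi_liftCoef, h, sampleVec, feat_some]
  ring

/-- For fixed G, a multilinear form in Z; this view gives the second moment by orthonormality of the
features. -/
theorem sampleVec_eq_right (a₀ : Fin d) (c s : ℝ) (Z G : Fin (m + 1) → Example d) (a : Fin d) :
    sampleVec a₀ c s Z G a = (lbl (G 0) * splitAll c s (pos G) 0 a) *
      multi feat (liftCoef (some a₀) fun I : Fin m → Option (Fin d) =>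
        ∏ i, feat (I i) (splitAll c s (pos G) (Fin.succ i))) (pos Z) := by
  have := multi_prod feat (fun i α => feat α (splitAll c s (pos G) (Fin.succ i)))
    (Fin.tail (pos Z))
  rw [multi_liftCoef, this, sampleVec, feat_some]
  have h : ∀ i : Fin m, 1 + inner ℝ (splitAll c s (pos G) (Fin.succ i)) (pos Z (Fin.succ i)) =
      ∑ α, feat α (splitAll c s (pos G) (Fin.succ i)) * feat α (Fin.tail (pos Z) i) :=
    fun i => one_add_inner_eq _ _
  simp_rw [h]
  ring

variable {D : Measure (Example d)} [IsProbabilityMeasure D] {c s : ℝ}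

theorem integral_sampleVec (hD : D.map Prod.fst = gaussE d) (hc : 0 ≤ c) (hs : 0 ≤ s)
    (hcs : c ^ 2 + s ^ 2 = 1) (a₀ : Fin d) (Z : Fin (m + 1) → Example d) (a : Fin d) :
    ∫ G, sampleVec a₀ c s Z G a ∂(Measure.pi fun _ => D) =
      multi feat (meanCoef D a₀ c s a) (pos Z) := by
  simp_rw [sampleVec_eq_left]
  rw [← sum_mul_coef hD hc hs hcs, sum_liftCoef_mul, meanCoef, multi_liftCoef, multi,
    Finset.mul_sum]
  refine Finset.sum_congr rfl fun I _ => ?_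
  rw [feat_some]
  simp only [monom, Fin.tail]
  ring

theorem allLp_feat_pos (hD : D.map Prod.fst = gaussE d) {k : ℕ} (i : Fin k) (α : Option (Fin d)) :
    AllLp (fun Z : Fin k → Example d => feat α (pos Z i)) (Measure.pi fun _ => D) :=
  (allLp_feat α).comp ((measurePreserving_fst_of_map hD).comp
    (measurePreserving_eval (fun _ : Fin k => D) i))

theorem allLp_feat_split {D : Measure (Example d)}
    (hD : D.map Prod.fst = gaussE d) (hc : 0 ≤ c) (hs : 0 ≤ s)
    (hcs : c ^ 2 + s ^ 2 = 1) (i : Fin (m + 1)) (α : Option (Fin d)) :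
    AllLp (fun G : Fin (m + 1) → Example d => feat α (splitAll c s (pos G) i))
      (Measure.pi fun _ => D) :=
  (allLp_feat α).comp ((measurePreserving_eval (fun _ : Fin (m + 1) => gaussE d) i).comp
    (measurePreserving_splitAll_pos hD hc hs hcs))

theorem allLp_sampleVec (hD : D.map Prod.fst = gaussE d) (hc : 0 ≤ c) (hs : 0 ≤ s)
    (hcs : c ^ 2 + s ^ 2 = 1) (a₀ : Fin d) (a : Fin d) :
    AllLp (fun p : (Fin (m + 1) → Example d) × (Fin (m + 1) → Example d) =>
      sampleVec a₀ c s p.1 p.2 a) ((Measure.pi fun _ => D).prod (Measure.pi fun _ => D)) := by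
  have h1 : MeasurePreserving
      (Prod.fst : (Fin (m + 1) → Example d) × (Fin (m + 1) → Example d) → _)
      ((Measure.pi fun _ => D).prod (Measure.pi fun _ => D)) (Measure.pi fun _ => D) :=
    measurePreserving_fst
  have h2 : MeasurePreserving
      (Prod.snd : (Fin (m + 1) → Example d) × (Fin (m + 1) → Example d) → _)
      ((Measure.pi fun _ => D).prod (Measure.pi fun _ => D)) (Measure.pi fun _ => D) :=
    measurePreserving_snd
  simp_rw [sampleVec, one_add_inner_eq]
  exact ((((allLp_feat_pos hD 0 (some a₀)).comp h1).mul (allLp_lbl_zero.comp h2)).mul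
    (AllLp.finsetProd fun i _ => AllLp.finsetSum fun α _ =>
      ((allLp_feat_split hD hc hs hcs i.succ α).comp h2).mul
        ((allLp_feat_pos hD i.succ α).comp h1))).mul
    ((allLp_feat_split hD hc hs hcs 0 (some a)).comp h2)

theorem allLp_sampleVec_right (hD : D.map Prod.fst = gaussE d) (hc : 0 ≤ c) (hs : 0 ≤ s)
    (hcs : c ^ 2 + s ^ 2 = 1) (a₀ : Fin d) (Z : Fin (m + 1) → Example d) (a : Fin d) :
    AllLp (fun G => sampleVec a₀ c s Z G a) (Measure.pi fun _ => D) := by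
  simp_rw [sampleVec_eq_left]
  exact allLp_lbl_zero.mul (allLp_multi_split hD hc hs hcs _)

theorem allLp_multi_pos {D : Measure (Example d)} (hD : D.map Prod.fst = gaussE d) {k : ℕ}
    (T : (Fin k → Option (Fin d)) → ℝ) :
    AllLp (fun Z : Fin k → Example d => multi feat T (pos Z)) (Measure.pi fun _ => D) :=
  (allLp_multi allLp_feat T).comp (measurePreserving_pos hD k)

theorem integral_comp_pos {D : Measure (Example d)} (hD : D.map Prod.fst = gaussE d) {k : ℕ}
    {F : (Fin k → EuclideanSpace ℝ (Fin d)) → ℝ}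
    (hF : AEStronglyMeasurable F (Measure.pi fun _ => gaussE d)) :
    ∫ Z : Fin k → Example d, F (pos Z) ∂(Measure.pi fun _ => D) =
      ∫ x, F x ∂(Measure.pi fun _ => gaussE d) := by
  have h := measurePreserving_pos hD k
  rw [← h.map_eq, integral_map h.measurable.aemeasurable (by rwa [h.map_eq])]

theorem integral_multi_sq (T : (Fin m → Option (Fin d)) → ℝ) :
    ∫ x, multi feat T x ^ 2 ∂(Measure.pi fun _ => gaussE d) = ∑ I, T I ^ 2 := by
  simp_rw [sq]
  exact integral_multi_mul_multi allLp_feat integral_feat_mul_feat T T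

/-- A coordinate in the first slot is orthogonal to the constant form. This centring is the only
purpose of the extra coordinate `a₀` of Z. -/
theorem integral_multi_lift (a₀ : Fin d) (U : (Fin m → Option (Fin d)) → ℝ) :
    ∫ x, multi feat (liftCoef (some a₀) U) x ∂(Measure.pi fun _ => gaussE d) = 0 := by
  have h := integral_multi_mul_multi allLp_feat integral_feat_mul_feat (liftCoef (some a₀) U)
    (fun I : Fin (m + 1) → Option (Fin d) => ∏ i, if I i = none then 1 else 0)
  rw [sum_liftCoef_mul] at h
  have h2 : ∀ x : Fin (m + 1) → EuclideanSpace ℝ (Fin d),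
      multi feat (fun I => ∏ i, if I i = none then 1 else 0) x = 1 := by
    intro x
    rw [multi_prod feat fun _ α => if α = none then 1 else 0]
    simp
  simp_rw [h2, mul_one] at h
  rw [h]
  refine Finset.sum_eq_zero fun I _ => ?_
  rw [Fin.prod_univ_succ]
  simp

/-- The second moment of the statistic. -/
theorem integral_integral_sampleVec_sq_le (hD : D.map Prod.fst = gaussE d) (hc : 0 ≤ c)
    (hs : 0 ≤ s) (hcs : c ^ 2 + s ^ 2 = 1) (a₀ : Fin d) (a : Fin d) :
    ∫ Z : Fin (m + 1) → Example d, ∫ G, sampleVec a₀ c s Z G a ^ 2 ∂(Measure.pi fun _ => D)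
      ∂(Measure.pi fun _ => D) ≤ (d + 1) ^ m := by
  have hL := (allLp_sampleVec (m := m) hD hc hs hcs a₀ a).pow 2
  rw [integral_integral_swap hL.integrable]
  -- Averaging over Z first produces the factors 1 + ‖·‖² of the split components, which are
  -- independent Gaussians with E(1 + ‖x‖²) = d + 1.
  have h1 : ∀ G : Fin (m + 1) → Example d, ∫ Z, sampleVec a₀ c s Z G a ^ 2
      ∂(Measure.pi fun _ => D) = (lbl (G 0) * splitAll c s (pos G) 0 a) ^ 2 *
        ∏ i : Fin m, (1 + ‖splitAll c s (pos G) (Fin.succ i)‖ ^ 2) := by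
    intro G
    simp_rw [sampleVec_eq_right, mul_pow _ (multi _ _ _)]
    rw [integral_const_mul, integral_comp_pos hD (F := fun x => multi feat _ x ^ 2)
      ((allLp_multi allLp_feat _).pow 2).aesm, integral_multi_sq, sum_liftCoef_sq]
    simp_rw [← Finset.prod_pow]
    rw [sum_prod_eq_prod_sum fun i α => feat α (splitAll c s (pos G) (Fin.succ i)) ^ 2]
    simp_rw [sum_feat_sq]
  simp_rw [h1]
  set φ : Fin (m + 1) → EuclideanSpace ℝ (Fin d) → ℝ :=
    Fin.cons (fun x => x a ^ 2) fun _ x => 1 + ‖x‖ ^ 2 with hφ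
  have hφL : ∀ i, AllLp (φ i) (gaussE d) := by
    intro i
    refine Fin.cases ?_ (fun i => ?_) i
    · exact (allLp_coord a).pow 2
    · simp only [hφ, Fin.cons_succ, ← sum_feat_sq]
      exact AllLp.finsetSum fun α _ => (allLp_feat α).pow 2
  have hprod : AllLp (fun x : Fin (m + 1) → EuclideanSpace ℝ (Fin d) => ∏ i, φ i (x i))
      (Measure.pi fun _ => gaussE d) :=
    AllLp.finsetProd fun i _ => (hφL i).comp (measurePreserving_eval (fun _ => gaussE d) i)
  have hmp := measurePreserving_splitAll_pos (m := m) hD hc hs hcs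
  calc _ ≤ ∫ G : Fin (m + 1) → Example d, ∏ i, φ i (splitAll c s (pos G) i)
        ∂(Measure.pi fun _ => D) := by
        refine integral_mono_of_nonneg (.of_forall fun G => ?_) (hprod.comp hmp).integrable
          (.of_forall fun G => ?_)
        · positivity
        · simp only [Fin.prod_univ_succ, hφ, Fin.cons_zero, Fin.cons_succ]
          refine mul_le_mul_of_nonneg_right ?_ (Finset.prod_nonneg fun i _ => by positivity)
          rw [mul_pow]
          have h2 : lbl (G 0) ^ 2 ≤ 1 := pow_le_one₀ (lbl_nonneg _) (lbl_le_one _)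
          nlinarith [sq_nonneg (splitAll c s (pos G) 0 a)]
    _ = ∫ x, ∏ i, φ i (x i) ∂(Measure.pi fun _ => gaussE d) := by
        rw [← hmp.map_eq, integral_map hmp.measurable.aemeasurable
          (by rw [hmp.map_eq]; exact hprod.aesm)]
    _ = (d + 1) ^ m := by
        rw [integral_fintype_prod_eq_prod, Fin.prod_univ_succ]
        simp only [hφ, Fin.cons_zero, Fin.cons_succ, ← sum_feat_sq]
        rw [integral_finsetSum _ fun α _ => ((allLp_feat α).pow 2).integrable]
        simp_rw [sq, integral_feat_mul_feat, integral_coord_mul_coord]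
        simp

/-! ### Blocks of groups -/

theorem measurePreserving_eval_zero_succ {Ω : Type*} [MeasurableSpace Ω] (μ : Measure Ω)
    [IsProbabilityMeasure μ] {n : ℕ} (j : Fin n) :
    MeasurePreserving (fun ω : Fin (n + 1) → Ω => (ω 0, ω j.succ)) (Measure.pi fun _ => μ)
      (μ.prod μ) := by
  have h1 := measurePreserving_piFinSuccAbove (fun _ : Fin (n + 1) => μ) 0
  have h2 := (MeasurePreserving.id μ).prod (measurePreserving_eval (fun _ : Fin n => μ) j)
  exact h2.comp h1

/-- The deviation of the sum over a block from its conditional expectation. -/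
def blockErr (D : Measure (Example d)) (a₀ : Fin d) (c s : ℝ) {n : ℕ}
    (ω : Fin (n + 1) → Fin (m + 1) → Example d) (a : Fin d) : ℝ :=
  ∑ j : Fin n, (sampleVec a₀ c s (ω 0) (ω j.succ) a - multi feat (meanCoef D a₀ c s a) (pos (ω 0)))

theorem allLp_blockErr (hD : D.map Prod.fst = gaussE d) (hc : 0 ≤ c) (hs : 0 ≤ s)
    (hcs : c ^ 2 + s ^ 2 = 1) (a₀ : Fin d) (n : ℕ) (a : Fin d) :
    AllLp (fun ω : Fin (n + 1) → Fin (m + 1) → Example d => blockErr D a₀ c s ω a)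
      (Measure.pi fun _ => Measure.pi fun _ => D) :=
  AllLp.finsetSum fun j _ =>
    ((allLp_sampleVec hD hc hs hcs a₀ a).comp (measurePreserving_eval_zero_succ _ j)).sub
      ((allLp_multi_pos hD _).comp (measurePreserving_eval
        (fun _ : Fin (n + 1) => Measure.pi fun _ : Fin (m + 1) => D) 0))

/-- Given Z, the groups of the block contribute independent centred terms, so variances add and each
is at most a second moment. -/
theorem integral_blockErr_sq_le (hD : D.map Prod.fst = gaussE d) (hc : 0 ≤ c) (hs : 0 ≤ s)
    (hcs : c ^ 2 + s ^ 2 = 1) (a₀ : Fin d) (n : ℕ) (a : Fin d) :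
    ∫ ω : Fin (n + 1) → Fin (m + 1) → Example d, blockErr D a₀ c s ω a ^ 2
      ∂(Measure.pi fun _ => Measure.pi fun _ => D) ≤ n * (d + 1) ^ m := by
  rw [integral_pi_cons _ n ((allLp_blockErr hD hc hs hcs a₀ n a).pow 2).integrable]
  have h1 : ∀ Z : Fin (m + 1) → Example d, ∫ b : Fin n → Fin (m + 1) → Example d,
      blockErr D a₀ c s (Fin.cons Z b) a ^ 2 ∂(Measure.pi fun _ => Measure.pi fun _ => D) ≤
      n * ∫ G, sampleVec a₀ c s Z G a ^ 2 ∂(Measure.pi fun _ => D) := by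
    intro Z
    have hY := allLp_sampleVec_right hD hc hs hcs a₀ Z a
    have hm := integral_sampleVec hD hc hs hcs a₀ Z a
    set M := multi feat (meanCoef D a₀ c s a) (pos Z)
    have hf : AllLp (fun G => sampleVec a₀ c s Z G a - M) (Measure.pi fun _ => D) :=
      hY.sub (AllLp.const M)
    have hf0 : ∫ G, (sampleVec a₀ c s Z G a - M) ∂(Measure.pi fun _ => D) = 0 := by
      rw [integral_sub hY.integrable (integrable_const _), hm]; simp
    have := integral_sum_sq_pi hf hf0 n
    simp only [blockErr, Fin.cons_zero, Fin.cons_succ]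
    rw [this]
    refine mul_le_mul_of_nonneg_left ?_ (by positivity)
    have e : ∀ G, (sampleVec a₀ c s Z G a - M) ^ 2 =
        sampleVec a₀ c s Z G a ^ 2 - 2 * M * sampleVec a₀ c s Z G a + M ^ 2 := fun G => by ring
    simp_rw [e]
    rw [integral_add (((hY.pow 2).sub (hY.const_mul _)).integrable) (integrable_const _),
      integral_sub (hY.pow 2).integrable (hY.const_mul _).integrable, integral_const_mul, hm]
    simp only [integral_const, probReal_univ, smul_eq_mul, one_mul]
    nlinarith [sq_nonneg M]
  have hint : Integrable (fun Z : Fin (m + 1) → Example d =>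
      ∫ G, sampleVec a₀ c s Z G a ^ 2 ∂(Measure.pi fun _ => D)) (Measure.pi fun _ => D) :=
    ((allLp_sampleVec hD hc hs hcs a₀ a).pow 2).integrable.integral_prod_left
  calc _ ≤ ∫ Z : Fin (m + 1) → Example d, n * ∫ G, sampleVec a₀ c s Z G a ^ 2
        ∂(Measure.pi fun _ => D) ∂(Measure.pi fun _ => D) :=
        integral_mono_of_nonneg (.of_forall fun Z => integral_nonneg fun b => sq_nonneg _)
          (hint.const_mul _) (.of_forall h1)
    _ = n * _ := integral_const_mul _ _
    _ ≤ _ := mul_le_mul_of_nonneg_left (integral_integral_sampleVec_sq_le hD hc hs hcs a₀ a)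
        (by positivity)

theorem markov_real {Ω : Type*} [MeasurableSpace Ω] {μ : Measure Ω} [IsFiniteMeasure μ]
    {f : Ω → ℝ} (hf : Integrable f μ) (h0 : ∀ x, 0 ≤ f x) {B : ℝ} (hB : 0 < B)
    (h : 100 * ∫ x, f x ∂μ ≤ B) : μ.real {x | B ≤ f x} ≤ 1 / 100 := by
  have := mul_meas_ge_le_integral_of_nonneg (.of_forall h0) hf B
  rw [le_div_iff₀ (by norm_num)]
  have h2 : 0 ≤ μ.real {x | B ≤ f x} := measureReal_nonneg
  by_contra hc
  push Not at hc
  nlinarith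

theorem sum_contract_sq_le {D : Measure (Example d)} (w : EuclideanSpace ℝ (Fin d))
    (hw : ‖w‖ = 1) :
    ∑ I : Fin m → Option (Fin d), contract D c s w I ^ 2 ≤
      ∑ I : Fin m → Option (Fin d), ∑ a,
        coef D c s (Fin.cons (some a) I : Fin (m + 1) → Option (Fin d)) ^ 2 := by
  refine Finset.sum_le_sum fun I _ => ?_
  have := Finset.sum_mul_sq_le_sq_mul_sq Finset.univ (fun a => w a)
    (fun a => coef D c s (Fin.cons (some a) I : Fin (m + 1) → Option (Fin d)))
  have hw2 : ∑ a, w a ^ 2 = 1 := by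
    have := EuclideanSpace.norm_sq_eq w
    simpa [hw] using this.symm
  rwa [hw2, one_mul] at this

theorem sum_coef_cons_sq_le {D : Measure (Example d)} : ∑ I : Fin m → Option (Fin d), ∑ a,
      coef D c s (Fin.cons (some a) I : Fin (m + 1) → Option (Fin d)) ^ 2 ≤
      ∑ I : Fin (m + 1) → Option (Fin d), coef D c s I ^ 2 := by
  rw [sum_cons, Finset.sum_comm, Fintype.sum_option]
  exact le_add_of_nonneg_left (Finset.sum_nonneg fun _ _ => sq_nonneg _)

/-- The vector computed by the learner from all blocks. -/
def learnerVec (a₀ : Fin d) (c s : ℝ) {R n : ℕ}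
    (ω : Fin R → Fin (n + 1) → Fin (m + 1) → Example d) : EuclideanSpace ℝ (Fin d) :=
  WithLp.toLp 2 fun a => ∑ r, ∑ j : Fin n, sampleVec a₀ c s (ω r 0) (ω r j.succ) a

/-- The law of all blocks. -/
abbrev blockLaw (D : Measure (Example d)) (R n m : ℕ) :
    Measure (Fin R → Fin (n + 1) → Fin (m + 1) → Example d) :=
  Measure.pi fun _ => Measure.pi fun _ => Measure.pi fun _ => D

theorem allLp_block_mean (hD : D.map Prod.fst = gaussE d) {n : ℕ}
    (T : (Fin (m + 1) → Option (Fin d)) → ℝ) :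
    AllLp (fun ω : Fin (n + 1) → Fin (m + 1) → Example d => multi feat T (pos (ω 0)))
      (Measure.pi fun _ => Measure.pi fun _ => D) :=
  (allLp_multi_pos hD T).comp (measurePreserving_eval
    (fun _ : Fin (n + 1) => Measure.pi fun _ : Fin (m + 1) => D) 0)

theorem integral_block_mean_pow (hD : D.map Prod.fst = gaussE d) {n : ℕ}
    (T : (Fin (m + 1) → Option (Fin d)) → ℝ) (q : ℕ) :
    ∫ ω : Fin (n + 1) → Fin (m + 1) → Example d, multi feat T (pos (ω 0)) ^ q
      ∂(Measure.pi fun _ => Measure.pi fun _ => D) =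
      ∫ x, multi feat T x ^ q ∂(Measure.pi fun _ => gaussE d) := by
  rw [← integral_comp_pos hD ((allLp_multi allLp_feat T).pow q).aesm]
  exact integral_comp_eval (μ := fun _ : Fin (n + 1) => Measure.pi fun _ : Fin (m + 1) => D)
    (i := 0) ((allLp_multi_pos hD T).pow q).aesm

theorem contract_combination {D : Measure (Example d)} (w : EuclideanSpace ℝ (Fin d)) (a₀ : Fin d)
    (x : Fin (m + 1) → EuclideanSpace ℝ (Fin d)) :
    ∑ a, w a * multi feat (meanCoef D a₀ c s a) x =
      multi feat (liftCoef (some a₀) (contract D c s w)) x := by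
  simp_rw [meanCoef, multi_liftCoef, multi, contract, Finset.sum_mul, Finset.mul_sum]
  rw [Finset.sum_comm]
  exact Finset.sum_congr rfl fun I _ => Finset.sum_congr rfl fun a _ => by ring

/-- The first event: the conditional expectations add up in the direction of `w`. -/
theorem le_measure_signal (hD : D.map Prod.fst = gaussE d) (a₀ : Fin d)
    (w : EuclideanSpace ℝ (Fin d)) (R n : ℕ) (hR : 64 ^ (m + 1) ≤ R)
    (hS : 0 < ∑ I : Fin m → Option (Fin d), contract D c s w I ^ 2) :
    1 / 20 ≤ (blockLaw D R n m).real
      {ω | √(R * ∑ I : Fin m → Option (Fin d), contract D c s w I ^ 2) / 8 ≤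
        ∑ r, multi feat (liftCoef (some a₀) (contract D c s w)) (pos (ω r 0))} := by
  set T := liftCoef (some a₀) (contract (m := m) D c s w) with hT
  have h2 : ∫ ω : Fin (n + 1) → Fin (m + 1) → Example d, multi feat T (pos (ω 0)) ^ 2
      ∂(Measure.pi fun _ => Measure.pi fun _ => D) =
      ∑ I : Fin m → Option (Fin d), contract D c s w I ^ 2 := by
    rw [integral_block_mean_pow hD, integral_multi_sq, hT, sum_liftCoef_sq]
  have h1 : ∫ ω : Fin (n + 1) → Fin (m + 1) → Example d, multi feat T (pos (ω 0))
      ∂(Measure.pi fun _ => Measure.pi fun _ => D) = 0 := by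
    have := integral_block_mean_pow hD (n := n) T 1
    simp only [pow_one] at this
    rw [this, hT, integral_multi_lift]
  have h4 : ∫ ω : Fin (n + 1) → Fin (m + 1) → Example d, multi feat T (pos (ω 0)) ^ 4
      ∂(Measure.pi fun _ => Measure.pi fun _ => D) ≤
      R * (∑ I : Fin m → Option (Fin d), contract D c s w I ^ 2) ^ 2 := by
    have h5 := integral_multi_pow_le (μ := gaussE d) allLp_feat 2 (by norm_num) _ (by positivity)
      (integral_feat_pow_le 2 (by norm_num)) T
    rw [integral_block_mean_pow hD]
    refine h5.trans ?_
    rw [hT, sum_liftCoef_sq]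
    -- For q = 2 the hypercontractive constant is 8² = 64 per slot, and there are m + 1 slots.
    norm_num
    gcongr
    exact_mod_cast hR
  have := le_measure_sum_pi (allLp_block_mean hD (n := n) T) h1 R
    (lt_of_lt_of_le (by positivity) hR) (by rw [h2]; exact hS) (by rw [h2]; exact h4)
  rwa [h2] at this

/-- The second event: the conditional expectations are not too long. -/
theorem measure_mean_le (hD : D.map Prod.fst = gaussE d) (a₀ : Fin d) (R n : ℕ) (hR : 0 < R)
    (hB : 0 < ∑ I : Fin (m + 1) → Option (Fin d), coef D c s I ^ 2) :
    (blockLaw D R n m).real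
      {ω | 100 * R * ∑ I : Fin (m + 1) → Option (Fin d), coef D c s I ^ 2 ≤
        ∑ a, (∑ r, multi feat (meanCoef D a₀ c s a) (pos (ω r 0))) ^ 2} ≤ 1 / 100 := by
  have hL : ∀ a, AllLp (fun ω : Fin R → Fin (n + 1) → Fin (m + 1) → Example d =>
      (∑ r, multi feat (meanCoef D a₀ c s a) (pos (ω r 0))) ^ 2) (blockLaw D R n m) :=
    fun a => (allLp_sum_pi (allLp_block_mean hD _) R).pow 2
  refine markov_real (AllLp.finsetSum fun a _ => hL a).integrable
    (fun ω => Finset.sum_nonneg fun a _ => sq_nonneg _)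
    (by have : (0 : ℝ) < R := by exact_mod_cast hR
        positivity) ?_
  rw [integral_finsetSum _ fun a _ => (hL a).integrable]
  have h : ∀ a, ∫ ω : Fin R → Fin (n + 1) → Fin (m + 1) → Example d,
      (∑ r, multi feat (meanCoef D a₀ c s a) (pos (ω r 0))) ^ 2 ∂(blockLaw D R n m) =
      R * ∑ I : Fin m → Option (Fin d),
        coef D c s (Fin.cons (some a) I : Fin (m + 1) → Option (Fin d)) ^ 2 := by
    intro a
    have h1 : ∫ ω : Fin (n + 1) → Fin (m + 1) → Example d,
        multi feat (meanCoef D a₀ c s a) (pos (ω 0))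
        ∂(Measure.pi fun _ => Measure.pi fun _ => D) = 0 := by
      have h1 := integral_block_mean_pow hD (n := n) (meanCoef (m := m) D a₀ c s a) 1
      simp only [pow_one] at h1
      rw [h1]
      exact integral_multi_lift _ _
    rw [integral_sum_sq_pi (allLp_block_mean hD _) h1, integral_block_mean_pow hD,
      integral_multi_sq, meanCoef, sum_liftCoef_sq]
  simp_rw [h]
  rw [← Finset.mul_sum, Finset.sum_comm, mul_assoc]
  have := sum_coef_cons_sq_le (D := D) (c := c) (s := s) (m := m)
  gcongr

/-- The third event: the deviations are small. -/
theorem measure_err_le (hD : D.map Prod.fst = gaussE d) (hc : 0 ≤ c) (hs : 0 ≤ s)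
    (hcs : c ^ 2 + s ^ 2 = 1) (a₀ : Fin d) (R n : ℕ) {B : ℝ} (hB : 0 < B)
    (h : 100 * (R ^ 2 * n * d * (d + 1) ^ m) ≤ B) :
    (blockLaw D R n m).real {ω | B ≤ ∑ a, (∑ r, blockErr D a₀ c s (ω r) a) ^ 2} ≤ 1 / 100 := by
  have hL : ∀ a, AllLp (fun ω : Fin R → Fin (n + 1) → Fin (m + 1) → Example d =>
      (∑ r, blockErr D a₀ c s (ω r) a) ^ 2) (blockLaw D R n m) :=
    fun a => (allLp_sum_pi (allLp_blockErr hD hc hs hcs a₀ n a) R).pow 2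
  refine markov_real (AllLp.finsetSum fun a _ => hL a).integrable
    (fun ω => Finset.sum_nonneg fun a _ => sq_nonneg _) hB ?_
  rw [integral_finsetSum _ fun a _ => (hL a).integrable]
  refine le_trans ?_ h
  gcongr
  have h1 : ∀ a ∈ Finset.univ, ∫ ω : Fin R → Fin (n + 1) → Fin (m + 1) → Example d,
      (∑ r, blockErr D a₀ c s (ω r) a) ^ 2 ∂(blockLaw D R n m) ≤ R ^ 2 * (n * (d + 1) ^ m) := by
    intro a _
    have hE := (allLp_blockErr (m := m) hD hc hs hcs a₀ n a).pow 2
    have hEr : ∀ r : Fin R, AllLp (fun ω : Fin R → Fin (n + 1) → Fin (m + 1) → Example d =>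
        blockErr D a₀ c s (ω r) a ^ 2) (blockLaw D R n m) := fun r =>
      hE.comp (measurePreserving_eval (fun _ : Fin R =>
        Measure.pi fun _ : Fin (n + 1) => Measure.pi fun _ : Fin (m + 1) => D) r)
    -- Cauchy–Schwarz over the blocks; the lost factor R is absorbed by taking n large.
    calc _ ≤ ∫ ω : Fin R → Fin (n + 1) → Fin (m + 1) → Example d,
          R * ∑ r, blockErr D a₀ c s (ω r) a ^ 2 ∂(blockLaw D R n m) := by
          refine integral_mono (hL a).integrable
            ((AllLp.finsetSum fun r _ => hEr r).const_mul _).integrable fun ω => ?_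
          have := sq_sum_le_card_mul_sum_sq (s := Finset.univ)
            (f := fun r : Fin R => blockErr D a₀ c s (ω r) a)
          simpa using this
      _ = R * ∑ r : Fin R, ∫ ω, blockErr D a₀ c s ω a ^ 2
          ∂(Measure.pi fun _ : Fin (n + 1) => Measure.pi fun _ : Fin (m + 1) => D) := by
          rw [integral_const_mul, integral_finsetSum _ fun r _ => (hEr r).integrable]
          congr 1
          exact Finset.sum_congr rfl fun r _ => integral_comp_eval (μ := fun _ : Fin R =>
            Measure.pi fun _ : Fin (n + 1) => Measure.pi fun _ : Fin (m + 1) => D) hE.aesm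
      _ ≤ R * ∑ r : Fin R, (n * (d + 1) ^ m : ℝ) := by
          gcongr
          exact integral_blockErr_sq_le hD hc hs hcs a₀ n a
      _ = _ := by simp; ring
  refine (Finset.sum_le_card_nsmul _ _ _ h1).trans_eq ?_
  simp; ring

/-- With constant probability, the vector computed by the learner correlates with `w`. -/
theorem le_measure_learnerVec (hD : D.map Prod.fst = gaussE d) (hc : 0 ≤ c) (hs : 0 ≤ s)
    (hcs : c ^ 2 + s ^ 2 = 1) (a₀ : Fin d) {w : EuclideanSpace ℝ (Fin d)} (hw : ‖w‖ = 1)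
    (R n : ℕ) (hR : 64 ^ (m + 1) ≤ R)
    (hS : 0 < ∑ I : Fin m → Option (Fin d), contract D c s w I ^ 2)
    (hn : 25600 * (R * d * (d + 1) ^ m) ≤
      n * ∑ I : Fin m → Option (Fin d), contract D c s w I ^ 2) :
    3 / 100 ≤ (blockLaw D R n m).real {ω | 0 < inner ℝ (learnerVec a₀ c s ω) w ∧
      √(∑ I : Fin m → Option (Fin d), contract D c s w I ^ 2) * ‖learnerVec a₀ c s ω‖ ≤
        176 * √(∑ I : Fin (m + 1) → Option (Fin d), coef D c s I ^ 2) *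
          inner ℝ (learnerVec a₀ c s ω) w} := by
  set S := ∑ I : Fin m → Option (Fin d), contract D c s w I ^ 2 with hSdef
  set B := ∑ I : Fin (m + 1) → Option (Fin d), coef D c s I ^ 2 with hBdef
  have hSB : S ≤ B := (sum_contract_sq_le w hw).trans sum_coef_cons_sq_le
  have hB0 : 0 < B := hS.trans_le hSB
  have hR0 : 0 < R := lt_of_lt_of_le (by positivity) hR
  have hR' : (0 : ℝ) < R := by exact_mod_cast hR0
  have hd' : (0 : ℝ) < d := by exact_mod_cast (Fin.pos a₀)
  have hn' : (0 : ℝ) < n := by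
    have : (0 : ℝ) < n * S := lt_of_lt_of_le (by positivity) hn
    exact pos_of_mul_pos_left this hS.le
  set ν := blockLaw D R n m
  set A₁ := {ω : Fin R → Fin (n + 1) → Fin (m + 1) → Example d | √(R * S) / 8 ≤
    ∑ r, multi feat (liftCoef (some a₀) (contract D c s w)) (pos (ω r 0))} with hA1
  set A₂ := {ω : Fin R → Fin (n + 1) → Fin (m + 1) → Example d | 100 * R * B ≤
    ∑ a, (∑ r, multi feat (meanCoef D a₀ c s a) (pos (ω r 0))) ^ 2} with hA2
  set A₃ := {ω : Fin R → Fin (n + 1) → Fin (m + 1) → Example d | n ^ 2 * (R * S) / 256 ≤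
    ∑ a, (∑ r, blockErr D a₀ c s (ω r) a) ^ 2} with hA3
  have p1 : 1 / 20 ≤ ν.real A₁ := le_measure_signal hD a₀ w R n hR hS
  have p2 : ν.real A₂ ≤ 1 / 100 := measure_mean_le hD a₀ R n hR0 hB0
  have p3 : ν.real A₃ ≤ 1 / 100 := by
    refine measure_err_le hD hc hs hcs a₀ R n (by positivity) ?_
    rw [le_div_iff₀ (by norm_num)]
    calc 100 * ((R : ℝ) ^ 2 * n * d * (d + 1) ^ m) * 256 =
        (R * n : ℝ) * (25600 * (R * d * (d + 1) ^ m)) := by ring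
      _ ≤ (R * n : ℝ) * (n * S) := by gcongr
      _ = _ := by ring
  set E := {ω : Fin R → Fin (n + 1) → Fin (m + 1) → Example d |
    0 < inner ℝ (learnerVec a₀ c s ω) w ∧
      √S * ‖learnerVec a₀ c s ω‖ ≤ 176 * √B * inner ℝ (learnerVec a₀ c s ω) w} with hE
  have hsub : A₁ ⊆ E ∪ (A₂ ∪ A₃) := by
    intro ω h1
    by_cases h2 : ω ∈ A₂
    · exact Or.inr (Or.inl h2)
    by_cases h3 : ω ∈ A₃
    · exact Or.inr (Or.inr h3)
    left
    rw [hA1, Set.mem_ofPred_eq] at h1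
    rw [hA2, Set.mem_ofPred_eq, not_le] at h2
    rw [hA3, Set.mem_ofPred_eq, not_le] at h3
    set U : EuclideanSpace ℝ (Fin d) :=
      WithLp.toLp 2 fun a => ∑ r, multi feat (meanCoef D a₀ c s a) (pos (ω r 0)) with hU
    set F : EuclideanSpace ℝ (Fin d) :=
      WithLp.toLp 2 fun a => ∑ r, blockErr D a₀ c s (ω r) a with hF
    -- Signal plus noise. Off the bad events ⟨U, w⟩ ≥ σ/8, ‖U‖ ≤ 10β and ‖F‖ ≤ nσ/16, so the inner
    -- product is at least nσ/16 and the length at most 11nβ; hence 176 = 11 · 16.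
    have hv : learnerVec a₀ c s ω = (n : ℝ) • U + F := by
      ext a
      simp only [learnerVec, hU, hF, PiLp.add_apply, PiLp.smul_apply, smul_eq_mul,
        Finset.mul_sum, ← Finset.sum_add_distrib, blockErr]
      refine Finset.sum_congr rfl fun r _ => ?_
      rw [Finset.sum_sub_distrib]
      simp
    have hUw : inner ℝ U w = ∑ r, multi feat (liftCoef (some a₀) (contract D c s w))
        (pos (ω r 0)) := by
      simp only [PiLp.inner_apply, hU, RCLike.inner_apply, conj_trivial]
      simp_rw [Finset.mul_sum]
      rw [Finset.sum_comm]
      exact Finset.sum_congr rfl fun r _ => contract_combination w a₀ _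
    have hUn : ‖U‖ ^ 2 < 100 * R * B := by
      rw [EuclideanSpace.norm_sq_eq]
      simpa [hU] using h2
    have hFn : ‖F‖ ^ 2 < n ^ 2 * (R * S) / 256 := by
      rw [EuclideanSpace.norm_sq_eq]
      simpa [hF] using h3
    set σ := √(R * S) with hσ
    set β := √(R * B) with hβ
    have hσ2 : σ ^ 2 = R * S := Real.sq_sqrt (by positivity)
    have hβ2 : β ^ 2 = R * B := Real.sq_sqrt (by positivity)
    have hσ0 : 0 < σ := Real.sqrt_pos.2 (by positivity)
    have hβ0 : 0 < β := Real.sqrt_pos.2 (by positivity)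
    have hσβ : σ ≤ β := Real.sqrt_le_sqrt (by gcongr)
    have hF1 : ‖F‖ ≤ n * σ / 16 := by
      refine abs_le_of_sq_le_sq' ?_ (by positivity) |>.2
      rw [div_pow, mul_pow, hσ2]
      norm_num
      linarith
    have hU1 : ‖U‖ ≤ 10 * β := by
      refine abs_le_of_sq_le_sq' ?_ (by positivity) |>.2
      rw [mul_pow, hβ2]
      norm_num
      linarith
    have hFw : -(n * σ / 16) ≤ inner ℝ F w := by
      have := abs_real_inner_le_norm F w
      rw [hw, mul_one] at this
      linarith [neg_abs_le (inner ℝ F w : ℝ)]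
    have hin : n * σ / 16 ≤ inner ℝ (learnerVec a₀ c s ω) w := by
      rw [hv, inner_add_left, real_inner_smul_left, hUw]
      have := mul_le_mul_of_nonneg_left h1 hn'.le
      linarith
    have hnorm : ‖learnerVec a₀ c s ω‖ ≤ 11 * n * β := by
      rw [hv]
      refine (norm_add_le _ _).trans ?_
      rw [norm_smul, Real.norm_eq_abs, abs_of_pos hn']
      have := mul_le_mul_of_nonneg_left hU1 hn'.le
      have := mul_le_mul_of_nonneg_left hσβ hn'.le
      nlinarith
    refine ⟨lt_of_lt_of_le (by positivity) hin, ?_⟩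
    have hσ' : σ = √R * √S := Real.sqrt_mul hR'.le S
    have hβ' : β = √R * √B := Real.sqrt_mul hR'.le B
    calc √S * ‖learnerVec a₀ c s ω‖ ≤ √S * (11 * n * β) := by gcongr
      _ = 176 * √B * (n * σ / 16) := by rw [hσ', hβ']; ring
      _ ≤ _ := by gcongr
  -- The probability left is 1/20 - 1/100 - 1/100 = 3/100.
  have h1 : ν.real A₁ ≤ ν.real E + (ν.real A₂ + ν.real A₃) :=
    (measureReal_mono hsub).trans ((measureReal_union_le _ _).trans
      (add_le_add_right (measureReal_union_le _ _) _))
  linarith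

end Learner

end


/-! ### From tensor norms to the guaranteed correlation. -/

noncomputable section

section Guarantee

/-! ### The correlation guaranteed by the learner -/

variable {d m : ℕ} {D : Measure (Example d)} [IsProbabilityMeasure D] {c s : ℝ}

/-- All q are allowed on one and the same event, since q enters only through the deterministic bound
on B. -/
theorem le_measure_corr (hD : D.map Prod.fst = gaussE d) (hm4 : 4 ≤ m) (hme : Even m)
    (hc : 0 ≤ c) (hs : 0 ≤ s) (hc2 : c ^ 2 = 1 / (m + 1)) (hs2 : s ^ 2 = m / (m + 1))
    {w : EuclideanSpace ℝ (Fin d)} (hw : ‖w‖ = 1) {t₀ : ℝ} (ht0 : 1 ≤ t₀) (htm : t₀ ^ 2 + 2 ≤ m)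
    (hneg : ∀ᵐ z ∂D, z.2 = -1 → inner ℝ w z.1 ≤ t₀) (a₀ : Fin d) {ε : ℝ} (hε : 0 < ε)
    (hεP : ε ≤ ∫ z, lbl z ∂D) (R n : ℕ) (hR : 64 ^ (m + 1) ≤ R)
    (hn : 25600 * (R * d * (d + 1) ^ m) * 4096 ^ m ≤ n * ε ^ 2) :
    3 / 100 ≤ (blockLaw D R n m).real {ω | 0 < inner ℝ (learnerVec a₀ c s ω) w ∧
      ∀ q : ℕ, 1 ≤ q → ε ^ (1 / (2 * q) : ℝ) * ‖learnerVec a₀ c s ω‖ ≤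
        176 * 64 ^ m * √(4 * q) ^ (m + 1) * inner ℝ (learnerVec a₀ c s ω) w} := by
  have hcs : c ^ 2 + s ^ 2 = 1 := by rw [hc2, hs2]; field_simp; ring
  have hP : 0 < ∫ z, lbl z ∂D := hε.trans_le hεP
  have hS := sq_integral_lbl_le hD hm4 hme hc hs hc2 hs2 hw ht0 htm hneg
  have hB := sum_coef_sq_pow_le (m := m) hD hc hs hcs hP
  set P := ∫ z, lbl z ∂D
  have hS0 : 0 < ∑ I : Fin m → Option (Fin d), contract D c s w I ^ 2 :=
    pos_of_mul_pos_right (lt_of_lt_of_le (by positivity) hS) (by positivity)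
  have hL := le_measure_learnerVec hD hc hs hcs a₀ hw R n hR hS0 (by
    have h1 : ε ^ 2 ≤ P ^ 2 := by gcongr
    have h2 := mul_le_mul_of_nonneg_left (h1.trans hS) (Nat.cast_nonneg (α := ℝ) n)
    have h3 := hn.trans h2
    have h4 : (0 : ℝ) < 4096 ^ m := by positivity
    refine le_of_mul_le_mul_right ?_ h4
    linarith)
  refine hL.trans (measureReal_mono fun ω hω => ⟨hω.1, fun q hq => ?_⟩)
  obtain ⟨h0, h1⟩ := hω
  specialize hB q hq
  set S := ∑ I : Fin m → Option (Fin d), contract D c s w I ^ 2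
  set B := ∑ I : Fin (m + 1) → Option (Fin d), coef D c s I ^ 2 with hBdef
  have hB0 : 0 ≤ B := Finset.sum_nonneg fun I _ => sq_nonneg _
  set x := inner ℝ (learnerVec a₀ c s ω) w
  set v := ‖learnerVec a₀ c s ω‖ with hv
  have hv0 : 0 ≤ v := norm_nonneg _
  set e := ε ^ (1 / (2 * q) : ℝ) with he
  have he0 : 0 ≤ e := Real.rpow_nonneg hε.le _
  have heq : e ^ (2 * q) = ε := by
    rw [he, ← Real.rpow_natCast, ← Real.rpow_mul hε.le]
    push_cast
    rw [one_div_mul_cancel (by positivity), Real.rpow_one]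
  have hPS : P ≤ 64 ^ m * √S := by
    refine abs_le_of_sq_le_sq' ?_ (by positivity) |>.2
    rw [mul_pow, Real.sq_sqrt hS0.le, ← pow_mul, mul_comm m 2, pow_mul]
    norm_num
    exact hS
  -- One factor P ≥ ε supplies the missing power: ε B^q ≤ P^{2q} (4q)^{q(m+1)}. Together with P ≤
  -- 64^m √S, the mass P then cancels from the correlation.
  have hBe : e * √B ≤ P * √(4 * q) ^ (m + 1) := by
    refine le_of_pow_le_pow_left₀ (n := 2 * q) (by omega) (by positivity) ?_
    calc (e * √B) ^ (2 * q) = ε * B ^ q := by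
          rw [mul_pow, heq, pow_mul (√B), Real.sq_sqrt hB0]
      _ ≤ P * (P ^ (2 * q - 1) * ((4 * q) ^ q) ^ (m + 1)) := by gcongr
      _ = (P * √(4 * q) ^ (m + 1)) ^ (2 * q) := by
          have h5 : √(4 * q) ^ (2 * q) = (4 * q : ℝ) ^ q := by
            rw [pow_mul, Real.sq_sqrt (by positivity)]
          rw [mul_pow P, pow_right_comm √(4 * q : ℝ), h5, ← mul_assoc, ← pow_succ',
            Nat.sub_add_cancel (by omega)]
  refine le_of_mul_le_mul_left ?_ hP
  calc P * (e * v) ≤ (64 ^ m * √S) * (e * v) := by gcongr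
    _ = 64 ^ m * e * (√S * v) := by ring
    _ ≤ 64 ^ m * e * (176 * √B * x) := by gcongr
    _ = 176 * 64 ^ m * (e * √B) * x := by ring
    _ ≤ 176 * 64 ^ m * (P * √(4 * q) ^ (m + 1)) * x := by gcongr
    _ = _ := by ring

theorem negative_mass_le {t : ℝ} {w : EuclideanSpace ℝ (Fin d)} (hw : ‖w‖ = 1)
    (hD : D.map Prod.fst = gaussE d) (hrel : ReliabilityCondition D (halfspace w t)) :
    (∀ᵐ z ∂D, z.2 = -1 → inner ℝ w z.1 < t) ∧ ∫ z, lbl z ∂D ≤ gauss.real (Set.Iio t) := by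
  have h : ∀ᵐ z ∂D, z.2 = -1 → inner ℝ w z.1 < t := by
    rw [ae_iff]
    refine measure_mono_null (fun z hz => ?_) hrel
    simp only [Set.mem_ofPred_eq, not_forall, not_lt] at hz ⊢
    obtain ⟨h1, h2⟩ := hz
    exact ⟨by rw [halfspace, if_pos (sub_nonneg.2 h2)], h1⟩
  refine ⟨h, ?_⟩
  have hmp : MeasurePreserving (fun z : Example d => (inner ℝ w z.1 : ℝ)) D gauss :=
    (measurePreserving_inner hw).comp (measurePreserving_fst_of_map hD)
  rw [integral_lbl, ← hmp.measureReal_preimage measurableSet_Iio.nullMeasurableSet]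
  exact ENNReal.toReal_mono (measure_ne_top _ _) (measure_mono_ae h)

theorem gauss_Iio_lt_one (a : ℝ) : gauss.real (Set.Iio a) < 1 := by
  have h : 0 < gauss.real (Set.Ioi a) := by
    refine ENNReal.toReal_pos (fun h => ?_) (measure_ne_top _ _)
    simpa using gaussianReal_absolutelyContinuous' 0 one_ne_zero h
  have h2 : gauss.real (Set.Iio a) + gauss.real (Set.Ioi a) ≤ 1 := by
    rw [← measureReal_union (by
      rw [Set.disjoint_left]; exact fun x (hx : x < a) (hx' : a < x) => lt_asymm hx hx') measurableSet_Ioi]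
    exact measureReal_le_one
  linarith

/-- The lower bound in terms of the number of negative examples is bounded away from `1`. -/
theorem exists_log_lower_bound (C₀ : ℝ) : ∃ l : ℝ, 0 < l ∧ ∀ ε t : ℝ, 0 < ε → ε < 1 →
    |t| ≤ C₀ * √(Real.log (1 / ε)) → ε ≤ gauss.real (Set.Iio t) → l ≤ Real.log (1 / ε) := by
  -- If ε > 1/2 then log(1/ε) ≤ 1, so t ≤ |C₀| and ε is at most the Gaussian mass below |C₀|. A
  -- lower bound on log(1/ε) is needed for ε^A to absorb constants.
  set b := max (1 / 2) (gauss.real (Set.Iio |C₀|)) with hb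
  have hb0 : 0 < b := lt_of_lt_of_le (by norm_num) (le_max_left _ _)
  have hb1 : b < 1 := max_lt (by norm_num) (gauss_Iio_lt_one _)
  refine ⟨Real.log (1 / b), Real.log_pos (by rw [lt_div_iff₀ hb0]; linarith),
    fun ε t hε hε1 ht hεt => Real.log_le_log (by positivity) ?_⟩
  refine one_div_le_one_div_of_le hε ?_
  by_cases h : ε ≤ 1 / 2
  · exact h.trans (le_max_left _ _)
  · push Not at h
    refine (hεt.trans (measureReal_mono (Set.Iio_subset_Iio ?_))).trans (le_max_right _ _)
    have h1 : Real.log (1 / ε) ≤ 1 := by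
      have h2 := Real.log_le_sub_one_of_pos (x := 1 / ε) (by positivity)
      have h3 : 1 / ε ≤ 2 := by rw [div_le_iff₀ hε]; linarith
      linarith
    have h4 : √(Real.log (1 / ε)) ≤ 1 := Real.sqrt_le_one.2 h1
    have h5 := Real.sqrt_nonneg (Real.log (1 / ε))
    calc t ≤ |t| := le_abs_self t
      _ ≤ C₀ * √(Real.log (1 / ε)) := ht
      _ ≤ |C₀| * 1 := mul_le_mul (le_abs_self _) h4 h5 (abs_nonneg _)
      _ = |C₀| := mul_one _

/-- With q = ⌈L⌉ one has ε^{1/(2q)} ≥ e^{-1/2} ≥ 1/L. Since L ≥ 2, all constants are powers of L: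
the exponent is at most 8m + 11 ≤ 59 t'. -/
theorem rpow_neg_log_le {ε t' x v : ℝ} {m : ℕ} (hε : 0 < ε) (ht' : 1 ≤ t') (hm : m ≤ 6 * t')
    (hv : 0 ≤ v)
    (hx : 0 ≤ x) (h : ∀ q : ℕ, 1 ≤ q → ε ^ (1 / (2 * q) : ℝ) * v ≤
      176 * 64 ^ m * √(4 * q) ^ (m + 1) * x) :
    (max (Real.log (1 / ε)) 2) ^ (-(59 * t')) * v ≤ x := by
  set L := max (Real.log (1 / ε)) 2 with hL
  have hL2 : 2 ≤ L := le_max_right _ _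
  have hL0 : 0 < L := by linarith
  set q := ⌈L⌉₊ with hq
  have hqL : L ≤ q := Nat.le_ceil L
  have hq1 : (q : ℝ) < L + 1 := Nat.ceil_lt_add_one hL0.le
  have hq0 : 1 ≤ q := Nat.one_le_iff_ne_zero.2 (by rw [hq, Ne, Nat.ceil_eq_zero]; linarith)
  have h1 : L⁻¹ ≤ ε ^ (1 / (2 * q) : ℝ) := by
    rw [Real.rpow_def_of_pos hε, ← Real.exp_log (inv_pos.2 hL0), Real.log_inv]
    apply Real.exp_le_exp.2
    have h2 : -L ≤ Real.log ε := by
      have := le_max_left (Real.log (1 / ε)) 2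
      rw [one_div, Real.log_inv] at this
      rw [hL, one_div, Real.log_inv]
      linarith
    have h3 : (1 / 2 : ℝ) ≤ Real.log L := by
      have := Real.log_two_gt_d9
      have := Real.log_le_log (by norm_num) hL2
      linarith
    have h4 : -(1 / 2 : ℝ) ≤ Real.log ε * (1 / (2 * q)) := by
      rw [mul_one_div, le_div_iff₀ (by linarith)]
      linarith
    linarith
  have h2 : √(4 * q) ≤ L ^ 2 := by
    rw [Real.sqrt_le_left (by positivity)]
    nlinarith [mul_nonneg (sub_nonneg.2 hL2) (sub_nonneg.2 hL2), pow_le_pow_left₀ (by norm_num) hL2 3]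
  have h3 : (176 * 64 ^ m * √(4 * q) ^ (m + 1) : ℝ) ≤ L ^ (8 * m + 10) := by
    calc (176 * 64 ^ m * √(4 * q) ^ (m + 1) : ℝ) ≤ L ^ 8 * (L ^ 6) ^ m * (L ^ 2) ^ (m + 1) := by
          gcongr
          · have := pow_le_pow_left₀ (by norm_num) hL2 8
            linarith
          · have := pow_le_pow_left₀ (by norm_num) hL2 6
            linarith
      _ = _ := by ring
  have h4 : L ^ (8 * m + 11) ≤ L ^ (59 * t') := by
    rw [← Real.rpow_natCast]
    refine Real.rpow_le_rpow_of_exponent_le (by linarith) ?_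
    push_cast
    linarith
  rw [Real.rpow_neg hL0.le, inv_mul_le_iff₀ (by positivity)]
  have h5 : L⁻¹ * v ≤ L ^ (8 * m + 10) * x :=
    (mul_le_mul_of_nonneg_right h1 hv).trans ((h q hq0).trans (by gcongr))
  rw [inv_mul_le_iff₀ hL0] at h5
  refine h5.trans ?_
  rw [← mul_assoc, ← pow_succ']
  gcongr

/-- The case q = 1: the loss is at most e^{7m+9} ≤ e^{51 t'}, and t' is at most a constant times
log(1/ε), so a fixed power of ε compensates for it. -/
theorem rpow_mul_le {ε t' x v l C₀ : ℝ} {m : ℕ} (hε : 0 < ε) (ht' : 1 ≤ t')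
    (htl : t' ≤ (C₀ ^ 2 + 1 / l) * Real.log (1 / ε)) (hm : m ≤ 6 * t') (hx : 0 ≤ x)
    (h : ∀ q : ℕ, 1 ≤ q → ε ^ (1 / (2 * q) : ℝ) * v ≤ 176 * 64 ^ m * √(4 * q) ^ (m + 1) * x) :
    ε ^ (1 / 2 + 51 * (C₀ ^ 2 + 1 / l)) * v ≤ x := by
  have h1 := h 1 le_rfl
  have h2 : √(4 * (1 : ℕ)) = 2 := by
    rw [show (4 * (1 : ℕ) : ℝ) = 2 ^ 2 by norm_num, Real.sqrt_sq (by norm_num)]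
  rw [h2] at h1
  have h3 : (176 * 64 ^ m * 2 ^ (m + 1) : ℝ) ≤ Real.exp (51 * t') := by
    calc (176 * 64 ^ m * 2 ^ (m + 1) : ℝ) ≤ 2 ^ 8 * (2 ^ 6) ^ m * 2 ^ (m + 1) := by
          gcongr <;> norm_num
      _ = 2 ^ (7 * m + 9) := by rw [← pow_mul, ← pow_add, ← pow_add]; congr 1; ring
      _ ≤ Real.exp 1 ^ (7 * m + 9) := by
          gcongr
          have := Real.add_one_le_exp 1
          linarith
      _ ≤ _ := by
          rw [← Real.exp_nat_mul]
          apply Real.exp_le_exp.2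
          push_cast
          linarith
  have h4 : ε ^ (51 * (C₀ ^ 2 + 1 / l)) * Real.exp (51 * t') ≤ 1 := by
    rw [Real.rpow_def_of_pos hε, ← Real.exp_add, Real.exp_le_one_iff]
    have h6 : Real.log (1 / ε) = -Real.log ε := by rw [one_div, Real.log_inv]
    rw [h6] at htl
    linarith
  rw [Real.rpow_add hε, mul_comm (ε ^ (1 / 2 : ℝ)), mul_assoc]
  have h5 : ε ^ (1 / 2 : ℝ) * v ≤ Real.exp (51 * t') * x := by
    have e : (1 / (2 * (1 : ℕ)) : ℝ) = 1 / 2 := by norm_num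
    rw [e] at h1
    exact h1.trans (by gcongr)
  calc _ ≤ ε ^ (51 * (C₀ ^ 2 + 1 / l)) * (Real.exp (51 * t') * x) := by gcongr
    _ = (ε ^ (51 * (C₀ ^ 2 + 1 / l)) * Real.exp (51 * t')) * x := by ring
    _ ≤ 1 * x := by gcongr
    _ = x := one_mul x

/-- For every bound on the threshold there is an exponent with which the learner is correct. -/
theorem exists_exponent (C₀ : ℝ) : ∃ A : ℝ, 0 < A ∧ ∀ (d m : ℕ) (ε t : ℝ)
    (w : EuclideanSpace ℝ (Fin d)) (D : Measure (Example d)) [IsProbabilityMeasure D] (R n : ℕ)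
    (a₀ : Fin d), 0 < ε → ε < 1 → ‖w‖ = 1 → |t| ≤ C₀ * √(Real.log (1 / ε)) →
    D.map Prod.fst = gaussE d → ReliabilityCondition D (halfspace w t) →
    ENNReal.ofReal ε ≤ D {z | z.2 = -1} → Even m → t ^ 2 + 3 ≤ m → m ≤ t ^ 2 + 5 →
    64 ^ (m + 1) ≤ R → 25600 * (R * d * (d + 1) ^ m) * 4096 ^ m ≤ n * ε ^ 2 →
    3 / 100 ≤ (blockLaw D R n m).real {ω |
      0 < inner ℝ (learnerVec a₀ (1 / √(m + 1)) (√m / √(m + 1)) ω) w ∧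
      max ((max (Real.log (1 / ε)) 2) ^ (-(59 * max (t ^ 2) 1))) (ε ^ A) *
        ‖learnerVec a₀ (1 / √(m + 1)) (√m / √(m + 1)) ω‖ ≤
        inner ℝ (learnerVec a₀ (1 / √(m + 1)) (√m / √(m + 1)) ω) w} := by
  obtain ⟨l, hl, hlb⟩ := exists_log_lower_bound C₀
  refine ⟨1 / 2 + 51 * (C₀ ^ 2 + 1 / l), by positivity, ?_⟩
  intro d m ε t w D _ R n a₀ hε hε1 hw ht hD hrel hεD hme hm3 hm5 hR hn
  obtain ⟨hneg, hPg⟩ := negative_mass_le hw hD hrel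
  have hεP : ε ≤ ∫ z, lbl z ∂D := by
    rw [integral_lbl, measureReal_def]
    exact (ENNReal.ofReal_le_iff_le_toReal (measure_ne_top _ _)).1 hεD
  have hlε := hlb ε t hε hε1 ht (hεP.trans hPg)
  have hm4 : 4 ≤ m := by
    have h3 : (3 : ℝ) ≤ m := by nlinarith [sq_nonneg t]
    have h3' : 3 ≤ m := by exact_mod_cast h3
    obtain ⟨k, rfl⟩ := hme
    omega
  have ht'1 : 1 ≤ max (t ^ 2) 1 := le_max_right _ _
  have hmt : (m : ℝ) ≤ 6 * max (t ^ 2) 1 := by linarith [le_max_left (t ^ 2) 1]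
  have htl : max (t ^ 2) 1 ≤ (C₀ ^ 2 + 1 / l) * Real.log (1 / ε) := by
    have hlog : 0 < Real.log (1 / ε) := hl.trans_le hlε
    have h1 : t ^ 2 ≤ C₀ ^ 2 * Real.log (1 / ε) := by
      have := pow_le_pow_left₀ (abs_nonneg t) ht 2
      rwa [sq_abs, mul_pow, Real.sq_sqrt hlog.le] at this
    have h2 : 1 ≤ 1 / l * Real.log (1 / ε) := by
      rw [one_div_mul_eq_div, le_div_iff₀ hl]; linarith
    have h3 : 0 ≤ C₀ ^ 2 * Real.log (1 / ε) := by positivity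
    rw [add_mul]
    exact max_le (by linarith) (by linarith)
  have hm1 : (0 : ℝ) < m + 1 := by positivity
  have := le_measure_corr hD hm4 hme (c := 1 / √(m + 1)) (s := √m / √(m + 1)) (by positivity)
    (by positivity) (by rw [div_pow, Real.sq_sqrt hm1.le, one_pow])
    (by rw [div_pow, Real.sq_sqrt hm1.le, Real.sq_sqrt (Nat.cast_nonneg m)]) hw
    -- The threshold polynomial needs a threshold of at least 1; raising it only enlarges the
    -- half-line that contains the negative examples.
    (t₀ := max |t| 1) (le_max_right _ _)
    (by
      rcases max_cases |t| 1 with h | h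
      · rw [h.1, sq_abs]; linarith
      · rw [h.1]; nlinarith [sq_nonneg t])
    (hneg.mono fun z hz hz' => (hz hz').le.trans ((le_abs_self t).trans (le_max_left _ _)))
    a₀ hε hεP R n hR hn
  refine this.trans (measureReal_mono fun ω hω => ⟨hω.1, ?_⟩)
  rw [max_mul_of_nonneg _ _ (norm_nonneg _)]
  exact max_le (rpow_neg_log_le hε ht'1 hmt (norm_nonneg _) hω.1.le hω.2)
    (rpow_mul_le hε ht'1 htl hmt hω.1.le hω.2)

end Guarantee

end


/-! ### Reasoning about runs; loops over coordinates. -/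

noncomputable section

namespace RealRAM

/-! ### Reasoning about runs -/

section Runs

variable {d : ℕ} {T : Tape d}

/-- Started in `s`, the program `p` halts after at most `c` steps in a state satisfying `Q`. -/
def Reaches (T : Tape d) (p : Prog) (s : State) (c : ℕ) (Q : State → Prop) : Prop :=
  ∃ n s', Exec T p s n s' ∧ n ≤ c ∧ Q s'

theorem Reaches.mono {p : Prog} {s : State} {c c' : ℕ} {Q Q' : State → Prop}
    (h : Reaches T p s c Q) (hc : c ≤ c') (hQ : ∀ s', Q s' → Q' s') : Reaches T p s c' Q' := by
  obtain ⟨n, s', h1, h2, h3⟩ := h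
  exact ⟨n, s', h1, h2.trans hc, hQ _ h3⟩

theorem Reaches.seq {p q : Prog} {s : State} {c c' : ℕ} {Q Q' : State → Prop}
    (h : Reaches T p s c Q) (h' : ∀ s', Q s' → Reaches T q s' c' Q') :
    Reaches T (.seq p q) s (c + c') Q' := by
  obtain ⟨n, s', h1, h2, h3⟩ := h
  obtain ⟨n', s'', h4, h5, h6⟩ := h' s' h3
  exact ⟨n + n', s'', .seq h1 h4, by omega, h6⟩

/-- The invariant is indexed by the number of completed iterations, so the exact iteration count
gives termination and running time. -/
theorem Reaches.while {b : Test} {p : Prog} (N c : ℕ) (I : ℕ → State → Prop)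
    (hI : ∀ k < N, ∀ s, I k s → b.Holds s ∧ Reaches T p s c (I (k + 1)))
    (hN : ∀ s, I N s → ¬ b.Holds s) {s : State} (h0 : I 0 s) :
    Reaches T (.while b p) s (N * (c + 1) + 1) (I N) := by
  have key : ∀ j ≤ N, ∀ s, I (N - j) s → Reaches T (.while b p) s (j * (c + 1) + 1) (I N) := by
    intro j
    induction j with
    | zero =>
      intro _ s hs
      exact ⟨1, s, .while_false (hN s hs), by omega, hs⟩
    | succ j ih =>
      intro hj s hs
      obtain ⟨hb, n, s', h1, h2, h3⟩ := hI _ (by omega) s hs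
      rw [show N - (j + 1) + 1 = N - j by omega] at h3
      obtain ⟨n', s'', h4, h5, h6⟩ := ih (by omega) s' h3
      exact ⟨n + n' + 1, s'', .while_true hb h1 h4, by linarith, h6⟩
  exact key N le_rfl s (by simpa using h0)

/-- Straight-line programs. -/
def block : List Instr → Prog
  | [] => .skip
  | a :: l => .seq (.instr a) (block l)

/-- The effect of a straight-line program. -/
def run (T : Tape d) : List Instr → State → State
  | [], s => s
  | a :: l, s => run T l (a.eval T s)

theorem reaches_block (l : List Instr) (s : State) {Q : State → Prop} (h : Q (run T l s)) :
    Reaches T (block l) s (l.map (Instr.cost d)).sum Q := by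
  induction l generalizing s with
  | nil => exact ⟨0, s, .skip s, le_rfl, h⟩
  | cons a l ih =>
    obtain ⟨n, s', h1, h2, h3⟩ := ih (a.eval T s) h
    exact ⟨_, s', .seq (.instr a s) h1, by simpa using h2, h3⟩

/-- The natural cells below `nl` and the real cells below `rl`, and among the real cells from `32`
on those outside of `[lo, hi)`, are the same in both states. -/
def Frame (nl rl lo hi : ℕ) (s s' : State) : Prop :=
  (∀ i < nl, s'.nat i = s.nat i) ∧
    ∀ i, (i < rl ∨ 32 ≤ i ∧ (i < lo ∨ hi ≤ i)) → s'.real i = s.real i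

theorem Frame.refl (nl rl lo hi : ℕ) (s : State) : Frame nl rl lo hi s s :=
  ⟨fun _ _ => rfl, fun _ _ => rfl⟩

theorem Frame.trans {nl rl lo hi : ℕ} {s s' s'' : State} (h : Frame nl rl lo hi s s')
    (h' : Frame nl rl lo hi s' s'') : Frame nl rl lo hi s s'' :=
  ⟨fun i hi => (h'.1 i hi).trans (h.1 i hi), fun i hi => (h'.2 i hi).trans (h.2 i hi)⟩

theorem Frame.mono {nl rl lo hi nl' rl' lo' hi' : ℕ} {s s' : State} (h : Frame nl rl lo hi s s')
    (h1 : nl' ≤ nl) (h2 : rl' ≤ rl) (h3 : lo' ≤ lo) (h4 : hi ≤ hi') :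
    Frame nl' rl' lo' hi' s s' :=
  ⟨fun i hi => h.1 i (by omega), fun i hi => h.2 i (by omega)⟩

end Runs

/-! ### Loops over the coordinates of vectors -/

section Vectors

variable {d : ℕ} {T : Tape d}

/-- A single pass overwrites x by the new residual and accumulates in real cell 20 the inner product
of the split component with the vector at natural cell 17, so the component is never stored. -/
def rotateBody : List Instr :=
  [.natAdd 19 3 18, .load 21 19, .natAdd 20 5 18, .load 22 20, .natAdd 21 17 18, .load 23 21,
    .mul 24 8 21, .mul 25 9 22, .add 24 24 25, .mul 24 24 23, .add 20 20 24,
    .mul 24 9 21, .mul 25 8 22, .sub 24 24 25, .store 19 24, .natAdd 18 18 1]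

theorem reaches_rotate {s : State} (h0 : s.nat 0 = d) (h1 : s.nat 1 = 1)
    (h3 : s.nat 3 = 2 * d + 32) (h5 : s.nat 5 = 3 * d + 33) (h17 : 4 * d + 34 ≤ s.nat 17)
    (h18 : s.nat 18 = 0) (h20 : s.real 20 = 0) :
    Reaches T (.while (.natLt 18 0) (block rotateBody)) s (17 * d + 1) fun s' =>
      Frame 18 20 (2 * d + 32) (3 * d + 32) s s' ∧ s'.drawn = s.drawn ∧
      (∀ a < d, s'.real (2 * d + 32 + a) =
        s.real 9 * s.real (2 * d + 32 + a) - s.real 8 * s.real (3 * d + 33 + a)) ∧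
      s'.real 20 = ∑ a ∈ Finset.range d, (s.real 8 * s.real (2 * d + 32 + a) +
        s.real 9 * s.real (3 * d + 33 + a)) * s.real (s.nat 17 + a) := by
  have key := Reaches.while (T := T) (b := .natLt 18 0) (p := block rotateBody) (s := s) d 16
    (fun k s' => Frame 18 20 (2 * d + 32) (3 * d + 32) s s' ∧ s'.drawn = s.drawn ∧
      s'.nat 18 = k ∧ (∀ a < k, s'.real (2 * d + 32 + a) =
        s.real 9 * s.real (2 * d + 32 + a) - s.real 8 * s.real (3 * d + 33 + a)) ∧
      (∀ a, k ≤ a → a < d → s'.real (2 * d + 32 + a) = s.real (2 * d + 32 + a)) ∧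
      s'.real 20 = ∑ a ∈ Finset.range k, (s.real 8 * s.real (2 * d + 32 + a) +
        s.real 9 * s.real (3 * d + 33 + a)) * s.real (s.nat 17 + a)) ?_ ?_ ?_
  · refine key.mono (by omega) ?_
    rintro s' ⟨hF, hd, -, hx, -, ha⟩
    exact ⟨hF, hd, hx, ha⟩
  · rintro k hk s' ⟨hF, hd, hk', hx, hx', ha⟩
    have e0 : s'.nat 0 = d := (hF.1 0 (by omega)).trans h0
    have e1 : s'.nat 1 = 1 := (hF.1 1 (by omega)).trans h1
    have e3 : s'.nat 3 = 2 * d + 32 := (hF.1 3 (by omega)).trans h3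
    have e5 : s'.nat 5 = 3 * d + 33 := (hF.1 5 (by omega)).trans h5
    have e17 : s'.nat 17 = s.nat 17 := hF.1 17 (by omega)
    have e8 : s'.real 8 = s.real 8 := hF.2 8 (by omega)
    have e9 : s'.real 9 = s.real 9 := hF.2 9 (by omega)
    have en : s'.real (3 * d + 33 + k) = s.real (3 * d + 33 + k) := hF.2 _ (by omega)
    have ez : s'.real (s.nat 17 + k) = s.real (s.nat 17 + k) := hF.2 _ (by omega)
    have ex := hx' k le_rfl hk
    refine ⟨by simp only [Test.Holds, e0, hk', hk], ?_⟩
    refine (reaches_block rotateBody s' ?_).mono (by simp [rotateBody, Instr.cost]) fun _ h => h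
    simp (disch := omega) only [rotateBody, run, Instr.eval, State.setNat, State.setReal,
      Function.update_self, Function.update_of_ne, e3, e5, e17, hk', ex, en, ez, e8, e9, e1]
    refine ⟨⟨fun i hi => ?_, fun i hi => ?_⟩, hd, trivial, ?_, ?_, ?_⟩
    · simp (disch := omega) only [Function.update_of_ne]
      exact hF.1 i hi
    · simp (disch := omega) only [Function.update_of_ne]
      exact hF.2 i hi
    · intro a hak
      rcases Nat.lt_succ_iff_lt_or_eq.1 hak with h | rfl
      · simp (disch := omega) only [Function.update_of_ne]
        exact hx a h
      · simp only [Function.update_self]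
    · intro a hak had
      simp (disch := omega) only [Function.update_of_ne]
      exact hx' a (by omega) had
    · rw [Finset.sum_range_succ, ← ha]
  · rintro s' ⟨hF, -, hk, -⟩
    simp only [Test.Holds, hk, (hF.1 0 (by omega)).trans h0, lt_irrefl, not_false_eq_true]
  · exact ⟨Frame.refl _ _ _ _ _, rfl, h18, by simp, fun _ _ _ => rfl, by simpa using h20⟩

def accumulateBody : List Instr :=
  [.natAdd 19 3 18, .load 21 19, .mul 21 19 21, .natAdd 19 2 18, .load 22 19, .add 22 22 21,
    .store 19 22, .natAdd 18 18 1]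

theorem reaches_accumulate {s : State} (h0 : s.nat 0 = d) (h1 : s.nat 1 = 1)
    (h2 : s.nat 2 = d + 32) (h3 : s.nat 3 = 2 * d + 32) (h18 : s.nat 18 = 0) :
    Reaches T (.while (.natLt 18 0) (block accumulateBody)) s (9 * d + 1) fun s' =>
      Frame 18 20 (d + 32) (2 * d + 32) s s' ∧ s'.drawn = s.drawn ∧
      ∀ a < d, s'.real (d + 32 + a) =
        s.real (d + 32 + a) + s.real 19 * s.real (2 * d + 32 + a) := by
  have key := Reaches.while (T := T) (b := .natLt 18 0) (p := block accumulateBody) (s := s) d 8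
    (fun k s' => Frame 18 20 (d + 32) (2 * d + 32) s s' ∧ s'.drawn = s.drawn ∧
      s'.nat 18 = k ∧ (∀ a < k, s'.real (d + 32 + a) =
        s.real (d + 32 + a) + s.real 19 * s.real (2 * d + 32 + a)) ∧
      ∀ a, k ≤ a → a < d → s'.real (d + 32 + a) = s.real (d + 32 + a)) ?_ ?_ ?_
  · refine key.mono (by omega) ?_
    rintro s' ⟨hF, hd, -, hx, -⟩
    exact ⟨hF, hd, hx⟩
  · rintro k hk s' ⟨hF, hd, hk', hx, hx'⟩
    have e0 : s'.nat 0 = d := (hF.1 0 (by omega)).trans h0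
    have e1 : s'.nat 1 = 1 := (hF.1 1 (by omega)).trans h1
    have e2 : s'.nat 2 = d + 32 := (hF.1 2 (by omega)).trans h2
    have e3 : s'.nat 3 = 2 * d + 32 := (hF.1 3 (by omega)).trans h3
    have e19 : s'.real 19 = s.real 19 := hF.2 19 (by omega)
    have en : s'.real (2 * d + 32 + k) = s.real (2 * d + 32 + k) := hF.2 _ (by omega)
    have ex := hx' k le_rfl hk
    refine ⟨by simp only [Test.Holds, e0, hk', hk], ?_⟩
    refine (reaches_block accumulateBody s' ?_).mono (by simp [accumulateBody, Instr.cost])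
      fun _ h => h
    simp (disch := omega) only [accumulateBody, run, Instr.eval, State.setNat, State.setReal,
      Function.update_self, Function.update_of_ne, e2, e3, hk', ex, en, e19, e1]
    refine ⟨⟨fun i hi => ?_, fun i hi => ?_⟩, hd, trivial, ?_, ?_⟩
    · simp (disch := omega) only [Function.update_of_ne]
      exact hF.1 i hi
    · simp (disch := omega) only [Function.update_of_ne]
      exact hF.2 i hi
    · intro a hak
      rcases Nat.lt_succ_iff_lt_or_eq.1 hak with h | rfl
      · simp (disch := omega) only [Function.update_of_ne]
        exact hx a h
      · simp only [Function.update_self]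
    · intro a hak had
      simp (disch := omega) only [Function.update_of_ne]
      exact hx' a (by omega) had
  · rintro s' ⟨hF, -, hk, -⟩
    simp only [Test.Holds, hk, (hF.1 0 (by omega)).trans h0, lt_irrefl, not_false_eq_true]
  · exact ⟨Frame.refl _ _ _ _ _, rfl, h18, by simp, fun _ _ _ => rfl⟩

def normSqBody : List Instr :=
  [.natAdd 19 2 18, .load 21 19, .mul 21 21 21, .add 20 20 21, .natAdd 18 18 1]

theorem reaches_normSq {s : State} (h0 : s.nat 0 = d) (h1 : s.nat 1 = 1)
    (h2 : s.nat 2 = d + 32) (h18 : s.nat 18 = 0) (h20 : s.real 20 = 0) :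
    Reaches T (.while (.natLt 18 0) (block normSqBody)) s (6 * d + 1) fun s' =>
      Frame 18 20 0 0 s s' ∧ s'.drawn = s.drawn ∧
      s'.real 20 = ∑ a ∈ Finset.range d, s.real (d + 32 + a) ^ 2 := by
  have key := Reaches.while (T := T) (b := .natLt 18 0) (p := block normSqBody) (s := s) d 5
    (fun k s' => Frame 18 20 0 0 s s' ∧ s'.drawn = s.drawn ∧
      s'.nat 18 = k ∧ s'.real 20 = ∑ a ∈ Finset.range k, s.real (d + 32 + a) ^ 2) ?_ ?_ ?_
  · refine key.mono (by omega) ?_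
    rintro s' ⟨hF, hd, -, hx⟩
    exact ⟨hF, hd, hx⟩
  · rintro k hk s' ⟨hF, hd, hk', ha⟩
    have e0 : s'.nat 0 = d := (hF.1 0 (by omega)).trans h0
    have e1 : s'.nat 1 = 1 := (hF.1 1 (by omega)).trans h1
    have e2 : s'.nat 2 = d + 32 := (hF.1 2 (by omega)).trans h2
    have en : s'.real (d + 32 + k) = s.real (d + 32 + k) := hF.2 _ (by omega)
    refine ⟨by simp only [Test.Holds, e0, hk', hk], ?_⟩
    refine (reaches_block normSqBody s' ?_).mono (by simp [normSqBody, Instr.cost]) fun _ h => h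
    simp (disch := omega) only [normSqBody, run, Instr.eval, State.setNat, State.setReal,
      Function.update_self, Function.update_of_ne, e2, hk', en, e1]
    refine ⟨⟨fun i hi => ?_, fun i hi => ?_⟩, hd, trivial, ?_⟩
    · simp (disch := omega) only [Function.update_of_ne]
      exact hF.1 i hi
    · simp (disch := omega) only [Function.update_of_ne]
      exact hF.2 i hi
    · rw [Finset.sum_range_succ, ← ha, sq]
  · rintro s' ⟨hF, -, hk, -⟩
    simp only [Test.Holds, hk, (hF.1 0 (by omega)).trans h0, lt_irrefl, not_false_eq_true]
  · exact ⟨Frame.refl _ _ _ _ _, rfl, h18, by simpa using h20⟩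

def scaleBody : List Instr :=
  [.natAdd 19 2 18, .load 21 19, .div 21 21 20, .store 19 21, .natAdd 18 18 1]

theorem reaches_scale {s : State} (h0 : s.nat 0 = d) (h1 : s.nat 1 = 1)
    (h2 : s.nat 2 = d + 32) (h18 : s.nat 18 = 0) :
    Reaches T (.while (.natLt 18 0) (block scaleBody)) s (6 * d + 1) fun s' =>
      Frame 18 20 (d + 32) (2 * d + 32) s s' ∧ s'.drawn = s.drawn ∧
      ∀ a < d, s'.real (d + 32 + a) = s.real (d + 32 + a) / s.real 20 := by
  have key := Reaches.while (T := T) (b := .natLt 18 0) (p := block scaleBody) (s := s) d 5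
    (fun k s' => Frame 18 21 (d + 32) (2 * d + 32) s s' ∧ s'.drawn = s.drawn ∧
      s'.nat 18 = k ∧ (∀ a < k, s'.real (d + 32 + a) = s.real (d + 32 + a) / s.real 20) ∧
      ∀ a, k ≤ a → a < d → s'.real (d + 32 + a) = s.real (d + 32 + a)) ?_ ?_ ?_
  · refine key.mono (by omega) ?_
    rintro s' ⟨hF, hd, -, hx, -⟩
    exact ⟨hF.mono le_rfl (by omega) le_rfl le_rfl, hd, hx⟩
  · rintro k hk s' ⟨hF, hd, hk', hx, hx'⟩
    have e0 : s'.nat 0 = d := (hF.1 0 (by omega)).trans h0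
    have e1 : s'.nat 1 = 1 := (hF.1 1 (by omega)).trans h1
    have e2 : s'.nat 2 = d + 32 := (hF.1 2 (by omega)).trans h2
    have e20 : s'.real 20 = s.real 20 := hF.2 20 (by omega)
    have ex := hx' k le_rfl hk
    refine ⟨by simp only [Test.Holds, e0, hk', hk], ?_⟩
    refine (reaches_block scaleBody s' ?_).mono (by simp [scaleBody, Instr.cost]) fun _ h => h
    simp (disch := omega) only [scaleBody, run, Instr.eval, State.setNat, State.setReal,
      Function.update_self, Function.update_of_ne, e2, hk', ex, e20, e1]
    refine ⟨⟨fun i hi => ?_, fun i hi => ?_⟩, hd, trivial, ?_, ?_⟩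
    · simp (disch := omega) only [Function.update_of_ne]
      exact hF.1 i hi
    · simp (disch := omega) only [Function.update_of_ne]
      exact hF.2 i hi
    · intro a hak
      rcases Nat.lt_succ_iff_lt_or_eq.1 hak with h | rfl
      · simp (disch := omega) only [Function.update_of_ne]
        exact hx a h
      · simp only [Function.update_self]
    · intro a hak had
      simp (disch := omega) only [Function.update_of_ne]
      exact hx' a (by omega) had
  · rintro s' ⟨hF, -, hk, -⟩
    simp only [Test.Holds, hk, (hF.1 0 (by omega)).trans h0, lt_irrefl, not_false_eq_true]
  · exact ⟨Frame.refl _ _ _ _ _, rfl, h18, by simp, fun _ _ _ => rfl⟩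

/-- Real cell 0 serves as buffer and is itself an output cell; the indices run downwards so that it
receives its final value last. -/
def outputBody : List Instr :=
  [.natSub 18 18 1, .natAdd 19 2 18, .load 0 19, .store 18 0]

theorem reaches_output {s : State} (h1 : s.nat 1 = 1) (h2 : s.nat 2 = d + 32)
    (h12 : s.nat 12 = 0) (h18 : s.nat 18 = d) :
    Reaches T (.while (.natLt 12 18) (block outputBody)) s (5 * d + 1) fun s' =>
      s'.drawn = s.drawn ∧ ∀ a < d, s'.real a = s.real (d + 32 + a) := by
  have key := Reaches.while (T := T) (b := .natLt 12 18) (p := block outputBody) (s := s) d 4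
    (fun k s' => (∀ i < 18, s'.nat i = s.nat i) ∧
      (∀ a < d, s'.real (d + 32 + a) = s.real (d + 32 + a)) ∧ s'.drawn = s.drawn ∧
      s'.nat 18 = d - k ∧ ∀ a, d - k ≤ a → a < d → s'.real a = s.real (d + 32 + a)) ?_ ?_ ?_
  · refine key.mono (by omega) ?_
    rintro s' ⟨-, -, hd, -, hx⟩
    exact ⟨hd, fun a ha => hx a (by omega) ha⟩
  · rintro k hk s' ⟨hF, hV, hd, hk', hx⟩
    have e1 : s'.nat 1 = 1 := (hF 1 (by omega)).trans h1
    have e2 : s'.nat 2 = d + 32 := (hF 2 (by omega)).trans h2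
    have e12 : s'.nat 12 = 0 := (hF 12 (by omega)).trans h12
    have ex := hV (d - k - 1) (by omega)
    refine ⟨by simp only [Test.Holds, e12, hk']; omega, ?_⟩
    refine (reaches_block outputBody s' ?_).mono (by simp [outputBody, Instr.cost]) fun _ h => h
    simp (disch := omega) only [outputBody, run, Instr.eval, State.setNat, State.setReal,
      Function.update_self, Function.update_of_ne, e2, hk', ex, e1]
    refine ⟨fun i hi => ?_, fun a ha => ?_, hd, by omega, fun a hak had => ?_⟩
    · simp (disch := omega) only [Function.update_of_ne]
      exact hF i hi
    · exact hV a ha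
    · by_cases h : a = d - k - 1
      · rw [h, Function.update_self]
      · simp (disch := omega) only [Function.update_of_ne]
        exact hx a (by omega) had
  · rintro s' ⟨hF, -, -, hk, -⟩
    simp only [Test.Holds, hk, (hF 12 (by omega)).trans h12]
    omega
  · exact ⟨fun _ _ => rfl, fun _ _ => rfl, rfl, by simpa using h18, fun a h h' => by omega⟩

/-- Normalise the accumulated vector and write it to the output cells. -/
def finish : Prog :=
  .seq (block [.ofNat 20 12, .natConst 18 0]) <|
  .seq (.while (.natLt 18 0) (block normSqBody)) <|
  .seq (block [.sqrt 20 20, .natConst 18 0]) <|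
  .seq (.while (.natLt 18 0) (block scaleBody)) <|
  .seq (block [.natAdd 18 0 12]) (.while (.natLt 12 18) (block outputBody))

/-- Valid for v = 0 too, by the conventions for division by zero, so that halting holds on every
tape. -/
theorem reaches_finish {s : State} (h0 : s.nat 0 = d) (h1 : s.nat 1 = 1) (h2 : s.nat 2 = d + 32)
    (h12 : s.nat 12 = 0) (v : EuclideanSpace ℝ (Fin d))
    (hv : ∀ a : Fin d, s.real (d + 32 + a) = v a) :
    Reaches T finish s (17 * d + 8) fun s' => s'.drawn = s.drawn ∧ output d s' = ‖v‖⁻¹ • v := by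
  refine Reaches.mono (c := 2 + ((6 * d + 1) + (2 + ((6 * d + 1) + (1 + (5 * d + 1))))))
    (Q := fun s' => s'.drawn = s.drawn ∧ output d s' = ‖v‖⁻¹ • v) ?_ (by omega) fun _ h => h
  refine (reaches_block _ _ (Q := fun s' => Frame 18 20 0 0 s s' ∧ s'.drawn = s.drawn ∧
    s'.nat 18 = 0 ∧ s'.real 20 = 0) ?_).seq ?_
  · simp (disch := omega) only [run, Instr.eval, State.setNat, State.setReal,
      Function.update_self, h12]
    refine ⟨⟨fun i hi => ?_, fun i hi => ?_⟩, trivial, trivial, by simp⟩ <;>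
      simp (disch := omega) only [Function.update_of_ne]
  rintro s₁ ⟨hF1, hd1, hn1, hr1⟩
  refine (reaches_normSq ((hF1.1 0 (by omega)).trans h0) ((hF1.1 1 (by omega)).trans h1)
    ((hF1.1 2 (by omega)).trans h2) hn1 hr1).seq ?_
  rintro s₂ ⟨hF2, hd2, hr2⟩
  replace hF2 := hF1.trans hF2
  have hnorm : s₂.real 20 = ‖v‖ ^ 2 := by
    rw [hr2, EuclideanSpace.norm_sq_eq, Finset.sum_range]
    refine Finset.sum_congr rfl fun a _ => ?_
    rw [hF1.2 _ (by omega), hv, Real.norm_eq_abs, sq_abs]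
  refine (reaches_block _ _ (Q := fun s' => Frame 18 20 0 0 s s' ∧ s'.drawn = s.drawn ∧
    s'.nat 18 = 0 ∧ s'.real 20 = ‖v‖) ?_).seq ?_
  · simp (disch := omega) only [run, Instr.eval, State.setNat, State.setReal,
      Function.update_self, hnorm]
    refine ⟨⟨fun i hi => ?_, fun i hi => ?_⟩, hd2.trans hd1, trivial,
      Real.sqrt_sq (norm_nonneg v)⟩
    · simp (disch := omega) only [Function.update_of_ne]
      exact hF2.1 i hi
    · simp (disch := omega) only [Function.update_of_ne]
      exact hF2.2 i hi
  rintro s₃ ⟨hF3, hd3, hn3, hr3⟩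
  refine (reaches_scale ((hF3.1 0 (by omega)).trans h0) ((hF3.1 1 (by omega)).trans h1)
    ((hF3.1 2 (by omega)).trans h2) hn3).seq ?_
  rintro s₄ ⟨hF4, hd4, hr4⟩
  have e0 : s₄.nat 0 = d := (hF4.1 0 (by omega)).trans ((hF3.1 0 (by omega)).trans h0)
  have e12 : s₄.nat 12 = 0 := (hF4.1 12 (by omega)).trans ((hF3.1 12 (by omega)).trans h12)
  refine (reaches_block _ _ (Q := fun s' => s'.nat 1 = 1 ∧ s'.nat 2 = d + 32 ∧ s'.nat 12 = 0 ∧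
    s'.nat 18 = d ∧ s'.drawn = s.drawn ∧ ∀ a : Fin d, s'.real (d + 32 + a) = v a / ‖v‖) ?_).seq ?_
  · simp (disch := omega) only [run, Instr.eval, State.setNat,
      Function.update_self, Function.update_of_ne, e0, e12]
    refine ⟨(hF4.1 1 (by omega)).trans ((hF3.1 1 (by omega)).trans h1),
      (hF4.1 2 (by omega)).trans ((hF3.1 2 (by omega)).trans h2), trivial, by simp,
      hd4.trans hd3, fun a => ?_⟩
    rw [hr4 a a.2, hF3.2 _ (by omega), hv, hr3]
  rintro s₅ ⟨h51, h52, h512, h518, hd5, hv5⟩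
  refine (reaches_output h51 h52 h512 h518).mono le_rfl ?_
  rintro s₆ ⟨hd6, hv6⟩
  refine ⟨hd6.trans hd5, ?_⟩
  ext a
  simp only [output, PiLp.smul_apply, smul_eq_mul]
  rw [hv6 a a.2, hv5, div_eq_inv_mul]

end Vectors

end RealRAM

end


/-! ### Processing one group of examples. -/

noncomputable section

namespace RealRAM

section Groups

variable {d : ℕ} {T : Tape d}

theorem writeExample_coord (b : ℕ) (z : Example d) (f : ℕ → ℝ) (a : Fin d) :
    writeExample b z f (b + a) = z.1 a := by
  rw [writeExample, dif_pos ⟨by omega, by omega⟩]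
  exact congrArg z.1 (Fin.ext (by simp))

theorem writeExample_label (b : ℕ) (z : Example d) (f : ℕ → ℝ) :
    writeExample b z f (b + d) = ((z.2 : ℤ) : ℝ) := by
  rw [writeExample, dif_neg (by omega), if_pos rfl]

theorem writeExample_of_ne (b : ℕ) (z : Example d) (f : ℕ → ℝ) {j : ℕ} (h : j < b ∨ b + d < j) :
    writeExample b z f j = f j := by
  rw [writeExample, dif_neg (by omega), if_neg (by omega)]

/-- The `d` real cells from `b` on hold the vector `x`. -/
def Vec (s : State) (b : ℕ) (x : EuclideanSpace ℝ (Fin d)) : Prop :=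
  ∀ a : Fin d, s.real (b + a) = x a

theorem Vec.of_frame {nl rl lo hi b : ℕ} {s s' : State} {x : EuclideanSpace ℝ (Fin d)}
    (h : Vec s b x) (hF : Frame nl rl lo hi s s') (hb : 32 ≤ b) (hlh : b + d ≤ lo ∨ hi ≤ b) :
    Vec s' b x := fun a => (hF.2 _ (by omega)).trans (h a)

/-- The cells that the main loops do not change: `d`, the addresses of the arrays, the order `m`,
the parameters of the rotations and the numbers of iterations. -/
structure Env (d m : ℕ) (c σ nlim Rlim : ℝ) (s : State) : Prop where
  n0 : s.nat 0 = d
  n1 : s.nat 1 = 1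
  n2 : s.nat 2 = d + 32
  n3 : s.nat 3 = 2 * d + 32
  n4 : s.nat 4 = 3 * d + 32
  n5 : s.nat 5 = 3 * d + 33
  n6 : s.nat 6 = 4 * d + 34
  n7 : s.nat 7 = d + 1
  n8 : s.nat 8 = m
  n9 : s.nat 9 = m + 1
  n10 : s.nat 10 = 4 * d + 34 + (d + 1)
  n12 : s.nat 12 = 0
  r2 : s.real 2 = 1
  r3 : s.real 3 = 2
  r8 : s.real 8 = c
  r9 : s.real 9 = σ
  r10 : s.real 10 = Rlim
  r11 : s.real 11 = nlim

variable {m : ℕ} {c σ nlim Rlim : ℝ}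

theorem Env.of_frame {nl rl lo hi : ℕ} {s s' : State} (h : Env d m c σ nlim Rlim s)
    (hF : Frame nl rl lo hi s s') (hn : 16 ≤ nl) (hr : 16 ≤ rl) : Env d m c σ nlim Rlim s' := by
  have h1 : ∀ i < 16, s'.nat i = s.nat i := fun i hi => hF.1 i (by omega)
  have h2 : ∀ i < 16, s'.real i = s.real i := fun i hi => hF.2 i (by omega)
  constructor <;>
    first
      | rw [h1 _ (by norm_num)]
      | rw [h2 _ (by norm_num)]
  exacts [h.n0, h.n1, h.n2, h.n3, h.n4, h.n5, h.n6, h.n7, h.n8, h.n9, h.n10, h.n12, h.r2, h.r3,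
    h.r8, h.r9, h.r10, h.r11]

/-- Rotate the vector `x` with a new example and multiply the weight by the next factor. -/
def pairBody : Prog :=
  .seq (block [.draw 5, .ofNat 20 12, .natConst 18 0]) <|
  .seq (.while (.natLt 18 0) (block rotateBody))
    (block [.add 20 20 2, .mul 19 19 20, .natAdd 17 17 7, .natAdd 16 16 1])

/-- The position of a fresh example plays the role of the Gaussian noise; its label is read and
ignored. -/
theorem reaches_pair {s : State} (hE : Env d m c σ nlim Rlim s) (h17 : 4 * d + 34 ≤ s.nat 17)
    {x z : EuclideanSpace ℝ (Fin d)} (hx : Vec s (2 * d + 32) x) (hz : Vec s (s.nat 17) z) :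
    Reaches T pairBody s (18 * d + 8) fun s' =>
      Frame 16 19 (2 * d + 32) (4 * d + 34) s s' ∧ s'.drawn = s.drawn + 1 ∧
      s'.nat 16 = s.nat 16 + 1 ∧ s'.nat 17 = s.nat 17 + (d + 1) ∧
      Vec s' (2 * d + 32) (σ • x - c • (T.1 s.drawn).1) ∧
      s'.real 19 = s.real 19 * (1 + inner ℝ (c • x + σ • (T.1 s.drawn).1) z) := by
  refine Reaches.mono (c := (d + 3) + ((17 * d + 1) + 4)) ?_ (by omega) fun _ h => h
  refine ((reaches_block _ _ (Q := fun s' => Frame 18 20 (3 * d + 33) (4 * d + 34) s s' ∧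
    s'.drawn = s.drawn + 1 ∧ s'.nat 18 = 0 ∧ s'.real 20 = 0 ∧
    Vec s' (3 * d + 33) (T.1 s.drawn).1) ?_).mono (by simp [Instr.cost]) fun _ h => h).seq ?_
  · simp (disch := omega) only [run, Instr.eval, State.setNat, State.setReal,
      Function.update_self, hE.n5, hE.n12]
    refine ⟨⟨fun i hi => ?_, fun i hi => ?_⟩, trivial, trivial, by simp, fun a => ?_⟩
    · simp (disch := omega) only [Function.update_of_ne]
    · simp (disch := omega) only [Function.update_of_ne]
      exact writeExample_of_ne _ _ _ (by omega)
    · simp (disch := omega) only [Function.update_of_ne]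
      exact writeExample_coord _ _ _ _
  rintro s₁ ⟨hF1, hd1, hn1, hr1, hv1⟩
  have hE1 := hE.of_frame hF1 (by norm_num) (by norm_num)
  have e17 : s₁.nat 17 = s.nat 17 := hF1.1 17 (by norm_num)
  have hx1 : Vec s₁ (2 * d + 32) x := hx.of_frame hF1 (by omega) (by omega)
  have hz1 : Vec s₁ (s₁.nat 17) z := by
    rw [e17]
    exact hz.of_frame hF1 (by omega) (by omega)
  refine (reaches_rotate hE1.n0 hE1.n1 hE1.n3 hE1.n5 (by omega) hn1 hr1).seq ?_
  rintro s₂ ⟨hF2, hd2, hv2, hr2⟩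
  replace hr2 : s₂.real 20 = inner ℝ (c • x + σ • (T.1 s.drawn).1) z := by
    rw [hr2, Finset.sum_range, PiLp.inner_apply]
    refine Finset.sum_congr rfl fun a _ => ?_
    rw [hE1.r8, hE1.r9, hx1 a, hv1 a, hz1 a]
    simp [mul_comm]
  have hF : Frame 18 20 (2 * d + 32) (4 * d + 34) s s₂ :=
    (hF1.mono le_rfl le_rfl (by omega) le_rfl).trans (hF2.mono le_rfl le_rfl le_rfl (by omega))
  have hE2 := hE.of_frame hF (by norm_num) (by norm_num)
  have f16 : s₂.nat 16 = s.nat 16 := hF.1 16 (by norm_num)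
  have f17 : s₂.nat 17 = s.nat 17 := hF.1 17 (by norm_num)
  have f19 : s₂.real 19 = s.real 19 := hF.2 19 (by omega)
  refine (reaches_block _ _ ?_).mono (by simp [Instr.cost]) fun _ h => h
  simp (disch := omega) only [run, Instr.eval, State.setNat, State.setReal,
      Function.update_self, Function.update_of_ne, hE2.n1, hE2.n7, hE2.r2, f16, f17, f19, hr2]
  refine ⟨⟨fun i hi => ?_, fun i hi => ?_⟩, hd2.trans hd1, trivial, trivial, fun a => ?_, by ring⟩
  · simp (disch := omega) only [Function.update_of_ne]
    exact hF.1 i (by omega)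
  · simp (disch := omega) only [Function.update_of_ne]
    exact hF.2 i (by omega)
  · simp (disch := omega) only [Function.update_of_ne]
    rw [hv2 a a.2, hE1.r8, hE1.r9, hx1 a, hv1 a]
    simp

/-- The contribution of the examples from `S q` on, contracted with those from `S p` on. -/
def streamVec (a₀ : Fin d) (c σ : ℝ) (m : ℕ) (S : ℕ → Example d) (p q : ℕ) :
    EuclideanSpace ℝ (Fin d) :=
  ((S p).1 a₀ * lbl (S q) * ∏ i ∈ Finset.range m,
    (1 + inner ℝ (split c σ (S q).1 (fun i => (S (q + 1 + i)).1) i) (S (p + (i + 1))).1)) •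
    resid c σ (S q).1 (fun i => (S (q + 1 + i)).1) m

/-- Read a group of examples and add its contribution to the accumulated vector. -/
def groupBody : Prog :=
  .seq (block [.draw 3, .load 19 4, .sub 19 2 19, .div 19 19 3, .mul 19 17 19, .natConst 16 0,
    .natAdd 17 10 12]) <|
  .seq (.while (.natLt 16 8) pairBody) <|
  .seq (block [.natConst 18 0]) (.while (.natLt 18 0) (block accumulateBody))

theorem reaches_group {s : State} (hE : Env d m c σ nlim Rlim s) (a₀ : Fin d) (p : ℕ)
    (h17 : s.real 17 = (T.1 p).1 a₀)
    (hZ : ∀ i ≤ m, Vec s (4 * d + 34 + i * (d + 1)) (T.1 (p + i)).1)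
    {v : EuclideanSpace ℝ (Fin d)} (hv : Vec s (d + 32) v) :
    Reaches T groupBody s (28 * (d + 1) * (m + 1)) fun s' =>
      Frame 16 19 (d + 32) (4 * d + 34) s s' ∧ s'.drawn = s.drawn + (m + 1) ∧
      Vec s' (d + 32) (v + streamVec a₀ c σ m T.1 p s.drawn) := by
  refine Reaches.mono (c := (d + 7) + ((m * (18 * d + 8 + 1) + 1) + (1 + (9 * d + 1)))) ?_
    (by nlinarith [mul_nonneg (Nat.zero_le d) (Nat.zero_le m)]) fun _ h => h
  set q := s.drawn with hq
  set ζ : ℕ → EuclideanSpace ℝ (Fin d) := fun i => (T.1 (q + 1 + i)).1 with hζ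
  set x := (T.1 q).1 with hx
  -- The scalar weight in real cell 19 after k factors; together with the k-th residual it is the
  -- loop invariant.
  set W : ℕ → ℝ := fun k => (T.1 p).1 a₀ * lbl (T.1 q) * ∏ i ∈ Finset.range k,
    (1 + inner ℝ (split c σ x ζ i) (T.1 (p + (i + 1))).1) with hW
  refine ((reaches_block _ _ (Q := fun s' => Frame 16 19 (2 * d + 32) (4 * d + 34) s s' ∧
    s'.drawn = q + 1 ∧ s'.nat 16 = 0 ∧ s'.nat 17 = 4 * d + 34 + (0 + 1) * (d + 1) ∧
    Vec s' (2 * d + 32) (resid c σ x ζ 0) ∧ s'.real 19 = W 0) ?_).mono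
    (by simp [Instr.cost]) fun _ h => h).seq ?_
  · have el : writeExample (2 * d + 32) (T.1 q) s.real (3 * d + 32) = (((T.1 q).2 : ℤ) : ℝ) := by
      rw [show 3 * d + 32 = 2 * d + 32 + d by ring]
      exact writeExample_label _ _ _
    have e2 : writeExample (2 * d + 32) (T.1 q) s.real 2 = 1 :=
      (writeExample_of_ne _ _ _ (by omega)).trans hE.r2
    have e3 : writeExample (2 * d + 32) (T.1 q) s.real 3 = 2 :=
      (writeExample_of_ne _ _ _ (by omega)).trans hE.r3
    have e17 : writeExample (2 * d + 32) (T.1 q) s.real 17 = (T.1 p).1 a₀ :=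
      (writeExample_of_ne _ _ _ (by omega)).trans h17
    simp (disch := omega) only [run, Instr.eval, State.setNat, State.setReal,
      Function.update_self, Function.update_of_ne, hE.n3, hE.n4, hE.n10, hE.n12, ← hq, el, e2, e3,
      e17]
    refine ⟨⟨fun i hi => ?_, fun i hi => ?_⟩, trivial, trivial, by ring, fun a => ?_, ?_⟩
    · simp (disch := omega) only [Function.update_of_ne]
    · simp (disch := omega) only [Function.update_of_ne]
      exact writeExample_of_ne _ _ _ (by omega)
    · simp (disch := omega) only [Function.update_of_ne]
      exact writeExample_coord _ _ _ _
    · simp [hW, lbl]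
  intro s₁ h1
  refine (Reaches.while m (18 * d + 8) (fun k s' => Frame 16 19 (2 * d + 32) (4 * d + 34) s s' ∧
    s'.drawn = q + 1 + k ∧ s'.nat 16 = k ∧ s'.nat 17 = 4 * d + 34 + (k + 1) * (d + 1) ∧
    Vec s' (2 * d + 32) (resid c σ x ζ k) ∧ s'.real 19 = W k) ?_ ?_ h1).seq ?_
  · rintro k hk s₂ ⟨hF, hd, h16, h17, hX, h19⟩
    have hE2 := hE.of_frame hF (by norm_num) (by norm_num)
    refine ⟨by simp only [Test.Holds, h16, hE2.n8, hk], ?_⟩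
    have hz : Vec s₂ (s₂.nat 17) (T.1 (p + (k + 1))).1 := by
      rw [h17]
      exact (hZ (k + 1) (by omega)).of_frame hF (by omega) (by omega)
    refine (reaches_pair hE2 (by rw [h17]; omega) hX hz).mono le_rfl ?_
    rintro s₃ ⟨hF3, hd3, h163, h173, hX3, h193⟩
    refine ⟨hF.trans hF3, by omega, by omega, by rw [h173, h17]; ring, ?_, ?_⟩
    · rw [hd] at hX3
      exact hX3
    · rw [h193, hd, h19]
      simp only [hW]
      rw [Finset.prod_range_succ, ← mul_assoc]
      rfl
  · rintro s₂ ⟨hF, -, h16, -⟩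
    simp only [Test.Holds, h16, (hE.of_frame hF (by norm_num) (by norm_num)).n8, lt_irrefl,
      not_false_eq_true]
  rintro s₂ ⟨hF2, hd2, -, -, hX2, h192⟩
  refine (reaches_block _ _ (Q := fun s' => Frame 16 20 (d + 32) (d + 32) s₂ s' ∧ s'.drawn = s₂.drawn ∧
    s'.nat 18 = 0) ?_).seq ?_
  · simp only [run, Instr.eval, State.setNat, Function.update_self]
    refine ⟨⟨fun i hi => ?_, fun i hi => rfl⟩, trivial, trivial⟩
    simp (disch := omega) only [Function.update_of_ne]
  rintro s₃ ⟨hF3, hd3, h183⟩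
  have hE3 := (hE.of_frame hF2 (by norm_num) (by norm_num)).of_frame hF3 (by norm_num)
    (by norm_num)
  refine (reaches_accumulate hE3.n0 hE3.n1 hE3.n2 hE3.n3 h183).mono le_rfl ?_
  rintro s₄ ⟨hF4, hd4, hV4⟩
  refine ⟨(hF2.mono le_rfl le_rfl (by omega) le_rfl).trans ((hF3.mono le_rfl (by omega) (by omega)
    (by omega)).trans (hF4.mono (by omega) (by omega) le_rfl (by omega))),
    hd4.trans (hd3.trans (hd2.trans (by ring))), fun a => ?_⟩
  rw [hV4 a a.2, hF3.2 19 (by omega), h192, hF3.2 _ (by omega), hF2.2 _ (by omega), hv a,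
    hF3.2 _ (by omega), hX2 a]
  simp only [streamVec, PiLp.add_apply, PiLp.smul_apply, smul_eq_mul]
  rfl

end Groups

end RealRAM

end


/-! ### Blocks of groups and the main loop. -/

noncomputable section

namespace RealRAM

section Blocks

variable {d : ℕ} {T : Tape d} {m : ℕ} {c σ nlim Rlim : ℝ}

def readBody : List Instr := [.draw 17, .natAdd 17 17 7, .natAdd 16 16 1]

theorem reaches_read {s : State} (hE : Env d m c σ nlim Rlim s) (h16 : s.nat 16 = 0)
    (h17 : s.nat 17 = 4 * d + 34) :
    Reaches T (.while (.natLt 16 9) (block readBody)) s ((m + 1) * (d + 4) + 1) fun s' =>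
      Frame 16 17 (4 * d + 34) (4 * d + 34 + (m + 1) * (d + 1)) s s' ∧
      s'.drawn = s.drawn + (m + 1) ∧
      ∀ i < m + 1, Vec s' (4 * d + 34 + i * (d + 1)) (T.1 (s.drawn + i)).1 := by
  have key := Reaches.while (T := T) (b := .natLt 16 9) (p := block readBody) (s := s) (m + 1)
    (d + 3) (fun k s' => Frame 16 17 (4 * d + 34) (4 * d + 34 + (m + 1) * (d + 1)) s s' ∧
      s'.drawn = s.drawn + k ∧ s'.nat 16 = k ∧ s'.nat 17 = 4 * d + 34 + k * (d + 1) ∧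
      ∀ i < k, Vec s' (4 * d + 34 + i * (d + 1)) (T.1 (s.drawn + i)).1) ?_ ?_ ?_
  · refine key.mono le_rfl ?_
    rintro s' ⟨hF, hd, -, -, hx⟩
    exact ⟨hF, hd, hx⟩
  · rintro k hk s' ⟨hF, hd, hk', h17', hx⟩
    have hE' := hE.of_frame hF (by norm_num) (by norm_num)
    have hk1 : (k + 1) * (d + 1) ≤ (m + 1) * (d + 1) := Nat.mul_le_mul_right _ hk
    rw [Nat.succ_mul] at hk1
    refine ⟨by simp only [Test.Holds, hE'.n9, hk', hk], ?_⟩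
    refine (reaches_block readBody s' ?_).mono (by simp [readBody, Instr.cost]) fun _ h => h
    simp (disch := omega) only [readBody, run, Instr.eval, State.setNat,
      Function.update_self, Function.update_of_ne, hE'.n7, hE'.n1, hk', h17', hd]
    refine ⟨⟨fun i hi => ?_, fun i hi => ?_⟩, by ring, trivial, by ring, fun i hi => ?_⟩
    · simp (disch := omega) only [Function.update_of_ne]
      exact hF.1 i hi
    · refine (writeExample_of_ne _ _ _ ?_).trans (hF.2 i hi)
      omega
    · rcases Nat.lt_succ_iff_lt_or_eq.1 hi with h | rfl
      · have h2 : (i + 1) * (d + 1) ≤ k * (d + 1) := Nat.mul_le_mul_right _ h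
        rw [Nat.succ_mul] at h2
        intro a
        refine (writeExample_of_ne _ _ _ ?_).trans (hx i h a)
        omega
      · exact fun a => writeExample_coord _ _ _ _
  · rintro s' ⟨hF, -, hk, -⟩
    simp only [Test.Holds, hk, (hE.of_frame hF (by norm_num) (by norm_num)).n9, lt_irrefl,
      not_false_eq_true]
  · exact ⟨Frame.refl _ _ _ _ _, rfl, h16, by simpa using h17, by simp⟩

/-- Read a block of groups of examples and add its contribution to the accumulated vector. -/
def blockBody : Prog :=
  .seq (block [.natConst 16 0, .natAdd 17 6 12]) <|
  .seq (.while (.natLt 16 9) (block readBody)) <|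
  .seq (block [.load 17 6, .ofNat 18 12]) <|
  .seq (.while (.lt 18 11) (.seq groupBody (block [.add 18 18 2]))) (block [.add 16 16 2])

/-- The group counter is a real cell because the limit is real and there is no rounding; counting up
while below it gives exactly ⌈nlim⌉ iterations. The first group of the block is kept as Z, hence the
offset j + 1. -/
theorem reaches_blockBody {s : State} (hE : Env d m c σ nlim Rlim s) (hd0 : 0 < d)
    {v : EuclideanSpace ℝ (Fin d)} (hv : Vec s (d + 32) v) :
    Reaches T blockBody s (41 * ((d + 1) * (m + 1) * (⌈nlim⌉₊ + 1))) fun s' =>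
      Frame 16 16 (d + 32) (4 * d + 34 + (m + 1) * (d + 1)) s s' ∧
      s'.drawn = s.drawn + (⌈nlim⌉₊ + 1) * (m + 1) ∧ s'.real 16 = s.real 16 + 1 ∧
      Vec s' (d + 32) (v + ∑ j ∈ Finset.range ⌈nlim⌉₊,
        streamVec ⟨0, hd0⟩ c σ m T.1 s.drawn (s.drawn + (j + 1) * (m + 1))) := by
  set n := ⌈nlim⌉₊ with hn
  set hi := 4 * d + 34 + (m + 1) * (d + 1) with hhi
  have hhi' : 4 * d + 34 ≤ hi := Nat.le_add_right _ _
  refine Reaches.mono (c := 2 + (((m + 1) * (d + 4) + 1) + (2 +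
    ((n * (28 * (d + 1) * (m + 1) + 1 + 1) + 1) + 1)))) ?_ ?_ fun _ h => h
  swap
  · have : 0 ≤ d * m := by positivity
    have : 0 ≤ d * n := by positivity
    have : 0 ≤ m * n := by positivity
    have : 0 ≤ d * m * n := by positivity
    nlinarith
  refine (reaches_block _ _ (Q := fun s' => Frame 16 18 (d + 32) (d + 32) s s' ∧
    s'.drawn = s.drawn ∧ s'.nat 16 = 0 ∧ s'.nat 17 = 4 * d + 34) ?_).seq ?_
  · simp (disch := omega) only [run, Instr.eval, State.setNat, Function.update_self,
      Function.update_of_ne, hE.n6, hE.n12]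
    refine ⟨⟨fun i hi => ?_, fun i hi => rfl⟩, trivial, trivial, trivial⟩
    simp (disch := omega) only [Function.update_of_ne]
  rintro s₁ ⟨hF1, hd1, h161, h171⟩
  refine (reaches_read (hE.of_frame hF1 (by norm_num) (by norm_num)) h161 h171).seq ?_
  rintro s₂ ⟨hF', hd2, hZ⟩
  rw [hd1] at hd2 hZ
  have hv2 : Vec s₂ (d + 32) v :=
    (hv.of_frame hF1 (by omega) (by omega)).of_frame hF' (by omega) (by omega)
  have hF2 : Frame 16 17 (d + 32) hi s s₂ :=
    (hF1.mono le_rfl (by omega) le_rfl (by omega)).trans (hF'.mono le_rfl le_rfl (by omega) le_rfl)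
  have hE2 := hE.of_frame hF2 (by norm_num) (by norm_num)
  refine (reaches_block _ _ (Q := fun s' => Frame 16 17 (d + 32) hi s s' ∧
    s'.drawn = s.drawn + (0 + 1) * (m + 1) ∧ s'.real 17 = (T.1 s.drawn).1 ⟨0, hd0⟩ ∧
    s'.real 18 = (0 : ℕ) ∧
    (∀ i ≤ m, Vec s' (4 * d + 34 + i * (d + 1)) (T.1 (s.drawn + i)).1) ∧
    Vec s' (d + 32) (v + ∑ j ∈ Finset.range 0,
      streamVec ⟨0, hd0⟩ c σ m T.1 s.drawn (s.drawn + (j + 1) * (m + 1)))) ?_).seq ?_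
  · have e : s₂.real (4 * d + 34) = (T.1 s.drawn).1 ⟨0, hd0⟩ := by
      simpa using hZ 0 (by omega) ⟨0, hd0⟩
    simp (disch := omega) only [run, Instr.eval, State.setReal, Function.update_self,
      Function.update_of_ne, hE2.n6, hE2.n12, e, hd2]
    refine ⟨⟨fun i hi => hF2.1 i hi, fun i hi => ?_⟩, by ring, trivial, trivial,
      fun i hi a => ?_, fun a => ?_⟩
    · simp (disch := omega) only [Function.update_of_ne]
      exact hF2.2 i hi
    · simp (disch := omega) only [Function.update_of_ne]
      exact hZ i (by omega) a
    · simp (disch := omega) only [Function.update_of_ne]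
      simpa using hv2 a
  intro s₃ h3
  refine (Reaches.while n (28 * (d + 1) * (m + 1) + 1) (fun k s' => Frame 16 17 (d + 32) hi s s' ∧
    s'.drawn = s.drawn + (k + 1) * (m + 1) ∧ s'.real 17 = (T.1 s.drawn).1 ⟨0, hd0⟩ ∧
    s'.real 18 = k ∧ (∀ i ≤ m, Vec s' (4 * d + 34 + i * (d + 1)) (T.1 (s.drawn + i)).1) ∧
    Vec s' (d + 32) (v + ∑ j ∈ Finset.range k,
      streamVec ⟨0, hd0⟩ c σ m T.1 s.drawn (s.drawn + (j + 1) * (m + 1)))) ?_ ?_ h3).seq ?_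
  · rintro k hk s₄ ⟨hF, hd, h17, h18, hZ, hV⟩
    have hE4 := hE.of_frame hF (by norm_num) (by norm_num)
    refine ⟨by simp only [Test.Holds, h18, hE4.r11]; exact Nat.lt_ceil.1 hk, ?_⟩
    refine (reaches_group hE4 _ _ h17 hZ hV).seq ?_
    rintro s₅ ⟨hF5, hd5, hV5⟩
    have e2 := (hE4.of_frame hF5 (by norm_num) (by norm_num)).r2
    have e17 : s₅.real 17 = s₄.real 17 := hF5.2 17 (by omega)
    have e18 : s₅.real 18 = k := (hF5.2 18 (by omega)).trans h18
    refine reaches_block _ _ ?_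
    simp (disch := omega) only [run, Instr.eval, State.setReal, Function.update_self,
      Function.update_of_ne, e2, e17, e18, hd5, hd]
    refine ⟨⟨fun i hi => (hF5.1 i hi).trans (hF.1 i hi), fun i hi => ?_⟩, by ring, h17,
      by push_cast; rfl, fun i hi a => ?_, fun a => ?_⟩
    · simp (disch := omega) only [Function.update_of_ne]
      rw [hF5.2 i (by omega), hF.2 i hi]
    · simp (disch := omega) only [Function.update_of_ne]
      rw [hF5.2 _ (by omega), hZ i hi a]
    · simp (disch := omega) only [Function.update_of_ne]
      rw [Finset.sum_range_succ, ← add_assoc, hV5 a, hd]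
  · rintro s₄ ⟨hF, -, -, h18, -⟩
    simp only [Test.Holds, h18, (hE.of_frame hF (by norm_num) (by norm_num)).r11, not_lt]
    exact Nat.le_ceil _
  rintro s₄ ⟨hF, hd, -, -, -, hV⟩
  have e16 : s₄.real 16 = s.real 16 := hF.2 16 (by omega)
  refine reaches_block _ _ ?_
  simp (disch := omega) only [run, Instr.eval, State.setReal, Function.update_self,
    (hE.of_frame hF (by norm_num) (by norm_num)).r2, e16, hd]
  refine ⟨⟨fun i hi => hF.1 i hi, fun i hi => ?_⟩, trivial, trivial, fun a => ?_⟩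
  · simp (disch := omega) only [Function.update_of_ne]
    exact hF.2 i (by omega)
  · simp (disch := omega) only [Function.update_of_ne]
    exact hV a

/-- The vector accumulated from a stream of examples. -/
def streamSum (a₀ : Fin d) (c σ : ℝ) (m n R : ℕ) (S : ℕ → Example d) : EuclideanSpace ℝ (Fin d) :=
  ∑ r ∈ Finset.range R, ∑ j ∈ Finset.range n, streamVec a₀ c σ m S (r * ((n + 1) * (m + 1)))
    (r * ((n + 1) * (m + 1)) + (j + 1) * (m + 1))

theorem reaches_blocks {s : State} (hE : Env d m c σ nlim Rlim s) (hd0 : 0 < d)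
    (hs : s.drawn = 0) (h16 : s.real 16 = 0) (hv : Vec s (d + 32) (0 : EuclideanSpace ℝ (Fin d))) :
    Reaches T (.while (.lt 16 10) blockBody) s
      (⌈Rlim⌉₊ * (41 * ((d + 1) * (m + 1) * (⌈nlim⌉₊ + 1)) + 1) + 1) fun s' =>
      s'.nat 0 = d ∧ s'.nat 1 = 1 ∧ s'.nat 2 = d + 32 ∧ s'.nat 12 = 0 ∧
      s'.drawn = ⌈Rlim⌉₊ * ((⌈nlim⌉₊ + 1) * (m + 1)) ∧
      Vec s' (d + 32) (streamSum ⟨0, hd0⟩ c σ m ⌈nlim⌉₊ ⌈Rlim⌉₊ T.1) := by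
  refine (Reaches.while ⌈Rlim⌉₊ (41 * ((d + 1) * (m + 1) * (⌈nlim⌉₊ + 1))) (fun k s' =>
    Env d m c σ nlim Rlim s' ∧ s'.drawn = k * ((⌈nlim⌉₊ + 1) * (m + 1)) ∧ s'.real 16 = k ∧
      Vec s' (d + 32) (streamSum ⟨0, hd0⟩ c σ m ⌈nlim⌉₊ k T.1)) ?_ ?_ ?_).mono le_rfl ?_
  · rintro k hk s₁ ⟨hE1, hd1, h161, hV⟩
    refine ⟨by simp only [Test.Holds, h161, hE1.r10]; exact Nat.lt_ceil.1 hk, ?_⟩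
    refine (reaches_blockBody hE1 hd0 hV).mono le_rfl ?_
    rintro s₂ ⟨hF, hd2, h162, hV2⟩
    refine ⟨hE1.of_frame hF le_rfl le_rfl, by rw [hd2, hd1]; ring, by rw [h162, h161]; push_cast; rfl,
      ?_⟩
    rw [streamSum, Finset.sum_range_succ, ← streamSum, ← hd1]
    exact hV2
  · rintro s₁ ⟨hE1, -, h161, -⟩
    simp only [Test.Holds, h161, hE1.r10, not_lt]
    exact Nat.le_ceil _
  · exact ⟨hE, by simpa using hs, by simpa using h16, by simpa [streamSum] using hv⟩
  · rintro s' ⟨hE', hd', -, hV⟩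
    exact ⟨hE'.n0, hE'.n1, hE'.n2, hE'.n12, hd', hV⟩

end Blocks

end RealRAM

end


/-! ### Initialisation and the whole program. -/

noncomputable section

namespace RealRAM

section Setup

variable {d : ℕ} {T : Tape d}

/-- The memory while the order `k` of the moment tensor is determined. -/
structure Preparing (d : ℕ) (ε t : ℝ) (k : ℕ) (s : State) : Prop where
  n0 : s.nat 0 = d
  n1 : s.nat 1 = 1
  n2 : s.nat 2 = d + 32
  n3 : s.nat 3 = 2 * d + 32
  n4 : s.nat 4 = 3 * d + 32
  n5 : s.nat 5 = 3 * d + 33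
  n6 : s.nat 6 = 4 * d + 34
  n7 : s.nat 7 = d + 1
  n8 : s.nat 8 = k
  n10 : s.nat 10 = 4 * d + 34 + (d + 1)
  n11 : s.nat 11 = 2
  n12 : s.nat 12 = 0
  r0 : s.real 0 = ε
  r2 : s.real 2 = 1
  r3 : s.real 3 = 2
  r4 : s.real 4 = d ^ 2
  r5 : s.real 5 = t ^ 2 + 3
  r6 : s.real 6 = k
  r7 : s.real 7 = d ^ k
  zero : ∀ i ≥ 16, s.real i = 0
  drawn : s.drawn = 0

def constants : List Instr :=
  [.natConst 1 1, .natConst 11 2, .natConst 15 32, .natAdd 2 0 15]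

def addresses : List Instr :=
  [.natAdd 3 2 0, .natAdd 4 3 0, .natAdd 5 4 1, .natAdd 7 0 1, .natAdd 6 5 7, .natAdd 10 6 7,
    .ofNat 2 1, .ofNat 3 11, .ofNat 4 0, .mul 4 4 4, .mul 5 1 1, .add 5 5 2, .add 5 5 3, .ofNat 7 1]

/-- The order is kept both as a natural number, for loop limits, and as a real number, for the
comparison with t² + 3. Steps of 2 keep it even, and d^k grows by the stored d². -/
def orderBody : List Instr := [.natAdd 8 8 11, .add 6 6 3, .mul 7 7 4]

/-- Real cell 10 becomes (d^m)^8 by three squarings; real cell 11 becomes its cube times (d^m)³,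
that is (d^m)^27, divided twice by ε. -/
def parameters : List Instr :=
  [.natAdd 9 8 1, .add 12 6 2, .sqrt 12 12, .div 8 2 12, .sqrt 9 6, .div 9 9 12,
    .mul 10 7 7, .mul 10 10 10, .mul 10 10 10, .mul 11 10 10, .mul 11 11 10, .mul 11 11 7,
    .mul 11 11 7, .mul 11 11 7, .div 11 11 0, .div 11 11 0]

/-- The part of the program for dimension at least two. -/
def learn : Prog :=
  .seq (block addresses) <|
  .seq (.while (.lt 6 5) (block orderBody)) <|
  .seq (block parameters) (.while (.lt 16 10) blockBody)

/-- The whole program. In dimension one it normalises a single example. -/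
def program : Prog :=
  .seq (block constants) <| .seq (.ite (.natLt 1 0) learn (.instr (.draw 2))) finish

/-- The order of the moment tensor, an even number between `t ^ 2 + 3` and `t ^ 2 + 5`. -/
def order (t : ℝ) : ℕ := 2 * ⌈(t ^ 2 + 3) / 2⌉₊

theorem le_order (t : ℝ) : t ^ 2 + 3 ≤ order t := by
  have := Nat.le_ceil ((t ^ 2 + 3) / 2)
  rw [order]
  push_cast
  linarith

theorem order_le (t : ℝ) : order t ≤ t ^ 2 + 5 := by
  have := Nat.ceil_lt_add_one (a := (t ^ 2 + 3) / 2) (by positivity)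
  rw [order]
  push_cast
  linarith

/-- The number of blocks. -/
def numBlocks (d m : ℕ) : ℕ := (d ^ m) ^ 8

/-- The number of groups in a block. -/
def numGroups (d m : ℕ) (ε : ℝ) : ℕ := ⌈((d : ℝ) ^ m) ^ 27 / ε / ε⌉₊

theorem run_constants (ε t : ℝ) : ∃ s, run T constants (initial d ε t) = s ∧ s.nat 0 = d ∧
    s.nat 1 = 1 ∧ s.nat 2 = d + 32 ∧ s.nat 8 = 0 ∧ s.nat 11 = 2 ∧ s.nat 12 = 0 ∧
    s.real = (initial d ε t).real ∧ s.drawn = 0 := by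
  refine ⟨_, rfl, ?_⟩
  simp [constants, run, Instr.eval, State.setNat, initial]

theorem reaches_order {s : State} {ε t : ℝ} (hs : Preparing d ε t 0 s) :
    Reaches T (.while (.lt 6 5) (block orderBody)) s (2 * order t + 1)
      (Preparing d ε t (order t)) := by
  refine (Reaches.while ⌈(t ^ 2 + 3) / 2⌉₊ 3 (fun k s' => Preparing d ε t (2 * k) s')
    ?_ ?_ hs).mono (by rw [order]; omega) fun _ h => h
  · intro k hk s' h
    have h1 := Nat.lt_ceil.1 hk
    refine ⟨by simp only [Test.Holds, h.r6, h.r5]; push_cast; linarith, ?_⟩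
    refine reaches_block _ _ ?_
    simp (disch := omega) only [orderBody, run, Instr.eval, State.setNat, State.setReal,
      Function.update_of_ne, h.n8, h.n11, h.r3, h.r4, h.r6, h.r7]
    constructor <;> simp (disch := omega) only [Function.update_self, Function.update_of_ne,
      h.n0, h.n1, h.n2, h.n3, h.n4, h.n5, h.n6, h.n7, h.n10, h.n11, h.n12, h.r0, h.r2, h.r3,
      h.r4, h.r5, h.drawn]
    · ring
    · push_cast; ring
    · ring
    · intro i hi
      simp (disch := omega) only [Function.update_of_ne]
      exact h.zero i hi
  · intro s' h
    simp only [Test.Holds, h.r6, h.r5, not_lt]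
    exact le_order t

theorem reaches_learn {s : State} {ε t : ℝ} (hd : 0 < d) (h0 : s.nat 0 = d) (h1 : s.nat 1 = 1)
    (h2 : s.nat 2 = d + 32) (h8 : s.nat 8 = 0) (h11 : s.nat 11 = 2) (h12 : s.nat 12 = 0)
    (hr : s.real = (initial d ε t).real) (hdr : s.drawn = 0) :
    Reaches T learn s (14 + ((2 * order t + 1) + (16 + (numBlocks d (order t) *
        (41 * ((d + 1) * (order t + 1) * (numGroups d (order t) ε + 1)) + 1) + 1)))) fun s' =>
      s'.nat 0 = d ∧ s'.nat 1 = 1 ∧ s'.nat 2 = d + 32 ∧ s'.nat 12 = 0 ∧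
      s'.drawn = numBlocks d (order t) * ((numGroups d (order t) ε + 1) * (order t + 1)) ∧
      Vec s' (d + 32) (streamSum ⟨0, hd⟩ (1 / √(order t + 1)) (√(order t) / √(order t + 1))
        (order t) (numGroups d (order t) ε) (numBlocks d (order t)) T.1) := by
  have hr0 : s.real 0 = ε := by rw [hr]; simp [initial]
  have hr1 : s.real 1 = t := by rw [hr]; simp [initial]
  have hr6 : s.real 6 = 0 := by rw [hr]; simp [initial]
  refine Reaches.seq (Q := Preparing d ε t 0) ((reaches_block addresses _ ?_).mono (c' := 14)
    (by simp [addresses, Instr.cost]) fun _ h => h) ?_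
  · simp (disch := omega) only [addresses, run, Instr.eval, State.setNat,
      State.setReal, Function.update_self, Function.update_of_ne, h0, h1, h11, hr1]
    constructor <;> simp (disch := omega) only [Function.update_self, Function.update_of_ne, h0,
      h1, h2, h8, h11, h12, hr0, hr6, hdr]
    all_goals try ring1
    all_goals try norm_num
    intro i hi
    simp (disch := omega) only [Function.update_of_ne]
    rw [hr, initial]
    simp only
    rw [if_neg (by omega), if_neg (by omega)]
  intro s₁ h1
  refine (reaches_order h1).seq ?_
  intro s₂ h
  set m := order t with hm
  refine Reaches.seq (Q := fun s' => Env d m (1 / √(m + 1)) (√m / √(m + 1))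
    (((d : ℝ) ^ m) ^ 27 / ε / ε) (((d : ℝ) ^ m) ^ 8) s' ∧ s'.drawn = 0 ∧
    ∀ i ≥ 16, s'.real i = 0) 
    ((reaches_block parameters _ ?_).mono (c' := 16) (by simp [parameters, Instr.cost])
      fun _ h => h) ?_
  · simp (disch := omega) only [parameters, run, Instr.eval, State.setNat, State.setReal,
      Function.update_self, Function.update_of_ne, h.n1, h.n8, h.r0, h.r2, h.r6, h.r7]
    refine ⟨?_, h.drawn, fun i hi => ?_⟩
    · constructor <;> simp (disch := omega) only [Function.update_self, Function.update_of_ne,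
        h.n0, h.n1, h.n2, h.n3, h.n4, h.n5, h.n6, h.n7, h.n8, h.n10, h.n12, h.r2, h.r3]
      · ring
      · ring
    · simp (disch := omega) only [Function.update_of_ne]
      exact h.zero i hi
  rintro s₃ ⟨hE, hd3, hz⟩
  have hceil : ⌈((d : ℝ) ^ m) ^ 8⌉₊ = numBlocks d m := by
    rw [numBlocks]
    exact_mod_cast Nat.ceil_natCast ((d ^ m) ^ 8)
  have := reaches_blocks (T := T) hE hd hd3 (hz 16 le_rfl) fun a => hz _ (by omega)
  rwa [hceil] at this

/-- In dimension at least two the program outputs the normalised sum over all groups. -/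
theorem reaches_program (hd : 1 < d) (ε t : ℝ) :
    Reaches T program (initial d ε t)
      (4 + (((14 + ((2 * order t + 1) + (16 + (numBlocks d (order t) *
        (41 * ((d + 1) * (order t + 1) * (numGroups d (order t) ε + 1)) + 1) + 1)))) + 1) +
        (17 * d + 8))) fun s' =>
      s'.drawn = numBlocks d (order t) * ((numGroups d (order t) ε + 1) * (order t + 1)) ∧
      ∃ v, v = streamSum ⟨0, by omega⟩ (1 / √(order t + 1)) (√(order t) / √(order t + 1))
        (order t) (numGroups d (order t) ε) (numBlocks d (order t)) T.1 ∧
      output d s' = ‖v‖⁻¹ • v := by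
  obtain ⟨s, hs, h0, h1, h2, h8, h11, h12, hr, hdr⟩ := run_constants (T := T) ε t
  refine (reaches_block constants _ (Q := fun s' => s' = s) hs).seq ?_
  rintro _ rfl
  obtain ⟨n, s', he, hn, h0', h1', h2', h12', hdr', hV⟩ :=
    reaches_learn (T := T) (by omega) h0 h1 h2 h8 h11 h12 hr hdr
  refine Reaches.seq (Q := fun s'' => s'' = s')
    ⟨n + 1, s', .ite_true (by simpa only [Test.Holds, h0, h1] using hd) he, by omega, rfl⟩ ?_
  rintro _ rfl
  exact (reaches_finish h0' h1' h2' h12' _ hV).mono le_rfl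
    fun s'' h => ⟨h.1.trans hdr', _, rfl, h.2⟩

/-- In dimension one the program outputs the sign of the first example. -/
theorem reaches_program_one {T : Tape 1} (ε t : ℝ) :
    Reaches T program (initial 1 ε t) 32 fun s' => s'.drawn = 1 ∧
      output 1 s' = ‖(T.1 0).1‖⁻¹ • (T.1 0).1 := by
  obtain ⟨s, hs, h0, h1, h2, h8, h11, h12, hr, hdr⟩ := run_constants (T := T) ε t
  refine Reaches.mono (c := 4 + (3 + (17 * 1 + 8))) ?_ (by norm_num) fun _ h => h
  refine (reaches_block constants _ (Q := fun s' => s' = s) hs).seq ?_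
  rintro s₁ rfl
  refine Reaches.seq (Q := fun s'' => s'' = (Instr.draw 2).eval T s₁)
    ⟨2 + 1, _, .ite_false (by simp only [Test.Holds, h0, h1]; omega) (.instr _ _), by omega, rfl⟩ ?_
  rintro _ rfl
  refine (reaches_finish (s := (Instr.draw 2).eval T s₁) h0 h1 h2 h12 (T.1 0).1 fun a => ?_).mono le_rfl fun s'' h => ⟨?_, h.2⟩
  · simp only [Instr.eval, h2, hdr]
    exact writeExample_coord _ _ _ _
  · rw [h.1]
    simp only [Instr.eval, hdr]

end Setup

end RealRAM

end


/-! ### Resource bounds and the law of the sample stream. -/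

noncomputable section

namespace RealRAM

/-! ### Resource bounds -/

section Bounds

variable {d m : ℕ} {ε : ℝ}

theorem pow_le_numBlocks (hd : 1 < d) (hm : 4 ≤ m) : 64 ^ (m + 1) ≤ numBlocks d m := by
  calc 64 ^ (m + 1) = 2 ^ (6 * (m + 1)) := by rw [pow_mul]; norm_num
    _ ≤ 2 ^ (m * 8) := Nat.pow_le_pow_right (by norm_num) (by omega)
    _ ≤ d ^ (m * 8) := Nat.pow_le_pow_left hd _
    _ = _ := by rw [numBlocks, pow_mul]

theorem le_numGroups (d m : ℕ) (hε : 0 < ε) :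
    (d : ℝ) ^ (27 * m) ≤ numGroups d m ε * ε ^ 2 := by
  have h := Nat.le_ceil (((d : ℝ) ^ m) ^ 27 / ε / ε)
  rw [div_div, div_le_iff₀ (by positivity), ← pow_mul, mul_comm m] at h
  rw [numGroups, sq, div_div, ← pow_mul, mul_comm m]
  exact h

/-- As d ≥ 2, constants become powers of d: 25600 ≤ 2^15, 4096 = 2^12 and d + 1 ≤ d². The total
exponent 22m + 16 is at most 27m because m ≥ 4. -/
theorem numGroups_large (hd : 1 < d) (hm : 4 ≤ m) (hε : 0 < ε) :
    25600 * (numBlocks d m * d * (d + 1) ^ m) * 4096 ^ m ≤ numGroups d m ε * ε ^ 2 := by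
  have hd2 : (2 : ℝ) ≤ d := by exact_mod_cast hd
  refine le_trans ?_ (le_numGroups d m hε)
  calc (25600 * (numBlocks d m * d * (d + 1) ^ m) * 4096 ^ m : ℝ)
      ≤ d ^ 15 * ((d ^ m) ^ 8 * d * (d ^ 2) ^ m) * (d ^ 12) ^ m := by
        rw [numBlocks]
        push_cast
        gcongr
        · have := pow_le_pow_left₀ (by norm_num) hd2 15
          linarith
        · nlinarith
        · have := pow_le_pow_left₀ (by norm_num) hd2 12
          linarith
    _ = (d : ℝ) ^ (22 * m + 16) := by ring
    _ ≤ _ := pow_le_pow_right₀ (by linarith) (by omega)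

/-- The factor d + 1 is the price of reading one example, so the same bound serves for samples and
for steps. -/
theorem numSamples_le (hd : 1 < d) (hε : 0 < ε) (hε1 : ε < 1) :
    ((d + 1) * (numBlocks d m * ((numGroups d m ε + 1) * (m + 1))) : ℝ) ≤
      (d : ℝ) ^ (36 * m + 4) / ε ^ 2 := by
  have hd2 : (2 : ℝ) ≤ d := by exact_mod_cast hd
  have h1 : (1 : ℝ) ≤ (d : ℝ) ^ (27 * m) / ε ^ 2 := by
    rw [le_div_iff₀ (by positivity), one_mul]
    exact (pow_le_one₀ hε.le hε1.le).trans (one_le_pow₀ (by linarith))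
  have h2 : (numGroups d m ε : ℝ) < (d : ℝ) ^ (27 * m) / ε ^ 2 + 1 := by
    have := Nat.ceil_lt_add_one (a := ((d : ℝ) ^ m) ^ 27 / ε / ε) (by positivity)
    rwa [← numGroups, div_div, ← pow_mul, mul_comm m, ← sq] at this
  have h3 : (numGroups d m ε + 1 : ℝ) ≤ d ^ 2 * (d ^ (27 * m) / ε ^ 2) := by
    have : (4 : ℝ) ≤ d ^ 2 := by nlinarith
    nlinarith
  have h4 : (m + 1 : ℝ) ≤ d ^ m := by
    have : m + 1 ≤ 2 ^ m := Nat.lt_two_pow_self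
    calc (m + 1 : ℝ) ≤ 2 ^ m := by exact_mod_cast this
      _ ≤ _ := by gcongr
  calc _ ≤ (d : ℝ) ^ 2 * ((d ^ m) ^ 8 * ((d ^ 2 * (d ^ (27 * m) / ε ^ 2)) * d ^ m)) := by
        rw [numBlocks]
        push_cast
        gcongr
        nlinarith
    _ = _ := by ring

theorem le_sampleBound {t : ℝ} (hd : 1 < d) (hε : 0 < ε) (hε1 : ε < 1) :
    ((d + 1) * (numBlocks d (order t) * ((numGroups d (order t) ε + 1) * (order t + 1))) : ℝ) ≤
      sampleBound 222 d ε t := by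
  have hd2 : (2 : ℝ) ≤ d := by exact_mod_cast hd
  refine (numSamples_le hd hε hε1).trans ?_
  rw [sampleBound]
  gcongr
  rw [← Real.rpow_natCast]
  refine Real.rpow_le_rpow_of_exponent_le (by linarith) ?_
  have := le_order t
  have := order_le t
  have h1 := le_max_left (t ^ 2) 1
  have h2 := le_max_right (t ^ 2) 1
  have h3 := sq_nonneg t
  have h4 : (4 : ℝ) ≤ order t := by
    have : (2 : ℝ) < order t := by linarith
    have : 2 < order t := by exact_mod_cast this
    have : 4 ≤ order t := by rw [order] at *; omega
    exact_mod_cast this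
  push_cast
  linarith

theorem one_le_sampleBound {C t : ℝ} (hd : 0 < d) (hC : 0 ≤ C) (hε : 0 < ε) (hε1 : ε < 1) :
    1 ≤ sampleBound C d ε t := by
  have hd1 : (1 : ℝ) ≤ d := by exact_mod_cast hd
  rw [sampleBound, le_div_iff₀ (by positivity), one_mul]
  exact (pow_le_one₀ hε.le hε1.le).trans (Real.one_le_rpow hd1 (by positivity))

theorem le_mul_sampleBound_rpow {C K t : ℝ} (hd : 0 < d) (hC : 0 ≤ C) (hK : 1 ≤ K) (hε : 0 < ε)
    (hε1 : ε < 1) : K * sampleBound C d ε t ≤ K * sampleBound C d ε t ^ K := by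
  have h := one_le_sampleBound (t := t) hd hC hε hε1
  gcongr
  simpa using Real.rpow_le_rpow_of_exponent_le h hK

theorem numSteps_le {t : ℝ} (hd : 1 < d) (hε : 0 < ε) (hε1 : ε < 1) :
    ((4 + (((14 + ((2 * order t + 1) + (16 + (numBlocks d (order t) *
      (41 * ((d + 1) * (order t + 1) * (numGroups d (order t) ε + 1)) + 1) + 1)))) + 1) +
      (17 * d + 8)) : ℕ) : ℝ) ≤ 107 * sampleBound 222 d ε t ^ (107 : ℝ) := by
  refine le_trans ?_ (le_mul_sampleBound_rpow (by omega) (by norm_num) (by norm_num) hε hε1)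
  refine le_trans ?_ (mul_le_mul_of_nonneg_left (le_sampleBound (t := t) hd hε hε1) (by norm_num))
  set m := order t
  set n := numGroups d m ε
  have hR : 1 ≤ numBlocks d m := Nat.one_le_pow _ _ (Nat.pow_pos (by omega))
  set R := numBlocks d m
  have h1 : R * (d + 1) ≤ (d + 1) * (R * ((n + 1) * (m + 1))) := by
    have : 1 ≤ (n + 1) * (m + 1) := Nat.succ_le_of_lt (by positivity)
    calc R * (d + 1) = (d + 1) * (R * 1) := by ring
      _ ≤ _ := by gcongr
  have h2 : m ≤ (d + 1) * (R * ((n + 1) * (m + 1))) := by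
    calc m ≤ 1 * (1 * (1 * (m + 1))) := by omega
      _ ≤ _ := by gcongr <;> omega
  have h3 : d + 1 ≤ R * (d + 1) := Nat.le_mul_of_pos_left _ hR
  have h4 : R ≤ R * (d + 1) := Nat.le_mul_of_pos_right _ (by omega)
  have h5 : R * (41 * ((d + 1) * (m + 1) * (n + 1)) + 1) =
      41 * ((d + 1) * (R * ((n + 1) * (m + 1)))) + R := by ring
  rw [h5]
  have h6 : 1 ≤ R * (d + 1) := by omega
  have : 4 + ((14 + (2 * m + 1 + (16 + (41 * ((d + 1) * (R * ((n + 1) * (m + 1)))) + R + 1))) + 1) +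
      (17 * d + 8)) ≤ 107 * ((d + 1) * (R * ((n + 1) * (m + 1)))) := by omega
  exact_mod_cast this

end Bounds

/-! ### The law of the samples -/

section Law

variable {d m : ℕ}

theorem streamVec_apply (a₀ : Fin d) (c σ : ℝ) (S : ℕ → Example d) (p q : ℕ) (a : Fin d) :
    streamVec a₀ c σ m S p q a = sampleVec a₀ c σ (fun i : Fin (m + 1) => S (p + i))
      (fun i : Fin (m + 1) => S (q + i)) a := by
  have hx : pos (fun i : Fin (m + 1) => S (q + i)) 0 = (S q).1 := by simp [pos]
  have hζ : ∀ j < m, (S (q + 1 + j)).1 =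
      ext0 (Fin.tail (pos (fun i : Fin (m + 1) => S (q + i)))) j := by
    intro j hj
    rw [ext0, dif_pos hj]
    simp only [Fin.tail, pos, Fin.val_succ]
    rw [add_assoc, add_comm 1 j]
  simp only [streamVec, PiLp.smul_apply, smul_eq_mul, sampleVec, splitAll, Fin.cons_zero,
    Fin.cons_succ, hx]
  rw [resid_congr c σ (S q).1 hζ, Finset.prod_range]
  congr 2
  refine Finset.prod_congr rfl fun i _ => ?_
  rw [split_congr c σ (S q).1 fun j hj => hζ j (by omega)]
  simp [pos]

/-- The arrangement of a stream of examples in blocks of groups. -/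
def blocks (R n m : ℕ) (S : ℕ → Example d) : Fin R → Fin (n + 1) → Fin (m + 1) → Example d :=
  fun r j i => S (finProdFinEquiv (r, finProdFinEquiv (j, i)))

theorem sum_ofLp_apply {ι : Type*} (t : Finset ι) (f : ι → EuclideanSpace ℝ (Fin d)) (a : Fin d) :
    (∑ i ∈ t, f i) a = ∑ i ∈ t, f i a := by
  rw [WithLp.ofLp_sum, Finset.sum_apply]

theorem streamSum_eq (a₀ : Fin d) (c σ : ℝ) (m n R : ℕ) (S : ℕ → Example d) :
    streamSum a₀ c σ m n R S = learnerVec a₀ c σ (blocks R n m S) := by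
  ext a
  rw [streamSum, learnerVec, Finset.sum_range, sum_ofLp_apply]
  refine Finset.sum_congr rfl fun r _ => ?_
  rw [Finset.sum_range, sum_ofLp_apply]
  refine Finset.sum_congr rfl fun j _ => ?_
  rw [streamVec_apply]
  congr 1 <;> ext1 i <;> simp only [blocks, finProdFinEquiv_apply_val] <;> congr 1 <;> simp <;> ring

variable {D : Measure (Example d)} [IsProbabilityMeasure D]

/-- Blocks use distinct positions of the stream, so their joint law is the restriction of an
infinite product along an injection, curried twice. -/
theorem measurePreserving_blocks (R n m : ℕ) :
    MeasurePreserving (blocks R n m) (Measure.infinitePi fun _ : ℕ => D) (blockLaw D R n m) := by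
  have hinj : Function.Injective fun p : Fin R × Fin (n + 1) × Fin (m + 1) =>
      ((finProdFinEquiv (p.1, finProdFinEquiv p.2) : Fin (R * ((n + 1) * (m + 1)))) : ℕ) := by
    intro p q h
    have h1 := finProdFinEquiv.injective (Fin.ext h)
    rw [Prod.mk.injEq] at h1
    exact Prod.ext h1.1 (finProdFinEquiv.injective h1.2)
  have h1 := Measure.map_infinitePi_infinitePi_of_inj (P := fun _ : ℕ => D) hinj
  have h2 := Measure.infinitePi_map_curry (ι := Fin R) (κ := Fin (n + 1) × Fin (m + 1))
    (fun _ _ => D)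
  have h3 := Measure.infinitePi_map_curry (ι := Fin (n + 1)) (κ := Fin (m + 1)) (fun _ _ => D)
  have h4 := Measure.infinitePi_map_pi
    (μ := fun _ : Fin R => Measure.infinitePi fun _ : Fin (n + 1) × Fin (m + 1) => D)
    (f := fun _ => MeasurableEquiv.curry (Fin (n + 1)) (Fin (m + 1)) (Example d))
    (fun _ => MeasurableEquiv.measurable _)
  refine ⟨by unfold blocks; fun_prop, ?_⟩
  have e : (blocks R n m : (ℕ → Example d) → _) =
      (fun ω i => MeasurableEquiv.curry (Fin (n + 1)) (Fin (m + 1)) (Example d) (ω i)) ∘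
        (MeasurableEquiv.curry (Fin R) (Fin (n + 1) × Fin (m + 1)) (Example d)) ∘
        fun (S : ℕ → Example d) p => S (finProdFinEquiv (p.1, finProdFinEquiv p.2)) := rfl
  rw [e, ← Measure.map_map (by fun_prop) (by fun_prop), ← Measure.map_map (by fun_prop)
    (by fun_prop), h1, h2, h4, h3]
  simp_rw [Measure.infinitePi_eq_pi]

end Law

end RealRAM

end


/-! ### Correctness of the program. -/

noncomputable section

section Correctness

variable {d m : ℕ}

theorem measurable_pos {k : ℕ} (i : Fin k) :
    Measurable fun G : Fin k → Example d => pos G i :=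
  measurable_fst.comp (measurable_pi_apply i)

theorem measurable_ext0 {Ω : Type*} [MeasurableSpace Ω] {k : ℕ}
    {X : Ω → Fin k → EuclideanSpace ℝ (Fin d)} (hX : ∀ i, Measurable fun ω => X ω i) (i : ℕ) :
    Measurable fun ω => ext0 (X ω) i := by
  by_cases h : i < k
  · simpa only [ext0, h, dif_pos] using hX ⟨i, h⟩
  · simp only [ext0, h, dif_neg, not_false_eq_true, measurable_const]

theorem measurable_resid {Ω : Type*} [MeasurableSpace Ω] {c s : ℝ}
    {x : Ω → EuclideanSpace ℝ (Fin d)} {ζ : Ω → ℕ → EuclideanSpace ℝ (Fin d)} (hx : Measurable x)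
    (hζ : ∀ i, Measurable fun ω => ζ ω i) (i : ℕ) :
    Measurable fun ω => resid c s (x ω) (ζ ω) i := by
  induction i with
  | zero => exact hx
  | succ i ih => exact (ih.const_smul s).sub ((hζ i).const_smul c)

theorem measurable_splitAll_pos (c s : ℝ) (i : Fin (m + 1)) :
    Measurable fun G : Fin (m + 1) → Example d => splitAll c s (pos G) i := by
  have h : ∀ j, Measurable fun G : Fin (m + 1) → Example d => ext0 (Fin.tail (pos G)) j :=
    measurable_ext0 fun j => measurable_pos j.succ
  refine Fin.cases ?_ (fun i => ?_) i
  · exact measurable_resid (measurable_pos 0) h m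
  · exact ((measurable_resid (measurable_pos 0) h i).const_smul c).add ((h i).const_smul s)

theorem measurable_learnerVec (a₀ : Fin d) (c s : ℝ) (R n : ℕ) :
    Measurable fun ω : Fin R → Fin (n + 1) → Fin (m + 1) → Example d => learnerVec a₀ c s ω := by
  have hz : ∀ r (i : Fin (m + 1)), Measurable fun ω : Fin R → Fin (n + 1) → Fin (m + 1) →
      Example d => pos (ω r 0) i := fun r i => (measurable_pos i).comp (by fun_prop)
  have hg : ∀ r (j : Fin n) (i : Fin (m + 1)), Measurable fun ω : Fin R → Fin (n + 1) →
      Fin (m + 1) → Example d => splitAll c s (pos (ω r j.succ)) i :=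
    fun r j i => (measurable_splitAll_pos c s i).comp (by fun_prop)
  have hl : ∀ r (j : Fin n), Measurable fun ω : Fin R → Fin (n + 1) → Fin (m + 1) →
      Example d => lbl (ω r j.succ 0) := fun r j => measurable_lbl.comp (by fun_prop)
  have hcoord : ∀ a : Fin d, Measurable fun x : EuclideanSpace ℝ (Fin d) => x a :=
    fun a => by fun_prop
  refine (WithLp.measurable_toLp 2 (Fin d → ℝ)).comp (measurable_pi_lambda _ fun a => ?_)
  refine Finset.measurable_sum _ fun r _ => Finset.measurable_sum _ fun j _ => ?_
  refine Measurable.mul (Measurable.mul (Measurable.mul ((hcoord a₀).comp (hz r 0)) (hl r j)) ?_)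
    ((hcoord a).comp (hg r j 0))
  exact Finset.measurable_prod _ fun i _ => measurable_const.add ((hg r j i.succ).inner (hz r i.succ))

theorem max_rpow_le_one {L A b ε : ℝ} (hε : 0 < ε) (hε1 : ε < 1) (hA : 0 < A) (hb : 0 ≤ b) :
    max ((max L 2) ^ (-b)) (ε ^ A) ≤ 1 :=
  max_le (Real.rpow_le_one_of_one_le_of_nonpos ((by norm_num : (1 : ℝ) ≤ 2).trans (le_max_right _ _))
    (by linarith)) (Real.rpow_le_one hε.le hε1.le hA.le)

theorem gauss_Ioi_zero : gauss.real (Set.Ioi 0) = 1 / 2 := by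
  have h1 : gauss.real (Set.Iio 0) = gauss.real (Set.Ioi 0) := by
    have h := gaussianReal_map_neg (μ := 0) (v := 1)
    rw [neg_zero] at h
    have hp : MeasurePreserving (fun x : ℝ => -x) gauss gauss := ⟨measurable_neg, h⟩
    rw [← hp.measureReal_preimage measurableSet_Iio.nullMeasurableSet]
    congr 1
    ext x
    simp
  have : NullSingletonClass gauss := nullSingletonClass_gaussianReal one_ne_zero
  have h2 : gauss.real (Set.Iic 0) = gauss.real (Set.Iio 0) :=
    measureReal_congr Iio_ae_eq_Iic.symm
  have h3 := probReal_compl_eq_one_sub (μ := gauss) (measurableSet_Iic (a := (0 : ℝ)))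
  rw [Set.compl_Iic] at h3
  linarith

theorem inner_normalize_one {x w : EuclideanSpace ℝ (Fin 1)} (hw : ‖w‖ = 1)
    (h : 0 < inner ℝ w x) : ‖‖x‖⁻¹ • x‖ = 1 ∧ inner ℝ (‖x‖⁻¹ • x) w = 1 := by
  have hx : x ≠ 0 := by
    rintro rfl
    simp at h
  have hx' : 0 < ‖x‖ := norm_pos_iff.2 hx
  have e : inner ℝ w x = ‖x‖ := by
    have e1 : inner ℝ w x = x 0 * w 0 := by simp [PiLp.inner_apply]
    have e2 : ‖x‖ = |x 0| := by simp [EuclideanSpace.norm_eq, Real.sqrt_sq_eq_abs]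
    have e3 : ‖w‖ = |w 0| := by simp [EuclideanSpace.norm_eq, Real.sqrt_sq_eq_abs]
    rw [e1] at h ⊢
    rw [← abs_of_pos h, abs_mul, ← e2, ← e3, hw, mul_one]
  refine ⟨norm_smul_inv_norm hx, ?_⟩
  rw [real_inner_smul_left, real_inner_comm, e, inv_mul_cancel₀ hx'.ne']

namespace RealRAM

variable {D : Measure (Example d)} [IsProbabilityMeasure D]

theorem measurePreserving_samples :
    MeasurePreserving (Prod.fst : Tape d → _) (tapeLaw D) (Measure.infinitePi fun _ : ℕ => D) :=
  measurePreserving_fst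

/-- The success event E is described by runs and need not be known to be measurable; a measurable
event F about the samples bounds its outer measure from below. -/
theorem le_tapeLaw_of_le_real {E : Set (Tape d)} {Ω : Type*} [MeasurableSpace Ω] {ν : Measure Ω}
    [IsProbabilityMeasure ν] {f : (ℕ → Example d) → Ω}
    (hf : MeasurePreserving f (Measure.infinitePi fun _ : ℕ => D) ν) {F : Set Ω}
    (hF : MeasurableSet F) {p : ℝ} (hp : p ≤ ν.real F) (h : ∀ T : Tape d, f T.1 ∈ F → T ∈ E) :
    ENNReal.ofReal p ≤ tapeLaw D E := by
  have hm := hf.comp (measurePreserving_samples (D := D))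
  calc ENNReal.ofReal p ≤ ENNReal.ofReal (ν.real F) := ENNReal.ofReal_le_ofReal hp
    _ = ν F := ofReal_measureReal
    _ = tapeLaw D ((f ∘ Prod.fst) ⁻¹' F) := (hm.measure_preimage hF.nullMeasurableSet).symm
    _ ≤ tapeLaw D E := measure_mono fun T hT => h T hT

/-- The normalised example equals w whenever ⟨w, x⟩ > 0, an event of probability 1/2, and the
required correlation is at most 1. -/
theorem program_succeeds_one {D : Measure (Example 1)} [IsProbabilityMeasure D] {ε t A b : ℝ}
    {w : EuclideanSpace ℝ (Fin 1)} (hε : 0 < ε) (hε1 : ε < 1) (hA : 0 < A) (hb : 0 ≤ b)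
    (hw : ‖w‖ = 1) (hD : D.map Prod.fst = gaussE 1) :
    ENNReal.ofReal (3 / 100) ≤ tapeLaw D {T | ∃ (n : ℕ) (s : State),
      Exec T program (initial 1 ε t) n s ∧ ‖output 1 s‖ = 1 ∧
      max ((max (Real.log (1 / ε)) 2) ^ (-b)) (ε ^ A) ≤ inner ℝ (output 1 s) w} := by
  have hmp : MeasurePreserving (fun S : ℕ → Example 1 => (inner ℝ w (S 0).1 : ℝ))
      (Measure.infinitePi fun _ : ℕ => D) gauss :=
    ((measurePreserving_inner hw).comp (measurePreserving_fst_of_map hD)).comp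
      (measurePreserving_eval_infinitePi (fun _ : ℕ => D) 0)
  refine le_tapeLaw_of_le_real hmp measurableSet_Ioi (by rw [gauss_Ioi_zero]; norm_num)
    fun T hT => ?_
  obtain ⟨n, s, hs, -, -, ho⟩ := reaches_program_one (T := T) ε t
  obtain ⟨h1, h2⟩ := inner_normalize_one hw hT
  refine ⟨n, s, hs, ?_, ?_⟩
  · rw [ho, h1]
  · rw [ho, h2]
    exact max_rpow_le_one hε hε1 hA hb

theorem exists_program_succeeds (C₀ : ℝ) : ∃ A : ℝ, 0 < A ∧
    ∀ (d : ℕ) (ε t : ℝ) (w : EuclideanSpace ℝ (Fin d)) (D : Measure (Example d))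
      [IsProbabilityMeasure D], 0 < ε → ε < 1 → ‖w‖ = 1 → |t| ≤ C₀ * √(Real.log (1 / ε)) →
      D.map Prod.fst = gaussE d → ReliabilityCondition D (halfspace w t) →
      ENNReal.ofReal ε ≤ D {z | z.2 = -1} →
      ENNReal.ofReal (3 / 100) ≤ tapeLaw D {T | ∃ (n : ℕ) (s : State),
        Exec T program (initial d ε t) n s ∧ ‖output d s‖ = 1 ∧
        max ((max (Real.log (1 / ε)) 2) ^ (-(59 * max (t ^ 2) 1))) (ε ^ A) ≤
          inner ℝ (output d s) w} := by
  obtain ⟨A, hA, hlearn⟩ := exists_exponent C₀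
  refine ⟨A, hA, fun d ε t w D _ hε hε1 hw ht hD hrel hεD => ?_⟩
  rcases lt_trichotomy d 1 with hd | rfl | hd
  · obtain rfl : d = 0 := by omega
    simp [Subsingleton.elim w 0] at hw
  · exact program_succeeds_one hε hε1 hA (by positivity) hw hD
  have h4 : 4 ≤ order t := by
    have h1 := le_order t
    have h2 : (2 : ℝ) < order t := by nlinarith [sq_nonneg t]
    have h3 : 2 < order t := by exact_mod_cast h2
    rw [order] at *
    omega
  have hμ := hlearn d (order t) ε t w D (numBlocks d (order t)) (numGroups d (order t) ε)
    ⟨0, by omega⟩ hε hε1 hw ht hD hrel hεD (by rw [order]; exact even_two_mul _) (le_order t)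
    (order_le t) (pow_le_numBlocks hd h4) (numGroups_large hd h4 hε)
  have hmeas := measurable_learnerVec (m := order t) (⟨0, by omega⟩ : Fin d)
    (1 / √(order t + 1)) (√(order t) / √(order t + 1)) (numBlocks d (order t))
    (numGroups d (order t) ε)
  have hin := hmeas.inner (𝕜 := ℝ) (measurable_const (a := w))
  refine le_tapeLaw_of_le_real (measurePreserving_blocks _ _ _) ?_ hμ fun T hT => ?_
  · exact (measurableSet_lt measurable_const hin).inter
      (measurableSet_le (hmeas.norm.const_mul _) hin)
  · obtain ⟨n, s, hs, -, -, v, hv, ho⟩ := reaches_program (T := T) hd ε t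
    rw [streamSum_eq] at hv
    rw [Set.mem_ofPred_eq, ← hv] at hT
    obtain ⟨hpos, hcorr⟩ := hT
    -- Strict positivity of the inner product is part of the event precisely so that the normalised
    -- output is a unit vector.
    have hv0 : v ≠ 0 := by
      rintro h
      simp [h] at hpos
    have hn : 0 < ‖v‖ := norm_pos_iff.2 hv0
    refine ⟨n, s, hs, ?_, ?_⟩
    · rw [ho]
      exact norm_smul_inv_norm hv0
    · rw [ho, real_inner_smul_left, le_inv_mul_iff₀ hn, mul_comm]
      exact hcorr

theorem program_resources {d : ℕ} (hd : 0 < d) {ε : ℝ} (hε : 0 < ε) (hε1 : ε < 1) (t : ℝ)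
    (T : Tape d) : ∃ (n : ℕ) (s : State), Exec T program (initial d ε t) n s ∧
      (s.drawn : ℝ) ≤ sampleBound 222 d ε t ∧
      (n : ℝ) ≤ 107 * sampleBound 222 d ε t ^ (107 : ℝ) := by
  rcases eq_or_lt_of_le (Nat.succ_le_of_lt hd) with h | hd1
  · obtain rfl : d = 1 := h.symm
    obtain ⟨n, s, hs, hn, hdr, -⟩ := reaches_program_one (T := T) ε t
    have h1 := one_le_sampleBound (C := 222) (t := t) hd (by norm_num) hε hε1
    refine ⟨n, s, hs, by rw [hdr]; exact_mod_cast h1, ?_⟩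
    have h2 := le_mul_sampleBound_rpow (C := 222) (K := 107) (t := t) hd (by norm_num)
      (by norm_num) hε hε1
    have h3 : (n : ℝ) ≤ 32 := by exact_mod_cast hn
    linarith
  · obtain ⟨n, s, hs, hn, hdr, -⟩ := reaches_program (T := T) hd1 ε t
    refine ⟨n, s, hs, ?_, (Nat.cast_le.2 hn).trans (numSteps_le hd1 hε hε1)⟩
    refine le_trans ?_ (le_sampleBound (t := t) hd1 hε hε1)
    rw [hdr]
    push_cast
    refine le_mul_of_one_le_left (by positivity) ?_
    have : (0 : ℝ) ≤ d := Nat.cast_nonneg d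
    linarith

end RealRAM

end Correctness

end

/-- There is a single program, with input `d`, `ε`, `t` and access to examples from `D`, which on
every run draws at most `N = d ^ O(max(t², 1)) / ε²` examples and halts within `poly(N)` steps, and
which with probability at least `p` outputs a unit vector that correlates with `w`. The constants
`C₁`, `C₂`, `K`, `p` are universal; only `A` depends on the constant `C₀` in
`|t| ≤ C₀ √(log (1/ε))`. -/
theorem mainTheorem3 :
    ∃ P : RealRAM.Prog, ∃ C₁ C₂ K p : ℝ, 0 < C₁ ∧ 0 < C₂ ∧ 0 < K ∧ 0 < p ∧
      ∀ C₀ : ℝ, 0 < C₀ → ∃ A : ℝ, 0 < A ∧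
        ∀ (d : ℕ) (ε t : ℝ) (w : EuclideanSpace ℝ (Fin d))
          (D : MeasureTheory.Measure (Example d)) [MeasureTheory.IsProbabilityMeasure D],
          0 < ε → ε < 1 → ‖w‖ = 1 →
          |t| ≤ C₀ * Real.sqrt (Real.log (1 / ε)) →
          D.map Prod.fst = ProbabilityTheory.stdGaussian (EuclideanSpace ℝ (Fin d)) →
          ReliabilityCondition D (halfspace w t) →
          ENNReal.ofReal ε ≤ D {z | z.2 = -1} →
          (∀ T : RealRAM.Tape d, ∃ (n : ℕ) (s : RealRAM.State),
            RealRAM.Exec T P (RealRAM.initial d ε t) n s ∧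
            (s.drawn : ℝ) ≤ sampleBound C₁ d ε t ∧
            (n : ℝ) ≤ K * sampleBound C₁ d ε t ^ K) ∧
          ENNReal.ofReal p ≤ RealRAM.tapeLaw D
            {T | ∃ (n : ℕ) (s : RealRAM.State),
              RealRAM.Exec T P (RealRAM.initial d ε t) n s ∧
              ‖RealRAM.output d s‖ = 1 ∧
              max ((max (Real.log (1 / ε)) 2) ^ (-(C₂ * max (t ^ 2) 1))) (ε ^ A) ≤
                inner ℝ (RealRAM.output d s) w} := by
  refine ⟨RealRAM.program, 222, 59, 107, 3 / 100, by norm_num, by norm_num, by norm_num,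
    by norm_num, fun C₀ _ => ?_⟩
  obtain ⟨A, hA, h⟩ := RealRAM.exists_program_succeeds C₀
  refine ⟨A, hA, fun d ε t w D _ hε hε1 hw ht hD hrel hεD => ⟨fun T => ?_, ?_⟩⟩
  · have hd : 0 < d := by
      rcases Nat.eq_zero_or_pos d with rfl | hd
      · simp [Subsingleton.elim w 0] at hw
      · exact hd
    exact RealRAM.program_resources hd hε hε1 t T
  · exact h d ε t w D hε hε1 hw ht hD hrel hεD
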